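/- Let $n\ge 2$, let $J=[a,b]\subset\mathbb{R}$ with $a<b$, and let $\gamma:J\to\mathbb{S}^n\subset\mathbb{R}^{n+1}$ be a smooth (positive) nondegenerate curve, i.e. $\gamma$ is $C^\infty$ and $\det(\gamma(t),\gamma'(t),\dots,\gamma^{(n)}(t))>0$ for all $t\in J$. Let $\mathfrak{F}_\gamma(t)\in SO_{n+1}$ be the Frenet frame, the matrix whose columns are obtained from $(\gamma(t),\gamma'(t),\dots,\gamma^{(n)}(t))$ by Gram--Schmidt orthonormalization. Let $\Pi:\mathrm{Spin}_{n+1}\to SO_{n+1}$ be the double covering, and let $\Gamma:J\to\mathrm{Spin}_{n+1}$ be a continuous lift of $\mathfrak{F}_\gamma$, i.e. $\Pi\circ\Gamma=\mathfrak{F}_\gamma$. Notation. Let $\mathrm{Lo}^1$ be the group of real lower triangular $(n+1)\times(n+1)$ matrices with unit diagonal and $\mathrm{Up}^+$ the group of real upper triangular ones with positive diagonal. For $z\in\mathrm{Spin}_{n+1}$, the triangular chart $\mathcal{U}_z\subset\mathrm{Spin}_{n+1}$ is the connected component containing $z$ of $\Pi^{-1}[\{Q\in SO_{n+1} : Q=\Pi(z)LU,\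 L\in\mathrm{Lo}^1,\ U\in\mathrm{Up}^+\}]$. For $z\in\mathrm{Spin}_{n+1}$ such that $\Pi(z)$ is a signed permutation matrix, the Bruhat cell $\mathrm{Bru}_z\subset\mathrm{Spin}_{n+1}$ is the connected component containing $z$ of $\Pi^{-1}[\{Q\in SO_{n+1} : Q=U_0\Pi(z)U_1,\ U_0,U_1\in\mathrm{Up}^+\}]$. For $1\le i\le n$, let $\alpha_i:\mathbb{R}\to\mathrm{Spin}_{n+1}$ be the one-parameter subgroup for which $\Pi(\alpha_i(\theta))$ is the rotation of angle $\theta$ from $e_i$ towards $e_{i+1}$ in the plane spanned by $e_i,e_{i+1}$; put $\acute a_i=\alpha_i(\pi/2)$, $\grave a_i=\acute a_i^{-1}$, and $$\acute\eta=\acute a_1\,\acute a_2\acute a_1\,\acute a_3\acute a_2\acute a_1\cdots\acute a_n\acute a_{n-1}\cdots\acute a_1,\qquad \grave\eta=\grave a_1\,\grave a_2\grave a_1\,\grave a_3\grave a_2\grave a_1\cdots\grave a_n\grave a_{n-1}\cdots\grave a_1.$$ Then the following conditions are equivalent: 1. $\gamma$ is strictly convex: for every nonzero linear functional $\omega$ on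 $\mathbb{R}^{n+1}$, the function $\omega\circ\gamma:J\to\mathbb{R}$ has at most $n$ zeroes, counted with multiplicities (endpoints of $J$ included); 2. $\Gamma$ is short: there exists $z\in\mathrm{Spin}_{n+1}$ such that $\Gamma[J]\subset\mathcal{U}_z$; 3. for all $t_0,t_+\in J$ with $t_0<t_+$, $\Gamma(t_+)\in\Gamma(t_0)\,\mathrm{Bru}_{\acute\eta}$; 4. for all $t_0,t_-\in J$ with $t_-<t_0$, $\Gamma(t_-)\in\Gamma(t_0)\,\mathrm{Bru}_{\grave\eta}$. -/

import Mathlib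

open scoped Pointwise ContDiff

noncomputable section

/-! ### Curves in the sphere and their Frenet frames -/

/-- The Euclidean space `ℝ^{n+1}`. -/
abbrev Euc (n : ℕ) : Type := EuclideanSpace ℝ (Fin (n + 1))

/-- The Wronski matrix of `γ` at `t`: its columns are the derivatives of `γ` at `t`
of orders `0, 1, …, n` (one-sided at the endpoints of the interval `J`). -/
def wronskiMatrix {n : ℕ} (γ : ℝ → Euc n) (J : Set ℝ) (t : ℝ) :
    Matrix (Fin (n + 1)) (Fin (n + 1)) ℝ :=
  Matrix.of fun i j => (iteratedDerivWithin (j : ℕ) γ J t) i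

/-- `γ : J → 𝕊^n` is a smooth, (positive) nondegenerate curve. -/
structure IsSmoothNondegenerate {n : ℕ} (γ : ℝ → Euc n) (J : Set ℝ) : Prop where
  smooth : ContDiffOn ℝ ∞ γ J
  mem_sphere : ∀ t ∈ J, γ t ∈ Metric.sphere (0 : Euc n) 1
  det_pos : ∀ t ∈ J, 0 < (wronskiMatrix γ J t).det

/-- The Frenet frame of `γ` at `t`: its columns are obtained from the derivatives of `γ` at `t`
of orders `0, 1, …, n` by Gram-Schmidt orthonormalization. -/
def frenetFrame {n : ℕ} (γ : ℝ → Euc n) (J : Set ℝ) (t : ℝ) :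
    Matrix (Fin (n + 1)) (Fin (n + 1)) ℝ :=
  Matrix.of fun i j =>
    (InnerProductSpace.gramSchmidtNormed ℝ
      (fun k : Fin (n + 1) => iteratedDerivWithin (k : ℕ) γ J t) j) i

/-! ### Strict convexity -/

/-- The multiplicity of `t` as a zero of `f : J → ℝ`: the least order of a derivative of `f` which
does not vanish at `t` (so `0` when `f t ≠ 0`), and `⊤` if all derivatives vanish. -/
def zeroMultiplicity (f : ℝ → ℝ) (J : Set ℝ) (t : ℝ) : ℕ∞ :=
  ⨅ (k : ℕ) (_ : iteratedDerivWithin k f J t ≠ 0), (k : ℕ∞)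

/-- The number of zeroes of `f : J → ℝ`, counted with multiplicities: the sum of all
multiplicities, that is, the supremum of the sums over finite subsets of `J`. -/
def zeroCount (f : ℝ → ℝ) (J : Set ℝ) : ℕ∞ :=
  ⨆ (S : Finset ℝ) (_ : (S : Set ℝ) ⊆ J), ∑ t ∈ S, zeroMultiplicity f J t

/-- `γ` is strictly convex on `J`: for every nonzero linear functional `f`, the function `f ∘ γ` has
at most `n` zeroes on `J`, counted with multiplicities. -/
def IsStrictlyConvexCurve {n : ℕ} (γ : ℝ → Euc n) (J : Set ℝ) : Prop :=
  ∀ f : Module.Dual ℝ (Euc n), f ≠ 0 → zeroCount (fun t => f (γ t)) J ≤ n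

/-! ### The spin group -/

/-- The quadratic form `v ↦ ⟪v, v⟫` on `ℝ^{n+1}`. -/
def eucForm (n : ℕ) : QuadraticForm ℝ (Euc n) := LinearMap.BilinMap.toQuadraticMap (innerₗ (Euc n))

/-- The canonical topology of the Clifford algebra as a finite-dimensional real vector space. -/
instance cliffordTopology (n : ℕ) : TopologicalSpace (CliffordAlgebra (eucForm n)) :=
  moduleTopology ℝ (CliffordAlgebra (eucForm n))

/-- The group `Spin_{n+1}`, with the topology induced by the one of the Clifford algebra. -/
abbrev Spin (n : ℕ) : Type := spinGroup (eucForm n)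

theorem exists_spin_conj {n : ℕ} (z : Spin n) (v : Euc n) :
    ∃ w : Euc n, CliffordAlgebra.ι (eucForm n) w =
      (z : CliffordAlgebra (eucForm n)) * CliffordAlgebra.ι (eucForm n) v *
        ((z⁻¹ : Spin n) : CliffordAlgebra (eucForm n)) := by
  obtain ⟨w, hw⟩ := spinGroup.conjAct_smul_ι_mem_range_ι (x := spinGroup.toUnits z) z.2 v
  exact ⟨w, by rw [hw, ConjAct.units_smul_def, ConjAct.ofConjAct_toConjAct]; rfl⟩

/-- The vector `z v z⁻¹`. -/
def spinConj {n : ℕ} (z : Spin n) (v : Euc n) : Euc n := Classical.choose (exists_spin_conj z v)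

theorem spinConj_spec {n : ℕ} (z : Spin n) (v : Euc n) :
    CliffordAlgebra.ι (eucForm n) (spinConj z v) =
      (z : CliffordAlgebra (eucForm n)) * CliffordAlgebra.ι (eucForm n) v *
        ((z⁻¹ : Spin n) : CliffordAlgebra (eucForm n)) :=
  Classical.choose_spec (exists_spin_conj z v)

/-- The double covering `Π : Spin_{n+1} → SO_{n+1}`: the matrix, in the standard basis, of the
rotation `v ↦ z v z⁻¹`. -/
def spinProj {n : ℕ} (z : Spin n) : Matrix (Fin (n + 1)) (Fin (n + 1)) ℝ :=
  Matrix.of fun i j => (spinConj z (EuclideanSpace.single j 1)) i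

/-- `Γ : J → Spin_{n+1}` is a continuous lift of the Frenet frame of `γ : J → 𝕊^n`. -/
structure IsFrenetLift {n : ℕ} (Γ : ℝ → Spin n) (γ : ℝ → Euc n) (J : Set ℝ) : Prop where
  continuousOn : ContinuousOn Γ J
  proj_eq : ∀ t ∈ J, spinProj (Γ t) = frenetFrame γ J t

/-! ### The elements `acute η` and `grave η` -/

theorem eucForm_apply {n : ℕ} (v : Euc n) : eucForm n v = ‖v‖ ^ 2 := by
  rw [← real_inner_self_eq_norm_sq]; rfl

theorem ι_mul_ι_mem_spinGroup {n : ℕ} (u w : Euc n) (hu : ‖u‖ = 1) (hw : ‖w‖ = 1) :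
    CliffordAlgebra.ι (eucForm n) u * CliffordAlgebra.ι (eucForm n) w ∈ spinGroup (eucForm n) := by
  have sq (v : Euc n) (hv : ‖v‖ = 1) :
      CliffordAlgebra.ι (eucForm n) v * CliffordAlgebra.ι (eucForm n) v = 1 := by
    rw [CliffordAlgebra.ι_sq_scalar, eucForm_apply, hv]; simp
  have mem (v : Euc n) (hv : ‖v‖ = 1) :
      (⟨_, _, sq v hv, sq v hv⟩ : (CliffordAlgebra (eucForm n))ˣ) ∈ lipschitzGroup (eucForm n) :=
    Subgroup.subset_closure ⟨v, rfl⟩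
  refine ⟨⟨⟨_, mul_mem (mem u hu) (mem w hw), rfl⟩, ?_⟩, ?_⟩
  · change _ ∈ unitary (CliffordAlgebra (eucForm n))
    rw [Unitary.mem_iff]
    simp only [star_mul, CliffordAlgebra.star_ι, neg_mul_neg]
    constructor
    · rw [mul_assoc, ← mul_assoc _ _ (CliffordAlgebra.ι (eucForm n) w), sq u hu, one_mul, sq w hw]
    · rw [mul_assoc, ← mul_assoc _ _ (CliffordAlgebra.ι (eucForm n) u), sq w hw, one_mul, sq u hu]
  · exact CliffordAlgebra.ι_mul_ι_mem_evenOdd_zero (eucForm n) u w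

theorem norm_cos_add_sin {n : ℕ} (i : Fin n) (θ : ℝ) :
    ‖Real.cos θ • (EuclideanSpace.single i.succ 1 : Euc n) +
      Real.sin θ • EuclideanSpace.single i.castSucc 1‖ = 1 := by
  have h : inner ℝ (Real.cos θ • (EuclideanSpace.single i.succ 1 : Euc n))
      (Real.sin θ • (EuclideanSpace.single i.castSucc 1 : Euc n)) = 0 := by
    simp [inner_smul_left, inner_smul_right, EuclideanSpace.inner_single_left,
      (Fin.castSucc_lt_succ (i := i)).ne']
  rw [← sq_eq_sq₀ (norm_nonneg _) zero_le_one, sq,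
    norm_add_sq_eq_norm_sq_add_norm_sq_of_inner_eq_zero _ _ h]
  simp [norm_smul]
  nlinarith [Real.sin_sq_add_cos_sq θ]

/-- The one-parameter subgroup `α_i(θ) = exp(θ 𝔞_i) = cos(θ/2) + sin(θ/2) e_{i+1} e_i` of
`Spin_{n+1}`, written as the product of the unit vectors `e_{i+1}` and
`cos(θ/2) e_{i+1} + sin(θ/2) e_i`. It covers the rotation of angle `θ` from `e_i` towards `e_{i+1}`
in the plane spanned by these two vectors. (The index `i : Fin n` stands for `i + 1` in
`{1, …, n}`.) -/
def spinAlpha {n : ℕ} (i : Fin n) (θ : ℝ) : Spin n :=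
  ⟨CliffordAlgebra.ι (eucForm n) (EuclideanSpace.single i.succ 1) *
    CliffordAlgebra.ι (eucForm n)
      (Real.cos (θ / 2) • EuclideanSpace.single i.succ 1 +
        Real.sin (θ / 2) • EuclideanSpace.single i.castSucc 1),
    ι_mul_ι_mem_spinGroup _ _ (by simp) (norm_cos_add_sin i _)⟩

/-- `acute a_i = α_i(π/2)`. -/
def acuteGen {n : ℕ} (i : Fin n) : Spin n := spinAlpha i (Real.pi / 2)

/-- `grave a_i = (acute a_i)⁻¹`. -/
def graveGen {n : ℕ} (i : Fin n) : Spin n := (acuteGen i)⁻¹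

/-- The reduced word `a_1 a_2 a_1 a_3 a_2 a_1 ⋯ a_n a_{n-1} ⋯ a_2 a_1` of the longest element `η`
of the symmetric group `S_{n+1}`. -/
def etaWord (n : ℕ) : List (Fin n) :=
  (List.finRange n).flatMap fun k => ((List.finRange n).filter (· ≤ k)).reverse

/-- `acute η`, the product of the `acute a_i` along a reduced word of `η`. -/
def acuteEta (n : ℕ) : Spin n := ((etaWord n).map acuteGen).prod

/-- `grave η`, the product of the `grave a_i` along a reduced word of `η`. -/
def graveEta (n : ℕ) : Spin n := ((etaWord n).map graveGen).prod

/-! ### Triangular charts and Bruhat cells -/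

/-- Lower triangular matrices with unit diagonal. -/
def lowerUnitriangular (m : ℕ) : Set (Matrix (Fin m) (Fin m) ℝ) :=
  {L | (∀ i j, i < j → L i j = 0) ∧ ∀ i, L i i = 1}

/-- Upper triangular matrices with positive diagonal. -/
def upperPositive (m : ℕ) : Set (Matrix (Fin m) (Fin m) ℝ) :=
  {U | (∀ i j, j < i → U i j = 0) ∧ ∀ i, 0 < U i i}

/-- The domain `𝒰_{Q₀} ⊆ SO_{m}` of triangular coordinates: the rotations of the form `Q₀ L U`, with
`L` lower triangular with unit diagonal and `U` upper triangular with positive diagonal. -/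
def chartSO {m : ℕ} (Q₀ : Matrix (Fin m) (Fin m) ℝ) : Set (Matrix (Fin m) (Fin m) ℝ) :=
  {Q | Q ∈ Matrix.specialOrthogonalGroup (Fin m) ℝ ∧
    ∃ L ∈ lowerUnitriangular m, ∃ U ∈ upperPositive m, Q = Q₀ * (L * U)}

/-- The signed Bruhat cell `Bru_{Q₀} ⊆ SO_{m}`: the rotations of the form `U₀ Q₀ U₁`, with `U₀, U₁`
upper triangular with positive diagonals. -/
def bruhatSO {m : ℕ} (Q₀ : Matrix (Fin m) (Fin m) ℝ) : Set (Matrix (Fin m) (Fin m) ℝ) :=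
  {Q | Q ∈ Matrix.specialOrthogonalGroup (Fin m) ℝ ∧
    ∃ U₀ ∈ upperPositive m, ∃ U₁ ∈ upperPositive m, Q = U₀ * Q₀ * U₁}

/-- The triangular chart `𝒰_z ⊆ Spin_{n+1}`: the connected component containing `z` of the preimage
under `Π` of `𝒰_{Π(z)}`. -/
def chartSpin {n : ℕ} (z : Spin n) : Set (Spin n) :=
  connectedComponentIn (spinProj ⁻¹' chartSO (spinProj z)) z

/-- The Bruhat cell `Bru_z ⊆ Spin_{n+1}`: the connected component containing `z` of the preimage
under `Π` of `Bru_{Π(z)}`. -/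
def bruhatSpin {n : ℕ} (z : Spin n) : Set (Spin n) :=
  connectedComponentIn (spinProj ⁻¹' bruhatSO (spinProj z)) z

/-- `Γ : J → Spin_{n+1}` is short: its image is contained in some triangular chart `𝒰_z`. -/
def IsShort {n : ℕ} (Γ : ℝ → Spin n) (J : Set ℝ) : Prop :=
  ∃ z : Spin n, Γ '' J ⊆ chartSpin z

end

/-! All four conditions are compared through the southwest minors of a matrix (last k rows, first k
columns). Their positivity, `SouthwestPositive`, is preserved by multiplication by Up⁺ on either
side and characterizes the open cell of Π(acute η) in SO (`preimage_bruhatSO_acuteEta`). A Wronski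
matrix W(t) is the Frenet frame F(t) times an element of Up⁺, so the position of Γ(t) relative to
Γ(t₀), projected to SO, is read off from G(t) = F(t₀)ᵀ W(t).

Cells and charts in Spin are connected components, so the right sheet has to be identified too. The
path `spinPath`, a product of the α_i(θ) along the reduced word, runs from 1 at θ = 0 to acute η at
θ = π/2 and stays in the cell for 0 < θ < π. The key local fact is
`IsWronskianFrom.exists_southwestPositive`: `rotationProd n θ * G (t₀ + u)` has positive southwest
minors for all small θ, u ≥ 0 that are not both 0. To see this, conjugate by the diagonal matrix of
powers of s = θ + u. As s → 0 with x = θ/s, the limit is a product of elementary lower unipotents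
with parameter x, times the Wronskian at 1 - x of positive multiples of monomials. Its southwest
minors are positive, and x ranges over the compact interval [0, 1].

1 → 3: a vanishing k-th minor at t₁ would give a functional with a zero of order n + 1 - k at t₀ and
k at t₁, hence n + 1 zeroes. So the minors keep the positive sign they have just after t₀, and a
path built from `spinPath` and Γ identifies the component.

3 → 2: after a small rotation by θ the whole curve, initial point included, lies in a translate of
the open cell. Such a translate projects into a triangular chart.

2 → 1: in a chart, Π(z)ᵀ W = L U. The columns of L form a chain in which the derivative of each is a
positive multiple of the next, and Rolle's theorem along this chain bounds the number of zeroes by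
n.

3 ↔ 4: inversion exchanges the cells of acute η and grave η = (acute η)⁻¹. -/

noncomputable section

open Filter Topology

/-! ### Iterated products along the reduced word of the longest permutation -/

section Words

variable {M : Type*} [Monoid M]

/-- The product `e (k + l - 1) * ⋯ * e (k + 1) * e k`. -/
def descFrom (e : ℕ → M) (k : ℕ) : ℕ → M
  | 0 => 1
  | l + 1 => e (k + l) * descFrom e k l

/-- The product of the descending blocks `e q * ⋯ * e 1 * e 0` for `q < p`. -/
def blockProd (e : ℕ → M) : ℕ → M
  | 0 => 1
  | p + 1 => blockProd e p * descFrom e 0 (p + 1)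

/-- The product `e 0 * e 1 * ⋯ * e (p - 1)`. -/
def ascProd (e : ℕ → M) : ℕ → M
  | 0 => 1
  | p + 1 => ascProd e p * e p

/-- The product of the ascending blocks `e 0 * e 1 * ⋯ * e q`, taken in the order of decreasing
`q < p`. -/
def revBlockProd (e : ℕ → M) : ℕ → M
  | 0 => 1
  | p + 1 => ascProd e (p + 1) * revBlockProd e p

theorem descFrom_add (e : ℕ → M) (k l : ℕ) :
    descFrom e 0 (k + l) = descFrom e k l * descFrom e 0 k := by
  induction l with
  | zero => simp [descFrom]
  | succ l ih => rw [← add_assoc, descFrom, ih, descFrom, mul_assoc, zero_add]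

theorem descFrom_mem (S : Submonoid M) (e : ℕ → M) (k l : ℕ)
    (h : ∀ i, k ≤ i → i < k + l → e i ∈ S) : descFrom e k l ∈ S := by
  induction l with
  | zero => exact S.one_mem
  | succ l ih =>
    exact S.mul_mem (h _ (by omega) (by omega)) (ih fun i h1 h2 => h i h1 (by omega))

theorem blockProd_mem (S : Submonoid M) (e : ℕ → M) (p : ℕ) (h : ∀ i < p, e i ∈ S) :
    blockProd e p ∈ S := by
  induction p with
  | zero => exact S.one_mem
  | succ p ih =>
    exact S.mul_mem (ih fun i hi => h i (by omega))
      (descFrom_mem S e 0 _ fun i _ hi => h i (by omega))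

theorem map_descFrom {N F : Type*} [Monoid N] [FunLike F M N] [MonoidHomClass F M N] (φ : F)
    (e : ℕ → M) (k l : ℕ) : φ (descFrom e k l) = descFrom (fun i => φ (e i)) k l := by
  induction l with
  | zero => exact map_one φ
  | succ l ih => rw [descFrom, map_mul, ih, descFrom]

theorem map_blockProd {N F : Type*} [Monoid N] [FunLike F M N] [MonoidHomClass F M N] (φ : F)
    (e : ℕ → M) (p : ℕ) : φ (blockProd e p) = blockProd (fun i => φ (e i)) p := by
  induction p with
  | zero => exact map_one φ
  | succ p ih => rw [blockProd, map_mul, ih, map_descFrom, blockProd]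

theorem descFrom_congr {e e' : ℕ → M} {k l : ℕ} (h : ∀ i < k + l, e i = e' i) :
    descFrom e k l = descFrom e' k l := by
  induction l with
  | zero => rfl
  | succ l ih => rw [descFrom, descFrom, h _ (by omega), ih fun i hi => h i (by omega)]

theorem blockProd_congr {e e' : ℕ → M} {p : ℕ} (h : ∀ i < p, e i = e' i) :
    blockProd e p = blockProd e' p := by
  induction p with
  | zero => rfl
  | succ p ih =>
    rw [blockProd, blockProd, ih fun i hi => h i (by omega),
      descFrom_congr fun i hi => h i (by omega)]

/-- Far commutation is enough to reverse the reduced word of the longest permutation. -/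
theorem blockProd_eq_revBlockProd (e : ℕ → M) (p : ℕ)
    (h : ∀ i j, j < p → i + 2 ≤ j → e i * e j = e j * e i) :
    blockProd e p = revBlockProd e p := by
  induction p using Nat.strong_induction_on with
  | _ p ih =>
    match p with
    | 0 => rfl
    | 1 => simp [blockProd, revBlockProd, descFrom, ascProd]
    | p + 2 =>
      -- Every letter of `blockProd e p` has index below p, hence is far from p + 1.
      have hc : Commute (blockProd e p) (e (p + 1)) := by
        have : blockProd e p ∈ Submonoid.centralizer {e (p + 1)} := by
          refine blockProd_mem _ _ _ fun i hi => ?_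
          rw [Submonoid.mem_centralizer_iff]
          rintro _ rfl
          exact (h i (p + 1) (by omega) (by omega)).symm
        exact (Submonoid.mem_centralizer_iff.1 this _ rfl).symm
      have h0 := ih p (by omega) fun i j hj hij => h i j (by omega) hij
      have h1 := ih (p + 1) (by omega) fun i j hj hij => h i j (by omega) hij
      calc blockProd e (p + 2)
          = revBlockProd e (p + 1) * (e (p + 1) * descFrom e 0 (p + 1)) := by
            rw [blockProd, h1, descFrom, zero_add]
        _ = ascProd e (p + 1) * (blockProd e p * e (p + 1)) * descFrom e 0 (p + 1) := by
            rw [revBlockProd, ← h0]; simp only [mul_assoc]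
        _ = ascProd e (p + 1) * e (p + 1) * (blockProd e p * descFrom e 0 (p + 1)) := by
            rw [hc.eq]; simp only [mul_assoc]
        _ = revBlockProd e (p + 2) := by
            rw [revBlockProd, ← h1, blockProd, ascProd.eq_2 e (p + 1)]

end Words

theorem inv_descFrom {G : Type*} [Group G] (e : ℕ → G) (p : ℕ) :
    (descFrom e 0 p)⁻¹ = ascProd (fun i => (e i)⁻¹) p := by
  induction p with
  | zero => exact inv_one
  | succ p ih => rw [descFrom, mul_inv_rev, ih, ascProd, zero_add]

theorem inv_blockProd {G : Type*} [Group G] (e : ℕ → G) (p : ℕ) :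
    (blockProd e p)⁻¹ = revBlockProd (fun i => (e i)⁻¹) p := by
  induction p with
  | zero => exact inv_one
  | succ p ih => rw [blockProd, mul_inv_rev, ih, inv_descFrom, revBlockProd]

theorem filter_finRange_prod {M : Type*} [Monoid M] {n : ℕ} (g : Fin n → M) (e : ℕ → M)
    (he : ∀ i : Fin n, e i = g i) (k : Fin n) :
    ((((List.finRange n).filter (· ≤ k)).reverse).map g).prod = descFrom e 0 (k + 1) := by
  have key : ∀ n (g : Fin n → M) (e : ℕ → M) (_ : ∀ i : Fin n, e i = g i) (p : ℕ) (_ : p ≤ n),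
      ((((List.finRange n).filter (fun i : Fin n => (i : ℕ) < p)).reverse).map g).prod
        = descFrom e 0 p := by
    intro n
    induction n with
    | zero =>
      intro g e _ p hp
      obtain rfl : p = 0 := by omega
      rfl
    | succ n ih =>
      intro g e he p hp
      rw [List.finRange_succ_last, List.filter_append, List.reverse_append, List.map_append,
        List.prod_append, List.filter_map, ← List.map_reverse, List.map_map]
      have h1 := ih (g ∘ Fin.castSucc) e (fun i => by simp [← he]) (min p n) (by omega)
      have h2 : ((fun i : Fin (n + 1) => decide ((i : ℕ) < p)) ∘ Fin.castSucc)
          = fun i : Fin n => decide ((i : ℕ) < min p n) := by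
        funext i
        simp
      rw [h2, h1]
      rcases Nat.lt_or_ge n p with h | h
      · obtain rfl : p = n + 1 := by omega
        simp [descFrom, ← he]
      · simp [h]
  rw [← key n g e he (k + 1) k.2]
  have : (fun i : Fin n => decide (i ≤ k)) = fun i : Fin n => decide ((i : ℕ) < k + 1) := by
    funext i
    exact decide_eq_decide.2 (by rw [Fin.le_def]; omega)
  rw [this]

/-- Letters indexed by ℕ serve words of every length at once, so inductions on the length need no
change of index type. -/
theorem etaWord_prod {M : Type*} [Monoid M] {n : ℕ} (g : Fin n → M) (e : ℕ → M)
    (he : ∀ i : Fin n, e i = g i) : ((etaWord n).map g).prod = blockProd e n := by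
  have key : ∀ n (F : Fin n → List M) (_ : ∀ k, (F k).prod = descFrom e 0 (k + 1)),
      ((List.finRange n).flatMap F).prod = blockProd e n := by
    intro n
    induction n with
    | zero => intro F _; rfl
    | succ n ih =>
      intro F hF
      rw [List.finRange_succ_last, List.flatMap_append, List.prod_append, List.flatMap_map,
        ih (fun a => F a.castSucc) fun k => by simp [hF]]
      simp [hF, blockProd]
  rw [etaWord, List.map_flatMap]
  exact key n _ fun k => filter_finRange_prod g e he k

/-! ### Elementary plane matrices -/

/-- The identity matrix, with the block `!![c, q; r, c]` in the rows and columns `i`, `i + 1`. -/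
def planeMatrix {m : ℕ} (c q r : ℝ) (i : ℕ) : Matrix (Fin m) (Fin m) ℝ :=
  Matrix.of fun a b =>
    if a = b then (if (a : ℕ) = i ∨ (a : ℕ) = i + 1 then c else 1)
    else if (a : ℕ) = i ∧ (b : ℕ) = i + 1 then q
    else if (a : ℕ) = i + 1 ∧ (b : ℕ) = i then r else 0

theorem planeMatrix_transpose {m : ℕ} (c q r : ℝ) (i : ℕ) :
    (planeMatrix c q r i : Matrix (Fin m) (Fin m) ℝ).transpose = planeMatrix c r q i := by
  ext a b
  simp only [planeMatrix, Matrix.transpose_apply, Matrix.of_apply]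
  by_cases h : a = b
  · subst h; simp
  · have h' : b ≠ a := fun h' => h h'.symm
    simp only [h, h', if_false]
    split_ifs <;> first | rfl | omega

theorem mul_planeMatrix_apply {m : ℕ} (X : Matrix (Fin m) (Fin m) ℝ) (c q r : ℝ) {i : ℕ}
    (hi : i + 1 < m) (a b : Fin m) :
    (X * (planeMatrix c q r i : Matrix (Fin m) (Fin m) ℝ)) a b =
      if (b : ℕ) = i then c * X a ⟨i, by omega⟩ + r * X a ⟨i + 1, hi⟩
      else if (b : ℕ) = i + 1 then q * X a ⟨i, by omega⟩ + c * X a ⟨i + 1, hi⟩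
      else X a b := by
  obtain ⟨b, hb⟩ := b
  rw [Matrix.mul_apply]
  have hne : (⟨i, by omega⟩ : Fin m) ≠ ⟨i + 1, hi⟩ := by simp
  have zero : ∀ d : Fin m, d ≠ ⟨i, by omega⟩ ∧ d ≠ ⟨i + 1, hi⟩ → ∀ b' : Fin m,
      (b' : ℕ) = i ∨ (b' : ℕ) = i + 1 →
      X a d * (planeMatrix c q r i : Matrix (Fin m) (Fin m) ℝ) d b' = 0 := by
    rintro d ⟨hd1, hd2⟩ b' hb'
    simp only [ne_eq, Fin.ext_iff] at hd1 hd2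
    have : d ≠ b' := by rintro rfl; omega
    simp [planeMatrix, hd1, hd2, this]
  simp only
  split_ifs with h1 h2
  · subst h1
    rw [Fintype.sum_eq_add _ _ hne fun d hd => zero d hd _ (Or.inl rfl)]
    simp [planeMatrix, mul_comm]
  · subst h2
    rw [Fintype.sum_eq_add _ _ hne fun d hd => zero d hd _ (Or.inr rfl)]
    simp [planeMatrix, mul_comm]
  · rw [Fintype.sum_eq_single ⟨b, hb⟩]
    · simp [planeMatrix, h1, h2]
    · intro d hd
      simp [planeMatrix, hd, h1, h2]

theorem planeMatrix_mul_apply {m : ℕ} (X : Matrix (Fin m) (Fin m) ℝ) (c q r : ℝ) {i : ℕ}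
    (hi : i + 1 < m) (a b : Fin m) :
    ((planeMatrix c q r i : Matrix (Fin m) (Fin m) ℝ) * X) a b =
      if (a : ℕ) = i then c * X ⟨i, by omega⟩ b + q * X ⟨i + 1, hi⟩ b
      else if (a : ℕ) = i + 1 then r * X ⟨i, by omega⟩ b + c * X ⟨i + 1, hi⟩ b
      else X a b := by
  have h := mul_planeMatrix_apply X.transpose c r q hi b a
  rw [← planeMatrix_transpose, ← Matrix.transpose_mul] at h
  simpa using h

/-! ### Flag minors -/

/-- The minor of `M` with rows `f` and the first `k` columns. -/
def flagMinor {m : ℕ} (M : Matrix (Fin m) (Fin m) ℝ) {k : ℕ} (hk : k ≤ m) (f : Fin k → Fin m) : ℝ :=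
  (M.submatrix f (Fin.castLE hk)).det

/-- The `k` consecutive rows `s, …, s + k - 1`. -/
def rowWindow {m : ℕ} (s k : ℕ) (h : s + k ≤ m) (a : Fin k) : Fin m :=
  ⟨s + a, by omega⟩

/-- The minors formed by the last `k` rows and the first `k` columns are all positive. -/
def SouthwestPositive {m : ℕ} (M : Matrix (Fin m) (Fin m) ℝ) : Prop :=
  ∀ k (hk : k ≤ m), 0 < flagMinor M hk (rowWindow (m - k) k (by omega))

/-- The case of Cauchy–Binet in which a single set of intermediate indices contributes; every
triangular or antidiagonal factor below is handled this way. -/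
theorem submatrix_mul_submatrix {m k : ℕ} (A B : Matrix (Fin m) (Fin m) ℝ)
    (f e g : Fin k → Fin m) (he : Function.Injective e)
    (h : ∀ a b c, (∀ d, e d ≠ c) → A (f a) c * B c (g b) = 0) :
    (A * B).submatrix f g = A.submatrix f e * B.submatrix e g := by
  ext a b
  simp only [Matrix.submatrix_apply, Matrix.mul_apply]
  rw [← Finset.sum_image (s := Finset.univ) (g := e) (f := fun c => A (f a) c * B c (g b))
    (fun x _ y _ hxy => he hxy)]
  symm
  apply Finset.sum_subset (Finset.subset_univ _)
  intro c _ hc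
  refine h a b c fun d hd => hc ?_
  simp [← hd]

theorem rowWindow_injective {m s k : ℕ} (h : s + k ≤ m) : Function.Injective (rowWindow s k h) := by
  intro a b hab
  simpa [rowWindow, Fin.ext_iff] using hab

/-- Right multiplication by an upper triangular matrix mixes the first k columns only among
themselves. The two lemmas that follow are the analogues for the last k rows (upper factor on the
left) and the first k rows (lower factor on the left). -/
theorem flagMinor_mul_upper {m k : ℕ} (M U : Matrix (Fin m) (Fin m) ℝ)
    (hU : ∀ i j, j < i → U i j = 0) (hk : k ≤ m) (f : Fin k → Fin m) :
    flagMinor (M * U) hk f = flagMinor M hk f * ∏ a : Fin k, U (Fin.castLE hk a) (Fin.castLE hk a) := by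
  rw [flagMinor, submatrix_mul_submatrix M U f (Fin.castLE hk) (Fin.castLE hk)
    (Fin.castLE_injective hk), Matrix.det_mul, flagMinor]
  · congr 1
    rw [Matrix.det_of_isUpperTriangular]
    · rfl
    · intro a b hab
      exact hU _ _ hab
  · intro a b c hc
    have : k ≤ c := by
      by_contra hlt
      exact hc ⟨c, by omega⟩ rfl
    rw [hU c _ (by rw [Fin.lt_def]; exact lt_of_lt_of_le b.2 this), mul_zero]

theorem flagMinor_upper_mul {m k : ℕ} (M U : Matrix (Fin m) (Fin m) ℝ)
    (hU : ∀ i j, j < i → U i j = 0) (hk : k ≤ m) :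
    flagMinor (U * M) hk (rowWindow (m - k) k (by omega)) =
      (∏ a : Fin k, U (rowWindow (m - k) k (by omega) a) (rowWindow (m - k) k (by omega) a)) *
        flagMinor M hk (rowWindow (m - k) k (by omega)) := by
  rw [flagMinor, submatrix_mul_submatrix U M _ (rowWindow (m - k) k (by omega)) _
    (rowWindow_injective _), Matrix.det_mul, flagMinor]
  · congr 1
    rw [Matrix.det_of_isUpperTriangular]
    · rfl
    · intro a b hab
      refine hU _ _ ?_
      change b < a at hab
      rw [Fin.lt_def] at hab ⊢
      exact Nat.add_lt_add_left hab _
  · intro a b c hc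
    rw [hU _ c, zero_mul]
    by_contra hlt
    simp only [rowWindow, Fin.lt_def, not_lt] at hlt
    exact hc ⟨c - (m - k), by omega⟩ (by simp only [rowWindow, Fin.ext_iff]; omega)

theorem flagMinor_lower_mul {m k : ℕ} (M L : Matrix (Fin m) (Fin m) ℝ)
    (hL : ∀ i j, i < j → L i j = 0) (hk : k ≤ m) :
    flagMinor (L * M) hk (Fin.castLE hk) =
      (∏ a : Fin k, L (Fin.castLE hk a) (Fin.castLE hk a)) * flagMinor M hk (Fin.castLE hk) := by
  rw [flagMinor, submatrix_mul_submatrix L M _ (Fin.castLE hk) _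
    (Fin.castLE_injective _), Matrix.det_mul, flagMinor]
  · congr 1
    rw [Matrix.det_of_isLowerTriangular]
    · rfl
    · intro a b hab
      exact hL _ _ hab
  · intro a b c hc
    have : k ≤ c := by
      by_contra hlt
      exact hc ⟨c, by omega⟩ rfl
    rw [hL _ c (by rw [Fin.lt_def]; exact lt_of_lt_of_le a.2 this), zero_mul]

theorem SouthwestPositive.mul_upper {m : ℕ} {M U : Matrix (Fin m) (Fin m) ℝ}
    (hM : SouthwestPositive M) (hU : U ∈ upperPositive m) : SouthwestPositive (M * U) := by
  intro k hk
  rw [flagMinor_mul_upper M U hU.1]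
  exact mul_pos (hM k hk) (Finset.prod_pos fun a _ => hU.2 _)

theorem SouthwestPositive.upper_mul {m : ℕ} {M U : Matrix (Fin m) (Fin m) ℝ}
    (hM : SouthwestPositive M) (hU : U ∈ upperPositive m) : SouthwestPositive (U * M) := by
  intro k hk
  rw [flagMinor_upper_mul M U hU.1]
  exact mul_pos (Finset.prod_pos fun a _ => hU.2 _) (hM k hk)

theorem SouthwestPositive.of_mul_upper {m : ℕ} {M U : Matrix (Fin m) (Fin m) ℝ}
    (hM : SouthwestPositive (M * U)) (hU : U ∈ upperPositive m) : SouthwestPositive M := by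
  intro k hk
  have := hM k hk
  rw [flagMinor_mul_upper M U hU.1] at this
  exact pos_of_mul_pos_left this (Finset.prod_pos fun a _ => hU.2 _).le

/-- The unimodular column operation. -/
theorem flagMinor_mul_planeMatrix {m k i : ℕ} (M : Matrix (Fin m) (Fin m) ℝ) {c q r : ℝ}
    (h : c * c - q * r = 1) (hk : k ≤ m) (hi : i + 2 ≤ k) (f : Fin k → Fin m) :
    flagMinor (M * planeMatrix c q r i) hk f = flagMinor M hk f := by
  set B := M.submatrix f (Fin.castLE hk) with hB
  set i0 : Fin k := ⟨i, by omega⟩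
  set i1 : Fin k := ⟨i + 1, by omega⟩
  have hne : i0 ≠ i1 := by simp [i0, i1]
  set u : Fin k → ℝ := fun a => B a i0
  set v : Fin k → ℝ := fun a => B a i1
  have key : (M * planeMatrix c q r i).submatrix f (Fin.castLE hk) =
      (B.updateCol i0 (c • u + r • v)).updateCol i1 (q • u + c • v) := by
    ext a b
    rw [Matrix.submatrix_apply, mul_planeMatrix_apply M c q r (by omega)]
    rw [Matrix.updateCol_apply, Matrix.updateCol_apply]
    by_cases h0 : b = i0
    · subst h0
      simp [hne, i0, u, v, i1, B]
    · by_cases h1 : b = i1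
      · subst h1
        simp [i1, u, v, i0, B]
      · have h0' : (b : ℕ) ≠ i := fun h => h0 (Fin.ext h)
        have h1' : (b : ℕ) ≠ i + 1 := fun h => h1 (Fin.ext h)
        simp [h0, h1, h0', h1', B]
  have e1 : (B.updateCol i0 u).updateCol i1 v = B := by
    ext a b
    simp only [Matrix.updateCol_apply]
    split_ifs with h1 h2
    · rw [h1]
    · rw [h2]
    · rfl
  have e2 : ((B.updateCol i0 v).updateCol i1 u).det = -B.det := by
    have : (B.updateCol i0 v).updateCol i1 u = B.submatrix id (Equiv.swap i0 i1) := by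
      ext a b
      simp only [Matrix.updateCol_apply, Matrix.submatrix_apply, id]
      split_ifs with h1 h2
      · rw [h1, Equiv.swap_apply_right]
      · rw [h2, Equiv.swap_apply_left]
      · rw [Equiv.swap_apply_of_ne_of_ne h2 h1]
    rw [this, Matrix.det_permute', Equiv.Perm.sign_swap hne]
    simp
  have e3 : ∀ w, ((B.updateCol i0 w).updateCol i1 w).det = 0 := fun w =>
    Matrix.det_zero_of_column_eq hne fun a => by simp [hne]
  have swap : ∀ x y, (B.updateCol i0 x).updateCol i1 y = (B.updateCol i1 y).updateCol i0 x := by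
    intro x y
    ext a b
    simp only [Matrix.updateCol_apply]
    split_ifs with h1 h2
    · exact absurd (h2.symm.trans h1) hne
    · rfl
    · rfl
    · rfl
  have lin : ∀ y, ((B.updateCol i0 (c • u + r • v)).updateCol i1 y).det =
      c * ((B.updateCol i0 u).updateCol i1 y).det + r * ((B.updateCol i0 v).updateCol i1 y).det := by
    intro y
    rw [swap, Matrix.det_updateCol_add, Matrix.det_updateCol_smul, Matrix.det_updateCol_smul,
      ← swap, ← swap]
  -- Bilinear expansion in the two new columns: equal columns contribute 0 and the swapped pair
  -- contributes -det B, so c * c - q * r remains.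
  rw [flagMinor, key, lin, Matrix.det_updateCol_add, Matrix.det_updateCol_add,
    Matrix.det_updateCol_smul, Matrix.det_updateCol_smul, Matrix.det_updateCol_smul,
    Matrix.det_updateCol_smul, e1, e2, e3, e3, flagMinor, ← hB]
  linear_combination B.det * h

theorem flagMinor_mul_descFrom {m k p : ℕ} (M : Matrix (Fin m) (Fin m) ℝ) {c q r : ℝ}
    (h : c * c - q * r = 1) (hk : k ≤ m) (hp : p + 1 ≤ k) (f : Fin k → Fin m) :
    flagMinor (M * descFrom (planeMatrix c q r) 0 p) hk f = flagMinor M hk f := by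
  induction p generalizing M with
  | zero => simp [descFrom]
  | succ p ih =>
    rw [descFrom, ← mul_assoc, ih _ (by omega), flagMinor_mul_planeMatrix M h hk (by omega)]

/-! ### Positivity of the southwest minors along the reduced word -/

/-- The matrices whose rows of index greater than `p` are those of the identity. -/
def rowsFixedAbove (m p : ℕ) : Submonoid (Matrix (Fin m) (Fin m) ℝ) where
  carrier := {M | ∀ a b : Fin m, p < a → M a b = (1 : Matrix (Fin m) (Fin m) ℝ) a b}
  one_mem' := fun _ _ _ => rfl
  mul_mem' := by
    intro A B hA hB a b ha
    rw [Matrix.mul_apply, Fintype.sum_eq_single a, hA a a ha, hB a b ha]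
    · simp
    · intro c hc
      rw [hA a c ha, Matrix.one_apply_ne hc.symm, zero_mul]

theorem planeMatrix_mem_rowsFixedAbove {m p i : ℕ} (c q r : ℝ) (hi : i + 1 ≤ p) :
    (planeMatrix c q r i : Matrix (Fin m) (Fin m) ℝ) ∈ rowsFixedAbove m p := by
  intro a b ha
  simp only [planeMatrix, Matrix.of_apply, Matrix.one_apply]
  split_ifs <;> first | rfl | omega

/-- The matrices whose columns of index less than `k` are those of the identity. -/
def colsFixedBelow (m k : ℕ) : Submonoid (Matrix (Fin m) (Fin m) ℝ) where
  carrier := {M | ∀ a b : Fin m, (b : ℕ) < k → M a b = (1 : Matrix (Fin m) (Fin m) ℝ) a b}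
  one_mem' := fun _ _ _ => rfl
  mul_mem' := by
    intro A B hA hB a b hb
    rw [Matrix.mul_apply, Fintype.sum_eq_single b, hA a b hb, hB b b hb]
    · simp
    · intro c hc
      rw [hB c b hb, Matrix.one_apply_ne hc, mul_zero]

theorem planeMatrix_mem_colsFixedBelow {m k i : ℕ} (c q r : ℝ) (hi : k ≤ i) :
    (planeMatrix c q r i : Matrix (Fin m) (Fin m) ℝ) ∈ colsFixedBelow m k := by
  intro a b ha
  simp only [planeMatrix, Matrix.of_apply, Matrix.one_apply]
  split_ifs <;> first | rfl | omega

/-- Passing from index k to k + l takes one subdiagonal step in each factor, and each step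
contributes r. -/
theorem descFrom_planeMatrix_corner {m k l : ℕ} (c q r : ℝ) (h : k + l < m) :
    descFrom (planeMatrix c q r : ℕ → Matrix (Fin m) (Fin m) ℝ) k l ⟨k + l, h⟩ ⟨k, by omega⟩ =
      r ^ l := by
  induction l with
  | zero => exact Matrix.one_apply_eq _
  | succ l ih =>
    have h0 := descFrom_mem (rowsFixedAbove m (k + l)) (planeMatrix c q r) k l
      (fun i _ hi => planeMatrix_mem_rowsFixedAbove c q r (by omega)) ⟨k + (l + 1), h⟩
      ⟨k, by omega⟩ (by simp)
    rw [descFrom, planeMatrix_mul_apply _ _ _ _ (by omega : k + l + 1 < m)]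
    have e : (⟨k + l + 1, by omega⟩ : Fin m) = ⟨k + (l + 1), h⟩ := rfl
    rw [e, h0, ih (by omega), Matrix.one_apply_ne (by simp [Fin.ext_iff])]
    simp [← add_assoc, pow_succ']

/-- Inductive step along the reduced word. The letters of index below k mix only the first k + 1
columns, unimodularly, and can be dropped. The remaining letters fix the columns before k, so the
bottom row of the minor has the single nonzero entry r ^ l, in its last column; Laplace expansion
along that row removes it. -/
theorem flagMinor_mul_block {m k l : ℕ} (X : Matrix (Fin m) (Fin m) ℝ) {c q r : ℝ}
    (h : c * c - q * r = 1) (hkl : k + l < m) (hX : ∀ b, X ⟨k + l, hkl⟩ b =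
      (1 : Matrix (Fin m) (Fin m) ℝ) ⟨k + l, hkl⟩ b) :
    flagMinor (X * descFrom (planeMatrix c q r) 0 (k + l)) (k := k + 1) (by omega)
        (rowWindow l (k + 1) (by omega)) =
      r ^ l * flagMinor X (k := k) (by omega) (rowWindow l k (by omega)) := by
  rw [descFrom_add, ← mul_assoc, flagMinor_mul_descFrom _ h _ le_rfl]
  set H := descFrom (planeMatrix c q r : ℕ → Matrix (Fin m) (Fin m) ℝ) k l with hH
  have hcol : H ∈ colsFixedBelow m k := descFrom_mem _ _ _ _ fun i hi _ =>
    planeMatrix_mem_colsFixedBelow c q r hi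
  have hXH : ∀ a b : Fin m, (b : ℕ) < k → (X * H) a b = X a b := by
    intro a b hb
    rw [Matrix.mul_apply, Fintype.sum_eq_single b]
    · rw [hcol b b hb, Matrix.one_apply_eq, mul_one]
    · intro d hd
      rw [hcol d b hb, Matrix.one_apply_ne hd, mul_zero]
  have hlast : ∀ b, (X * H) ⟨k + l, hkl⟩ b = H ⟨k + l, hkl⟩ b := by
    intro b
    rw [Matrix.mul_apply, Fintype.sum_eq_single ⟨k + l, hkl⟩, hX, Matrix.one_apply_eq, one_mul]
    intro d hd
    rw [hX, Matrix.one_apply_ne hd.symm, zero_mul]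
  have hrow : ∀ s : ℕ, ∀ hs : s + (k + 1) ≤ m, s = l →
      rowWindow s (k + 1) hs (Fin.last k) = ⟨k + l, hkl⟩ := by
    intro s hs e
    simp [rowWindow, e, add_comm]
  rw [flagMinor, Matrix.det_succ_row _ (Fin.last k), Fin.sum_univ_castSucc,
    Finset.sum_eq_zero, zero_add]
  · simp only [Matrix.submatrix_apply, hrow _ _ rfl, hlast, Fin.val_last]
    have e1 : (Fin.castLE (by omega : k + 1 ≤ m) (Fin.last k)) = ⟨k, by omega⟩ := rfl
    rw [e1, hH, descFrom_planeMatrix_corner, ← hH, ← two_mul, pow_mul]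
    have e2 : ((X * H).submatrix (rowWindow l (k + 1) (by omega))
        (Fin.castLE (by omega : k + 1 ≤ m))).submatrix (Fin.last k).succAbove
          (Fin.last k).succAbove =
        X.submatrix (rowWindow l k (by omega)) (Fin.castLE (by omega : k ≤ m)) := by
      ext a b
      simp only [Matrix.submatrix_apply, Fin.succAbove_last]
      rw [hXH _ _ (by simp)]
      rfl
    rw [e2, flagMinor]
    simp
  · intro b _
    simp only [Matrix.submatrix_apply, hrow _ _ rfl, hlast]
    rw [hcol _ _ (by simp), Matrix.one_apply_ne]
    · simp
    · simp only [ne_eq, Fin.ext_iff, Fin.val_castLE, Fin.val_castSucc]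
      omega

/-- After p blocks only the first p + 1 rows have been touched, so the induction is on the southwest
minors of that leading square, whose last row is s + k - 1 = p. -/
theorem flagMinor_blockProd_pos {m p s k : ℕ} {c q r : ℝ} (h : c * c - q * r = 1) (hr : 0 < r)
    (hp : p < m) (hk : s + k = p + 1) :
    0 < flagMinor (blockProd (planeMatrix c q r : ℕ → Matrix (Fin m) (Fin m) ℝ) p)
      (by omega : k ≤ m) (rowWindow s k (by omega)) := by
  induction p generalizing k with
  | zero =>
    match k with
    | 0 => simp [flagMinor]
    | k + 1 =>
      obtain ⟨rfl, rfl⟩ : s = 0 ∧ k = 0 := by omega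
      rw [flagMinor, Matrix.det_fin_one]
      change 0 < (1 : Matrix (Fin m) (Fin m) ℝ) ⟨0, hp⟩ ⟨0, hp⟩
      rw [Matrix.one_apply_eq]
      exact one_pos
  | succ p ih =>
    match k with
    | 0 => simp [flagMinor]
    | k + 1 =>
      have key := flagMinor_mul_block (blockProd (planeMatrix c q r) p) h (by omega : k + s < m)
        (fun b => blockProd_mem (rowsFixedAbove m p) _ p
          (fun i hi => planeMatrix_mem_rowsFixedAbove c q r (by omega)) _ _
          (by simp only; omega))
      have ih' := ih (by omega) (by omega : s + k = p + 1)
      rw [blockProd]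
      simp only [(by omega : k + s = p + 1)] at key
      rw [key]
      exact mul_pos (pow_pos hr _) ih'

theorem southwestPositive_blockProd {n : ℕ} {c q r : ℝ} (h : c * c - q * r = 1) (hr : 0 < r) :
    SouthwestPositive (blockProd (planeMatrix c q r : ℕ → Matrix (Fin (n + 1)) (Fin (n + 1)) ℝ) n) :=
  fun _ hk => flagMinor_blockProd_pos h hr (by omega) (by omega)

/-! ### Monomial matrices -/

/-- The matrices with at most one nonzero entry in each row and in each column. -/
def monomialMatrices (m : ℕ) : Submonoid (Matrix (Fin m) (Fin m) ℝ) where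
  carrier := {M | ∃ σ : Equiv.Perm (Fin m), ∀ a b, a ≠ σ b → M a b = 0}
  one_mem' := ⟨1, fun _ _ h => Matrix.one_apply_ne h⟩
  mul_mem' := by
    rintro A B ⟨σ, hA⟩ ⟨τ, hB⟩
    refine ⟨σ * τ, fun a b hab => ?_⟩
    rw [Matrix.mul_apply]
    refine Finset.sum_eq_zero fun c _ => ?_
    by_cases hc : c = τ b
    · rw [hA a c (by rwa [hc]), zero_mul]
    · rw [hB c b hc, mul_zero]

theorem planeMatrix_mem_monomialMatrices {m i : ℕ} (q r : ℝ) (hi : i + 1 < m) :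
    (planeMatrix 0 q r i : Matrix (Fin m) (Fin m) ℝ) ∈ monomialMatrices m := by
  obtain ⟨x, hx⟩ : ∃ x : Fin m, (x : ℕ) = i := ⟨⟨i, by omega⟩, rfl⟩
  obtain ⟨y, hy⟩ : ∃ y : Fin m, (y : ℕ) = i + 1 := ⟨⟨i + 1, hi⟩, rfl⟩
  refine ⟨Equiv.swap x y, fun a b hab => ?_⟩
  rw [Equiv.swap_apply_def] at hab
  simp only [planeMatrix, Matrix.of_apply]
  simp only [Fin.ext_iff] at hab ⊢
  split_ifs at hab ⊢ <;> first | rfl | omega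

/-- A monomial matrix with positive southwest minors is antidiagonal. -/
theorem apply_eq_zero_of_monomial {n : ℕ} {M : Matrix (Fin (n + 1)) (Fin (n + 1)) ℝ}
    (hM : M ∈ monomialMatrices (n + 1)) (hpos : SouthwestPositive M) (a b : Fin (n + 1))
    (hab : (a : ℕ) + b ≠ n) : M a b = 0 := by
  obtain ⟨σ, hσ⟩ := hM
  have key : ∀ j (hj : j < n + 1), (σ ⟨j, hj⟩ : ℕ) + j = n := by
    intro j
    induction j using Nat.strong_induction_on with
    | _ j ih =>
      intro hj
      by_contra hne
      -- The top row of this minor is n - j. Columns before j have their entry in rows below it, so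
      -- if column j does not meet row n - j either, that row of the minor vanishes.
      refine (hpos (j + 1) (by omega)).ne' ?_
      refine Matrix.det_eq_zero_of_row_eq_zero 0 fun d => hσ _ _ fun e => ?_
      simp only [rowWindow, Fin.ext_iff, Fin.val_zero, add_zero] at e
      rcases Nat.lt_or_ge d j with hd | hd
      · have := ih d hd (by omega)
        have e' : (Fin.castLE (by omega : j + 1 ≤ n + 1) d) = ⟨d, by omega⟩ := rfl
        rw [e'] at e
        omega
      · have e' : (Fin.castLE (by omega : j + 1 ≤ n + 1) d) = ⟨j, by omega⟩ := by
          simp only [Fin.ext_iff, Fin.val_castLE]; omega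
        rw [e'] at e
        omega
  refine hσ a b fun e => hab ?_
  rw [e]
  exact key b b.2

/-! ### Triangular factorization -/

theorem lowerUnitriangular_mul {m : ℕ} {A B : Matrix (Fin m) (Fin m) ℝ}
    (hA : A ∈ lowerUnitriangular m) (hB : B ∈ lowerUnitriangular m) :
    A * B ∈ lowerUnitriangular m := by
  refine ⟨fun i j hij => ?_, fun i => ?_⟩
  · rw [Matrix.mul_apply]
    refine Finset.sum_eq_zero fun k _ => ?_
    rcases lt_or_ge i k with h | h
    · rw [hA.1 i k h, zero_mul]
    · rw [hB.1 k j (lt_of_le_of_lt h hij), mul_zero]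
  · rw [Matrix.mul_apply, Fintype.sum_eq_single i, hA.2, hB.2, one_mul]
    intro k hk
    rcases lt_or_gt_of_ne hk with h | h
    · rw [hB.1 k i h, mul_zero]
    · rw [hA.1 i k h, zero_mul]

/-- Gaussian elimination without row exchanges: a leading minor is the product of the pivots met so
far, so no pivot vanishes and all are positive. -/
theorem exists_lower_mul_of_leading_minors_pos {m : ℕ} (M : Matrix (Fin m) (Fin m) ℝ)
    (hM : ∀ k (hk : k ≤ m), 0 < flagMinor M hk (Fin.castLE hk)) :
    ∃ L ∈ lowerUnitriangular m, ∃ U ∈ upperPositive m, M = L * U := by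
  have key : ∀ j ≤ m, ∃ L ∈ lowerUnitriangular m, ∃ N : Matrix (Fin m) (Fin m) ℝ,
      (∀ a b : Fin m, b < a → (b : ℕ) < j → N a b = 0) ∧ M = L * N := by
    intro j
    induction j with
    | zero =>
      exact fun _ => ⟨1, ⟨fun i j h => Matrix.one_apply_ne h.ne, fun i => Matrix.one_apply_eq i⟩, M,
        fun a b _ h => absurd h (by omega), (one_mul M).symm⟩
    | succ j ih =>
      intro hj
      obtain ⟨L, hL, N, hN, rfl⟩ := ih (by omega)
      set d : Fin m := ⟨j, hj⟩
      have hd : N d d ≠ 0 := by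
        have h := hM (j + 1) hj
        rw [flagMinor_lower_mul _ _ hL.1, Finset.prod_eq_one fun a _ => hL.2 _, one_mul, flagMinor,
          Matrix.det_of_isUpperTriangular, Fin.prod_univ_castSucc] at h
        · exact (right_ne_zero_of_mul h.ne')
        · intro a b hab
          change b < a at hab
          exact hN _ _ hab (by simp only [Fin.val_castLE]; omega)
      refine ⟨L * Matrix.of fun a b => if a = b then 1 else if b = d ∧ d < a then N a d / N d d
        else 0, lowerUnitriangular_mul hL ⟨?_, ?_⟩,
        Matrix.of fun a b => if d < a then N a b - N a d / N d d * N d b else N a b, ?_, ?_⟩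
      · intro a b hab
        simp only [Matrix.of_apply, hab.ne, if_false]
        rw [if_neg]
        rintro ⟨rfl, h⟩
        exact absurd h hab.asymm
      · simp
      · intro a b hab hb
        simp only [Matrix.of_apply]
        rcases Nat.lt_succ_iff_lt_or_eq.1 hb with h | h
        · rw [hN a b hab h]
          split_ifs with h'
          · rw [hN d b h h]; simp
          · rfl
        · obtain rfl : b = d := Fin.ext h
          rw [if_pos hab, div_mul_cancel₀ _ hd, sub_self]
      · rw [mul_assoc]
        congr 1
        ext a b
        rw [Matrix.mul_apply]
        simp only [Matrix.of_apply]
        by_cases ha : d < a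
        · rw [Fintype.sum_eq_add a d ha.ne']
          · simp [ha, ha.ne']
          · rintro c ⟨h1, h2⟩
            simp [h1.symm, h2]
        · rw [Fintype.sum_eq_single a]
          · simp [ha]
          · intro c hc
            simp [hc.symm, ha]
  obtain ⟨L, hL, N, hN, rfl⟩ := key m le_rfl
  refine ⟨L, hL, N, ⟨fun i j h => hN i j h j.2, fun i => ?_⟩, rfl⟩
  have hprod : ∀ k (hk : k ≤ m), 0 < ∏ a : Fin k, N (Fin.castLE hk a) (Fin.castLE hk a) := by
    intro k hk
    have h := hM k hk
    rw [flagMinor_lower_mul _ _ hL.1, Finset.prod_eq_one fun a _ => hL.2 _, one_mul, flagMinor,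
      Matrix.det_of_isUpperTriangular] at h
    · exact h
    · intro a b hab
      exact hN _ _ hab (Fin.castLE hk b).2
  have h := hprod (i + 1) i.2
  rw [Fin.prod_univ_castSucc] at h
  exact pos_of_mul_pos_right h (hprod i i.2.le).le

/-! ### The open Bruhat cell -/

section Antidiagonal

variable {n : ℕ} {H : Matrix (Fin (n + 1)) (Fin (n + 1)) ℝ}

/-- Conjugation by an antidiagonal matrix reverses the indices, turning lower into upper.
Orthogonality makes the antidiagonal entries square to 1, so the diagonal stays equal to 1. -/
theorem antidiagonal_mul_lower_mul_transpose (hH : ∀ a b : Fin (n + 1), (a : ℕ) + b ≠ n → H a b = 0)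
    (hO : H * H.transpose = 1) {L : Matrix (Fin (n + 1)) (Fin (n + 1)) ℝ}
    (hL : L ∈ lowerUnitriangular (n + 1)) : H * L * H.transpose ∈ upperPositive (n + 1) := by
  have hsum : ∀ a b, (H * L * H.transpose) a b =
      H a a.rev * L a.rev b.rev * H b b.rev := by
    intro a b
    rw [Matrix.mul_apply, Fintype.sum_eq_single b.rev, Matrix.mul_apply,
      Fintype.sum_eq_single a.rev, Matrix.transpose_apply]
    · intro c hc
      rw [hH, zero_mul]
      simp only [ne_eq, Fin.ext_iff, Fin.val_rev] at hc
      omega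
    · intro c hc
      rw [Matrix.transpose_apply, hH, mul_zero]
      simp only [ne_eq, Fin.ext_iff, Fin.val_rev] at hc
      omega
  refine ⟨fun i j hij => ?_, fun i => ?_⟩
  · rw [hsum, hL.1 _ _ (Fin.rev_lt_rev.2 hij)]
    simp
  · have h1 : (H * H.transpose) i i = H i i.rev * H i i.rev := by
      rw [Matrix.mul_apply, Fintype.sum_eq_single i.rev, Matrix.transpose_apply]
      intro c hc
      rw [hH, zero_mul]
      simp only [ne_eq, Fin.ext_iff, Fin.val_rev] at hc
      omega
    rw [hO, Matrix.one_apply_eq] at h1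
    rw [hsum, hL.2, mul_one, ← h1]
    exact one_pos

/-- The k-th leading minor of Hᵀ Q is the product of the k-th southwest minors of H and Q, so the
triangular factorization applies to Hᵀ Q. -/
theorem SouthwestPositive.exists_eq_mul_lower_mul_upper
    (hH : ∀ a b : Fin (n + 1), (a : ℕ) + b ≠ n → H a b = 0)
    (hO : H * H.transpose = 1) (hpos : SouthwestPositive H)
    {Q : Matrix (Fin (n + 1)) (Fin (n + 1)) ℝ} (hQ : SouthwestPositive Q) :
    ∃ L ∈ lowerUnitriangular (n + 1), ∃ U ∈ upperPositive (n + 1), Q = H * (L * U) := by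
  obtain ⟨L, hL, U, hU, h⟩ := exists_lower_mul_of_leading_minors_pos (H.transpose * Q) (by
    intro k hk
    rw [flagMinor, submatrix_mul_submatrix _ _ _ (rowWindow (n + 1 - k) k (by omega)) _
      (rowWindow_injective _), Matrix.det_mul, ← Matrix.transpose_submatrix, Matrix.det_transpose]
    · exact mul_pos (hpos k hk) (hQ k hk)
    · intro a b c hc
      rw [Matrix.transpose_apply, hH, zero_mul]
      intro e
      simp only [Fin.val_castLE] at e
      exact hc ⟨c - (n + 1 - k), by omega⟩ (by simp only [rowWindow, Fin.ext_iff]; omega))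
  exact ⟨L, hL, U, hU, by rw [← h, ← mul_assoc, hO, one_mul]⟩

end Antidiagonal

/-! ### Nonnegative flag minors -/

/-- All minors of `M` formed by its first columns are nonnegative. -/
def FlagNonneg {m : ℕ} (M : Matrix (Fin m) (Fin m) ℝ) : Prop :=
  ∀ k (hk : k ≤ m) (f : Fin k → Fin m), Monotone f → 0 ≤ flagMinor M hk f

/-- The matrices whose left multiplication does not decrease nonnegative flag minors. -/
def flagIncreasing (m : ℕ) : Submonoid (Matrix (Fin m) (Fin m) ℝ) where
  carrier := {A | ∀ M, FlagNonneg M → ∀ k (hk : k ≤ m) (f : Fin k → Fin m), Monotone f →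
    flagMinor M hk f ≤ flagMinor (A * M) hk f}
  one_mem' := fun M _ k hk f _ => by rw [one_mul]
  mul_mem' := by
    intro A B hA hB M hM k hk f hf
    rw [mul_assoc]
    refine (hB M hM k hk f hf).trans (hA (B * M) ?_ k hk f hf)
    exact fun k hk f hf => (hM k hk f hf).trans (hB M hM k hk f hf)

theorem planeMatrix_mem_flagIncreasing {m i : ℕ} {x : ℝ} (hx : 0 ≤ x) (hi : i + 1 < m) :
    (planeMatrix 1 0 x i : Matrix (Fin m) (Fin m) ℝ) ∈ flagIncreasing m := by
  intro M hM k hk f hf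
  by_cases hinj : Function.Injective f
  swap
  · have hzero : ∀ N : Matrix (Fin m) (Fin m) ℝ, flagMinor N hk f = 0 := by
      intro N
      obtain ⟨a, b, hab, hne⟩ := Function.not_injective_iff.1 hinj
      exact Matrix.det_zero_of_row_eq hne (by ext c; simp [hab])
    rw [hzero, hzero]
  by_cases hex : ∃ a, (f a : ℕ) = i + 1
  · obtain ⟨a, ha⟩ := hex
    -- The factor adds x times row i to row i + 1, so the minor increases by x times the minor with
    -- i + 1 replaced by i. The new row choice may repeat i; this is why `FlagNonneg` allows
    -- monotone maps and not only strictly monotone ones.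
    set g : Fin k → Fin m := Function.update f a ⟨i, by omega⟩ with hg
    have hgmono : Monotone g := by
      intro b c hbc
      simp only [hg, Function.update_apply]
      split_ifs with h1 h2 h2
      · exact le_rfl
      · subst h1
        have := hf hbc
        rw [Fin.le_def] at this ⊢
        simp only
        omega
      · subst h2
        have hle := hf hbc
        have hne : f b ≠ f c := fun e => h1 (hinj e)
        rw [Fin.le_def] at hle ⊢
        simp only [ne_eq, Fin.ext_iff] at hne ⊢
        omega
      · exact hf hbc
    have key : (planeMatrix 1 0 x i * M).submatrix f (Fin.castLE hk) =
        (M.submatrix f (Fin.castLE hk)).updateRow a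
          ((fun b => M (f a) (Fin.castLE hk b)) +
            x • fun b => M ⟨i, by omega⟩ (Fin.castLE hk b)) := by
      ext b c
      rw [Matrix.submatrix_apply, planeMatrix_mul_apply _ _ _ _ hi, Matrix.updateRow_apply]
      have hfa : f a = ⟨i + 1, hi⟩ := Fin.ext ha
      by_cases hb : b = a
      · subst hb
        simp [hfa]
        ring
      · have h2 : (f b : ℕ) ≠ i + 1 := fun e => hb (hinj (Fin.ext (e.trans ha.symm)))
        rw [if_neg h2, if_neg hb, Matrix.submatrix_apply]
        split_ifs with h3
        · simp only [one_mul, zero_mul, add_zero]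
          congr 1
          exact Fin.ext h3.symm
        · rfl
    have e1 : (M.submatrix f (Fin.castLE hk)).updateRow a
        (fun b => M (f a) (Fin.castLE hk b)) = M.submatrix f (Fin.castLE hk) := by
      ext b c
      rw [Matrix.updateRow_apply]
      split_ifs with h
      · rw [h]; rfl
      · rfl
    have e2 : (M.submatrix f (Fin.castLE hk)).updateRow a
        (fun b => M ⟨i, by omega⟩ (Fin.castLE hk b)) = M.submatrix g (Fin.castLE hk) := by
      ext b c
      rw [Matrix.updateRow_apply, Matrix.submatrix_apply, Matrix.submatrix_apply, hg,
        Function.update_apply]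
      split_ifs <;> rfl
    rw [flagMinor, flagMinor, key, Matrix.det_updateRow_add, Matrix.det_updateRow_smul, e1, e2]
    exact le_add_of_nonneg_right (mul_nonneg hx (hM k hk g hgmono))
  · refine le_of_eq ?_
    rw [flagMinor, flagMinor]
    congr 1
    ext b c
    rw [Matrix.submatrix_apply, Matrix.submatrix_apply, planeMatrix_mul_apply _ _ _ _ hi,
      if_neg fun h : (f b : ℕ) = i + 1 => hex ⟨b, h⟩]
    split_ifs with h3
    · simp only [one_mul, zero_mul, add_zero]
      congr 1
      exact Fin.ext h3
    · rfl

/-- The Wronski matrix at `y` of the monomials `r a * y ^ a / a!`. -/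
def monomialWronskian {m : ℕ} (r : Fin m → ℝ) (y : ℝ) : Matrix (Fin m) (Fin m) ℝ :=
  Matrix.of fun a b => if b ≤ a then y ^ ((a : ℕ) - b) * (r a / (Nat.factorial ((a : ℕ) - b) : ℝ)) else 0

/-- With a = f(row), each entry is y⁻ᵇ · (r_a yᵃ / a!) · a(a-1)⋯(a-b+1). The last factor is a monic
polynomial of degree b in a, so after scaling rows and columns the determinant is a Vandermonde
determinant. -/
theorem flagMinor_monomialWronskian {m k : ℕ} (r : Fin m → ℝ) {y : ℝ} (hy : 0 < y) (hk : k ≤ m)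
    (f : Fin k → Fin m) :
    flagMinor (monomialWronskian r y) hk f =
      (∏ b : Fin k, (y ^ (b : ℕ))⁻¹) *
        ((∏ a : Fin k, (r (f a) * y ^ (f a : ℕ) / (Nat.factorial (f a) : ℝ))) *
          ∏ a : Fin k, ∏ b ∈ Finset.Ioi a, (((f b : ℕ) : ℝ) - (f a : ℕ))) := by
  have hvand := Matrix.det_eval_matrixOfPolynomials_eq_det_vandermonde
    (fun a : Fin k => (((f a : Fin m) : ℕ) : ℝ)) (fun b : Fin k => descPochhammer ℝ b)
    (fun b => descPochhammer_natDegree ℝ b) (fun b => monic_descPochhammer ℝ b)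
  rw [← Matrix.det_vandermonde, hvand, ← Matrix.det_mul_column, ← Matrix.det_mul_row, flagMinor]
  congr 1
  ext a b
  simp only [monomialWronskian, Matrix.submatrix_apply, Matrix.of_apply,
    descPochhammer_eval_eq_descFactorial]
  split_ifs with h
  · have hle : (b : ℕ) ≤ f a := h
    have h1 := Nat.factorial_mul_descFactorial hle
    have h2 : (Nat.factorial (f a) : ℝ) =
        (Nat.factorial ((f a : ℕ) - b) : ℝ) * ((f a : ℕ).descFactorial b : ℝ) := by
      rw [← h1]; push_cast; rfl
    have h3 : y ^ (f a : ℕ) = y ^ ((f a : ℕ) - b) * y ^ (b : ℕ) := by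
      rw [← pow_add, Nat.sub_add_cancel hle]
    have h4 : ((f a : ℕ).descFactorial b : ℝ) ≠ 0 := by
      rw [Nat.cast_ne_zero, ne_eq, Nat.descFactorial_eq_zero_iff_lt]
      omega
    have h5 : (Nat.factorial ((f a : ℕ) - b) : ℝ) ≠ 0 := Nat.cast_ne_zero.2 (Nat.factorial_ne_zero _)
    have h6 : y ^ (b : ℕ) ≠ 0 := pow_ne_zero _ hy.ne'
    rw [h2, h3]
    simp only [Fin.val_castLE]
    field_simp
  · have hlt : (f a : ℕ) < b := not_le.1 h
    rw [Nat.descFactorial_of_lt hlt]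
    simp

theorem flagMinor_monomialWronskian_pos {m k : ℕ} {r : Fin m → ℝ} (hr : ∀ a, 0 < r a) {y : ℝ}
    (hy : 0 < y) (hk : k ≤ m) {f : Fin k → Fin m} (hf : StrictMono f) :
    0 < flagMinor (monomialWronskian r y) hk f := by
  rw [flagMinor_monomialWronskian r hy]
  refine mul_pos (Finset.prod_pos fun b _ => by positivity)
    (mul_pos (Finset.prod_pos fun a _ => ?_) (Finset.prod_pos fun a _ => Finset.prod_pos fun b hb => ?_))
  · have := hr (f a); positivity
  · rw [sub_pos, Nat.cast_lt]
    exact hf (Finset.mem_Ioi.1 hb)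

theorem continuous_monomialWronskian {m : ℕ} (r : Fin m → ℝ) :
    Continuous (monomialWronskian r) := by
  refine continuous_matrix fun a b => ?_
  simp only [monomialWronskian, Matrix.of_apply]
  split_ifs <;> fun_prop

theorem continuous_flagMinor {m k : ℕ} (hk : k ≤ m) (f : Fin k → Fin m) :
    Continuous fun M : Matrix (Fin m) (Fin m) ℝ => flagMinor M hk f :=
  (continuous_id.matrix_submatrix f (Fin.castLE hk)).matrix_det

theorem flagNonneg_monomialWronskian {m : ℕ} {r : Fin m → ℝ} (hr : ∀ a, 0 < r a) {y : ℝ}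
    (hy : 0 ≤ y) : FlagNonneg (monomialWronskian r y) := by
  intro k hk f hf
  have hpos : ∀ y : ℝ, 0 < y → 0 ≤ flagMinor (monomialWronskian r y) hk f := by
    intro y hy
    rw [flagMinor_monomialWronskian r hy]
    refine mul_nonneg (Finset.prod_nonneg fun b _ => by positivity)
      (mul_nonneg (Finset.prod_nonneg fun a _ => ?_)
        (Finset.prod_nonneg fun a _ => Finset.prod_nonneg fun b hb => ?_))
    · have := hr (f a); positivity
    · rw [sub_nonneg, Nat.cast_le]
      exact hf (Finset.mem_Ioi.1 hb).le
  rcases hy.eq_or_lt with rfl | hy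
  · have h := ((continuous_flagMinor hk f).comp (continuous_monomialWronskian r)).tendsto 0
    exact ge_of_tendsto (h.mono_left (nhdsWithin_le_nhds (s := Set.Ioi 0)))
      (eventually_nhdsWithin_of_forall fun y hy => hpos y hy)
  · exact hpos y hy

theorem rowWindow_strictMono {m s k : ℕ} (h : s + k ≤ m) : StrictMono (rowWindow s k h) := by
  intro a b hab
  rw [Fin.lt_def] at hab ⊢
  exact Nat.add_lt_add_left hab _

/-- The limit shape of the frames near the origin has positive southwest minors. -/
theorem southwestPositive_blockProd_mul_monomialWronskian {n : ℕ} {r : Fin (n + 1) → ℝ}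
    (hr : ∀ a, 0 < r a) {x y : ℝ} (hx : 0 ≤ x) (hy : 0 ≤ y) (hxy : 0 < x + y) :
    SouthwestPositive (blockProd (planeMatrix 1 0 x) n * monomialWronskian r y) := by
  -- At y = 0 the Wronskian is in Up⁺ and x > 0, so the unipotent product carries the positivity.
  -- For y > 0 the Wronskian is already positive, and the unipotent factors can only increase its
  -- minors.
  rcases hy.eq_or_lt with rfl | hy
  · refine (southwestPositive_blockProd (by norm_num) (by linarith)).mul_upper ⟨?_, ?_⟩
    · intro a b hab
      simp only [monomialWronskian, Matrix.of_apply]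
      rw [if_pos hab.le, zero_pow, zero_mul]
      rw [Fin.lt_def] at hab
      omega
    · intro a
      simpa [monomialWronskian] using hr a
  · intro k hk
    have hf := rowWindow_strictMono (Nat.sub_add_cancel hk).le
    exact (flagMinor_monomialWronskian_pos hr hy hk hf).trans_le
      (blockProd_mem (flagIncreasing (n + 1)) _ n
        (fun i hi => planeMatrix_mem_flagIncreasing hx (by omega)) _
        (flagNonneg_monomialWronskian hr hy.le) k hk _ hf.monotone)

/-! ### Frames near a point -/

/-- The product of the plane rotations of angle `θ` along the reduced word. -/
def rotationProd (n : ℕ) (θ : ℝ) : Matrix (Fin (n + 1)) (Fin (n + 1)) ℝ :=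
  blockProd (planeMatrix (Real.cos θ) (-Real.sin θ) (Real.sin θ)) n

/-- The columns of `G` are successive derivatives of the first one on `(t₀, b)`, and `G` is
continuous at `t₀` from the right, where it is upper triangular with positive diagonal. -/
structure IsWronskianFrom {n : ℕ} (G : ℝ → Matrix (Fin (n + 1)) (Fin (n + 1)) ℝ) (t₀ b : ℝ) :
    Prop where
  lt : t₀ < b
  cont : ∀ i j, ContinuousWithinAt (fun t => G t i j) (Set.Ici t₀) t₀
  deriv : ∀ i (j : ℕ) (hj : j + 1 < n + 1), ∀ t ∈ Set.Ioo t₀ b,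
    HasDerivAt (fun t => G t i ⟨j, by omega⟩) (G t i ⟨j + 1, hj⟩) t
  initial : G t₀ ∈ upperPositive (n + 1)

namespace IsWronskianFrom

variable {n : ℕ} {G : ℝ → Matrix (Fin (n + 1)) (Fin (n + 1)) ℝ} {t₀ b : ℝ}

/-- Leading Taylor coefficient of an entry below the diagonal: the entry vanishes at t₀ and
differentiation moves it one column towards the diagonal, so L'Hôpital's rule applies d times. -/
theorem tendsto_div_pow (h : IsWronskianFrom G t₀ b) (i : Fin (n + 1)) (d j : ℕ)
    (hij : j + d = i) :
    Tendsto (fun t => G t i ⟨j, by omega⟩ / (t - t₀) ^ d) (𝓝[>] t₀)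
      (𝓝 (G t₀ i i / (Nat.factorial d : ℝ))) := by
  have hc : ∀ j, Tendsto (fun t => G t i j) (𝓝[>] t₀) (𝓝 (G t₀ i j)) := fun j =>
    (h.cont i j).mono_left (nhdsWithin_mono _ Set.Ioi_subset_Ici_self)
  induction d generalizing j with
  | zero =>
    have e : (⟨j, by omega⟩ : Fin (n + 1)) = i := Fin.ext (by simpa using hij)
    simpa [e] using hc i
  | succ d ih =>
    refine HasDerivAt.lhopital_zero_right_on_Ioo h.lt (h.deriv i j (by omega))
      (g' := fun t => ((d + 1 : ℕ) : ℝ) * (t - t₀) ^ d) (fun t ht => ?_) (fun t ht => ?_) ?_ ?_ ?_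
    · simpa using ((hasDerivAt_id t).sub_const t₀).fun_pow (d + 1)
    · have : 0 < t - t₀ := sub_pos.2 ht.1
      positivity
    · have h0 := h.initial.1 i ⟨j, by omega⟩ (by rw [Fin.lt_def]; simp only; omega)
      simpa [h0] using hc ⟨j, by omega⟩
    · have : Tendsto (fun t : ℝ => (t - t₀) ^ (d + 1)) (𝓝 t₀) (𝓝 ((t₀ - t₀) ^ (d + 1))) :=
        Continuous.tendsto (by fun_prop) t₀
      rw [sub_self, zero_pow (by omega)] at this
      exact this.mono_left nhdsWithin_le_nhds
    · have key := (ih (j + 1) (by omega)).div_const ((d + 1 : ℕ) : ℝ)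
      have e : G t₀ i i / (Nat.factorial d : ℝ) / ((d + 1 : ℕ) : ℝ) =
          G t₀ i i / (Nat.factorial (d + 1) : ℝ) := by
        rw [div_div, Nat.factorial_succ, mul_comm (d + 1)]
        push_cast
        rfl
      rw [e] at key
      refine key.congr fun t => ?_
      rw [div_div, mul_comm]

/-- The domain of the rescaled parameters. -/
def scaleDomain : Set (ℝ × ℝ) := {z | 0 < z.1 ∧ 0 ≤ z.2 ∧ z.2 ≤ 1}

/-- The limit is joint in the scale s = `z.1` and the ratio x = `z.2`; convergence for each fixed x
would not suffice for the compactness argument on [0, 1]. -/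
theorem tendsto_scaled (h : IsWronskianFrom G t₀ b) (x₀ : ℝ) (i j : Fin (n + 1)) :
    Tendsto (fun z : ℝ × ℝ => (z.1 ^ (i : ℕ))⁻¹ * G (t₀ + (1 - z.2) * z.1) i j * z.1 ^ (j : ℕ))
      (𝓝[scaleDomain] (0, x₀)) (𝓝 (monomialWronskian (fun a => G t₀ a a) (1 - x₀) i j)) := by
  have hu : Tendsto (fun z : ℝ × ℝ => t₀ + (1 - z.2) * z.1) (𝓝[scaleDomain] (0, x₀))
      (𝓝[≥] t₀) := by
    refine tendsto_nhdsWithin_iff.2 ⟨?_, ?_⟩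
    · have : Tendsto (fun z : ℝ × ℝ => t₀ + (1 - z.2) * z.1) (𝓝 (0, x₀))
          (𝓝 (t₀ + (1 - x₀) * 0)) := Continuous.tendsto (by fun_prop) (0, x₀)
      rw [mul_zero, add_zero] at this
      exact this.mono_left nhdsWithin_le_nhds
    · refine eventually_nhdsWithin_of_forall fun z hz => ?_
      have := mul_nonneg (sub_nonneg.2 hz.2.2) hz.1.le
      simp only [Set.mem_Ici]
      linarith
  have h1 : Tendsto (fun z : ℝ × ℝ => z.1) (𝓝[scaleDomain] (0, x₀)) (𝓝 0) :=
    (continuous_fst.tendsto ((0 : ℝ), x₀)).mono_left nhdsWithin_le_nhds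
  have h2 : Tendsto (fun z : ℝ × ℝ => z.2) (𝓝[scaleDomain] (0, x₀)) (𝓝 x₀) :=
    (continuous_snd.tendsto ((0 : ℝ), x₀)).mono_left nhdsWithin_le_nhds
  simp only [monomialWronskian, Matrix.of_apply]
  split_ifs with hji
  · obtain ⟨d, hd⟩ : ∃ d, (j : ℕ) + d = i := ⟨i - j, by have := Fin.le_def.1 hji; omega⟩
    have hd' : (i : ℕ) - j = d := by omega
    rw [hd']
    -- The quotient is extended by its limit at t₀, because the argument t₀ + (1 - x) s equals t₀
    -- when x = 1.
    set H : ℝ → ℝ := fun t => if t = t₀ then G t₀ i i / (Nat.factorial d : ℝ)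
      else G t i j / (t - t₀) ^ d with hH
    have hHlim : Tendsto H (𝓝[≥] t₀) (𝓝 (G t₀ i i / (Nat.factorial d : ℝ))) := by
      have hHt : H t₀ = G t₀ i i / (Nat.factorial d : ℝ) := if_pos rfl
      rw [← hHt]
      have : ContinuousWithinAt H (Set.Ioi t₀) t₀ := by
        rw [ContinuousWithinAt, hHt]
        refine (h.tendsto_div_pow i d j hd).congr' ?_
        filter_upwards [self_mem_nhdsWithin] with t ht
        simp only [hH]
        rw [if_neg (ne_of_gt ht)]
      exact continuousWithinAt_Ioi_iff_Ici.1 this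
    have hprod := ((tendsto_const_nhds (x := (1 : ℝ))).sub h2).pow d |>.mul (hHlim.comp hu)
    refine hprod.congr' ?_
    filter_upwards [self_mem_nhdsWithin] with z hz
    have hz1 : z.1 ≠ 0 := hz.1.ne'
    have hpow : z.1 ^ (i : ℕ) = z.1 ^ (j : ℕ) * z.1 ^ d := by rw [← pow_add, hd]
    simp only [Function.comp_apply, hH]
    by_cases hy : 1 - z.2 = 0
    · rw [hy]
      simp only [zero_mul, add_zero, if_true]
      rcases Nat.eq_zero_or_pos d with rfl | hdpos
      · obtain rfl : j = i := Fin.ext (by simpa using hd)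
        simp only [pow_zero, Nat.factorial_zero, Nat.cast_one, div_one, one_mul]
        field_simp
      · rw [h.initial.1 i j (by rw [Fin.lt_def]; omega), zero_pow (by omega)]
        simp
    · rw [if_neg (by simpa using ⟨hy, hz1⟩), hpow, add_sub_cancel_left, mul_pow]
      field_simp
  · have hlt : (i : ℕ) < j := by
      rw [not_le, Fin.lt_def] at hji; exact hji
    have h3 := ((h.cont i j).tendsto.comp hu).mul (h1.pow ((j : ℕ) - i))
    rw [zero_pow (by omega), mul_zero] at h3
    refine h3.congr' ?_
    filter_upwards [self_mem_nhdsWithin] with z hz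
    have hz1 : z.1 ≠ 0 := hz.1.ne'
    have hpow : z.1 ^ (j : ℕ) = z.1 ^ ((j : ℕ) - i) * z.1 ^ (i : ℕ) := by
      rw [← pow_add, Nat.sub_add_cancel hlt.le]
    simp only [Function.comp_apply]
    rw [hpow]
    field_simp

end IsWronskianFrom

theorem continuous_planeMatrix (m i : ℕ) :
    Continuous fun v : ℝ × ℝ × ℝ => (planeMatrix v.1 v.2.1 v.2.2 i : Matrix (Fin m) (Fin m) ℝ) := by
  refine continuous_matrix fun a b => ?_
  simp only [planeMatrix, Matrix.of_apply]
  split_ifs <;> fun_prop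

theorem continuous_blockProd {X : Type*} [TopologicalSpace X] {m : ℕ}
    {e : X → ℕ → Matrix (Fin m) (Fin m) ℝ} (he : ∀ i, Continuous fun x => e x i) (p : ℕ) :
    Continuous fun x => blockProd (e x) p := by
  have hd : ∀ l, Continuous fun x => descFrom (e x) 0 l := by
    intro l
    induction l with
    | zero => exact continuous_const
    | succ l ih => exact (he _).matrix_mul ih
  induction p with
  | zero => exact continuous_const
  | succ p ih => exact ih.matrix_mul (hd _)

theorem continuous_rotationProd (n : ℕ) : Continuous (rotationProd n) :=
  continuous_blockProd (fun i => (continuous_planeMatrix (n + 1) i).comp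
    (f := fun θ => (Real.cos θ, -Real.sin θ, Real.sin θ)) (by fun_prop)) n

theorem rotationProd_zero (n : ℕ) : rotationProd n 0 = 1 := by
  have : rotationProd n 0 ∈ (⊥ : Submonoid (Matrix (Fin (n + 1)) (Fin (n + 1)) ℝ)) := by
    refine blockProd_mem _ _ _ fun i _ => ?_
    rw [Submonoid.mem_bot]
    ext a b
    simp [planeMatrix, Matrix.one_apply]
  simpa using this

theorem southwestPositive_rotationProd {n : ℕ} {θ : ℝ} (h0 : 0 < θ) (hpi : θ < Real.pi) :
    SouthwestPositive (rotationProd n θ) :=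
  southwestPositive_blockProd (by nlinarith [Real.sin_sq_add_cos_sq θ])
    (Real.sin_pos_of_pos_of_lt_pi h0 hpi)

/-- Conjugation of a product of plane matrices by a diagonal matrix of powers. -/
theorem conj_blockProd {n : ℕ} (c q r : ℝ) {s : ℝ} (hs : s ≠ 0) (p : ℕ) :
    Matrix.diagonal (fun a : Fin (n + 1) => (s ^ (a : ℕ))⁻¹) * blockProd (planeMatrix c q r) p *
      Matrix.diagonal (fun a : Fin (n + 1) => s ^ (a : ℕ)) =
    blockProd (planeMatrix c (s * q) (r / s)) p := by
  set D := Matrix.diagonal (fun a : Fin (n + 1) => s ^ (a : ℕ)) with hD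
  set D' := Matrix.diagonal (fun a : Fin (n + 1) => (s ^ (a : ℕ))⁻¹) with hD'
  have h1 : D' * D = 1 := by
    rw [hD, hD', Matrix.diagonal_mul_diagonal, ← Matrix.diagonal_one]
    congr 1
    funext a
    exact inv_mul_cancel₀ (pow_ne_zero _ hs)
  have h2 : D * D' = 1 := mul_eq_one_comm.1 h1
  let φ : Matrix (Fin (n + 1)) (Fin (n + 1)) ℝ →* Matrix (Fin (n + 1)) (Fin (n + 1)) ℝ :=
    { toFun := fun M => D' * M * D
      map_one' := by rw [mul_one, h1]
      map_mul' := fun A B => by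
        rw [show D' * A * D * (D' * B * D) = D' * A * (D * D') * B * D by simp only [mul_assoc], h2,
          mul_one, mul_assoc D' A B] }
  change φ _ = _
  rw [map_blockProd]
  congr 1
  funext i
  change D' * planeMatrix c q r i * D = _
  ext a b
  rw [hD, hD', Matrix.mul_diagonal, Matrix.diagonal_mul]
  simp only [planeMatrix, Matrix.of_apply]
  have ha : s ^ (a : ℕ) ≠ 0 := pow_ne_zero _ hs
  split_ifs with h1 h2 h3 h4
  · subst h1; field_simp
  · subst h1; field_simp
  · rw [h3.1, h3.2, pow_succ]
    field_simp
  · rw [h4.1, h4.2, pow_succ]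
    field_simp
  · simp

/-- Near `t₀`, products of small rotations with `G` have positive southwest minors. -/
theorem IsWronskianFrom.exists_southwestPositive {n : ℕ}
    {G : ℝ → Matrix (Fin (n + 1)) (Fin (n + 1)) ℝ} {t₀ b : ℝ} (h : IsWronskianFrom G t₀ b) :
    ∃ ε > 0, ∀ θ u : ℝ, 0 ≤ θ → 0 ≤ u → 0 < θ + u → θ + u ≤ ε →
      SouthwestPositive (rotationProd n θ * G (t₀ + u)) := by
  -- The product after conjugation by the powers of s, with θ = x s and u = (1 - x) s. The
  -- subdiagonal entry sin(x s)/s is written x sinc(x s), which is continuous at s = 0.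
  set Φ : ℝ × ℝ → Matrix (Fin (n + 1)) (Fin (n + 1)) ℝ := fun z =>
    blockProd (planeMatrix (Real.cos (z.2 * z.1)) (z.1 * -Real.sin (z.2 * z.1))
      (z.2 * Real.sinc (z.2 * z.1))) n * Matrix.of fun i j : Fin (n + 1) =>
        (z.1 ^ (i : ℕ))⁻¹ * G (t₀ + (1 - z.2) * z.1) i j * z.1 ^ (j : ℕ) with hΦ
  have hlim : ∀ x₀, Tendsto Φ (𝓝[scaleDomain] (0, x₀))
      (𝓝 (blockProd (planeMatrix 1 0 x₀) n *
        monomialWronskian (fun a => G t₀ a a) (1 - x₀))) := by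
    intro x₀
    have hA : Continuous fun z : ℝ × ℝ => (blockProd (planeMatrix (Real.cos (z.2 * z.1))
        (z.1 * -Real.sin (z.2 * z.1)) (z.2 * Real.sinc (z.2 * z.1))) n :
          Matrix (Fin (n + 1)) (Fin (n + 1)) ℝ) :=
      continuous_blockProd (fun i => (continuous_planeMatrix (n + 1) i).comp
        (f := fun z : ℝ × ℝ => (Real.cos (z.2 * z.1), z.1 * -Real.sin (z.2 * z.1),
          z.2 * Real.sinc (z.2 * z.1)))
        (by have := Real.continuous_sinc; fun_prop)) n
    have hA' := (hA.tendsto (0, x₀)).mono_left (nhdsWithin_le_nhds (s := scaleDomain))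
    simp only [mul_zero, Real.cos_zero, zero_mul, Real.sinc_zero, mul_one] at hA'
    have hB : Tendsto (fun z : ℝ × ℝ => (Matrix.of fun i j =>
        (z.1 ^ (i : ℕ))⁻¹ * G (t₀ + (1 - z.2) * z.1) i j * z.1 ^ (j : ℕ) :
          Matrix (Fin (n + 1)) (Fin (n + 1)) ℝ)) (𝓝[scaleDomain] (0, x₀))
        (𝓝 (monomialWronskian (fun a => G t₀ a a) (1 - x₀))) :=
      tendsto_pi_nhds.2 fun i => tendsto_pi_nhds.2 fun j => h.tendsto_scaled x₀ i j
    exact ((continuous_fst.matrix_mul continuous_snd).tendsto _).comp (hA'.prodMk_nhds hB)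
  have hev : ∀ᶠ s in 𝓝 (0 : ℝ), ∀ x ∈ Set.Icc (0 : ℝ) 1,
      0 < s → x ∈ Set.Icc (0 : ℝ) 1 → SouthwestPositive (Φ (s, x)) := by
    refine isCompact_Icc.eventually_forall_of_forall_eventually
      (P := fun s x => 0 < s → x ∈ Set.Icc (0 : ℝ) 1 → SouthwestPositive (Φ (s, x)))
      fun x₀ hx₀ => ?_
    have hpos := southwestPositive_blockProd_mul_monomialWronskian h.initial.2 hx₀.1
      (sub_nonneg.2 hx₀.2) (by linarith)
    have hall : ∀ᶠ z in 𝓝[scaleDomain] ((0 : ℝ), x₀), ∀ k : Fin (n + 2),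
        0 < flagMinor (Φ z) (Nat.lt_succ_iff.1 k.2)
          (rowWindow (n + 1 - k) k (Nat.sub_add_cancel (Nat.lt_succ_iff.1 k.2)).le) :=
      eventually_all.2 fun k =>
        (((continuous_flagMinor _ _).tendsto _).comp (hlim x₀)).eventually_const_lt (hpos k _)
    filter_upwards [eventually_nhdsWithin_iff.1 hall] with z hz h0 hx k hk
    exact hz ⟨h0, hx⟩ ⟨k, by omega⟩
  obtain ⟨δ, hδ, hball⟩ := Metric.eventually_nhds_iff.1 hev
  refine ⟨δ / 2, by positivity, fun θ u hθ hu hs hle => ?_⟩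
  have hx : θ / (θ + u) ∈ Set.Icc (0 : ℝ) 1 :=
    ⟨by positivity, (div_le_one hs).2 (by linarith)⟩
  have hpos := hball (y := θ + u) (by rw [Real.dist_eq, sub_zero, abs_of_pos hs]; linarith) _ hx hs hx
  have e1 : θ / (θ + u) * (θ + u) = θ := div_mul_cancel₀ _ hs.ne'
  have e2 : (1 - θ / (θ + u)) * (θ + u) = u := by rw [sub_mul, e1]; ring
  have e3 : θ / (θ + u) * Real.sinc θ = Real.sin θ / (θ + u) := by
    by_cases h0 : θ = 0
    · simp [h0]
    · rw [Real.sinc_of_ne_zero h0]; field_simp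
  simp only [hΦ, e1, e2, e3] at hpos
  rw [← conj_blockProd _ _ _ hs.ne'] at hpos
  set D := Matrix.diagonal (fun a : Fin (n + 1) => (θ + u) ^ (a : ℕ)) with hD
  set D' := Matrix.diagonal (fun a : Fin (n + 1) => ((θ + u) ^ (a : ℕ))⁻¹) with hD'
  have e4 : (Matrix.of fun i j : Fin (n + 1) =>
      ((θ + u) ^ (i : ℕ))⁻¹ * G (t₀ + u) i j * (θ + u) ^ (j : ℕ)) = D' * G (t₀ + u) * D := by
    ext i j
    rw [hD, hD', Matrix.mul_diagonal, Matrix.diagonal_mul, Matrix.of_apply]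
  have e5 : D * D' = 1 := by
    rw [hD, hD', Matrix.diagonal_mul_diagonal, ← Matrix.diagonal_one]
    congr 1
    funext a
    exact mul_inv_cancel₀ (pow_ne_zero _ hs.ne')
  have hdiag : ∀ v : Fin (n + 1) → ℝ, (∀ a, 0 < v a) → Matrix.diagonal v ∈ upperPositive (n + 1) :=
    fun v hv => ⟨fun i j hij => Matrix.diagonal_apply_ne _ hij.ne', fun i => by simpa using hv i⟩
  have hDu : D ∈ upperPositive (n + 1) := hdiag _ fun a => by positivity
  have hDu' : D' ∈ upperPositive (n + 1) := hdiag _ fun a => by positivity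
  rw [e4] at hpos
  have := (hpos.upper_mul hDu).mul_upper hDu'
  have e6 : ∀ A B : Matrix (Fin (n + 1)) (Fin (n + 1)) ℝ,
      D * (D' * A * D * (D' * B * D)) * D' = A * B := by
    intro A B
    calc D * (D' * A * D * (D' * B * D)) * D'
        = (D * D') * A * (D * D') * B * (D * D') := by simp only [mul_assoc]
      _ = A * B := by simp only [e5, one_mul, mul_one]
  rwa [e6] at this

/-! ### Counting zeroes with Rolle's theorem -/

/-- The number of initial members of the sequence `ℓ 0, ℓ 1, …, ℓ (N - 1)` that vanish at `t`. -/
def vanishOrder : ℕ → (ℕ → ℝ → ℝ) → ℝ → ℕ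
  | 0, _, _ => 0
  | N + 1, ℓ, t => if ℓ 0 t = 0 then vanishOrder N (fun j => ℓ (j + 1)) t + 1 else 0

theorem vanishOrder_le (N : ℕ) (ℓ : ℕ → ℝ → ℝ) (t : ℝ) : vanishOrder N ℓ t ≤ N := by
  induction N generalizing ℓ with
  | zero => exact le_rfl
  | succ N ih =>
    rw [vanishOrder]
    split_ifs
    · exact Nat.succ_le_succ (ih _)
    · exact Nat.zero_le _

theorem eq_zero_of_lt_vanishOrder {N j : ℕ} {ℓ : ℕ → ℝ → ℝ} {t : ℝ}
    (h : j < vanishOrder N ℓ t) : ℓ j t = 0 := by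
  induction N generalizing ℓ j with
  | zero => exact absurd h (Nat.not_lt_zero _)
  | succ N ih =>
    rw [vanishOrder] at h
    split_ifs at h with h0
    · match j with
      | 0 => exact h0
      | j + 1 => exact ih (ℓ := fun j => ℓ (j + 1)) (Nat.lt_of_succ_lt_succ h)
    · exact absurd h (Nat.not_lt_zero _)

theorem apply_vanishOrder_ne_zero {N : ℕ} {ℓ : ℕ → ℝ → ℝ} {t : ℝ}
    (h : ∃ j ≤ N, ℓ j t ≠ 0) : ℓ (vanishOrder N ℓ t) t ≠ 0 := by
  induction N generalizing ℓ with
  | zero =>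
    obtain ⟨j, hj, h⟩ := h
    obtain rfl : j = 0 := by omega
    exact h
  | succ N ih =>
    rw [vanishOrder]
    split_ifs with h0
    · refine ih (ℓ := fun j => ℓ (j + 1)) ?_
      obtain ⟨j, hj, h⟩ := h
      match j with
      | 0 => exact absurd h0 h
      | j + 1 => exact ⟨j, by omega, h⟩
    · exact h0

/-- Rolle's theorem for a finite set of zeroes. -/
theorem exists_finset_deriv_eq_zero {a b : ℝ} {f f' : ℝ → ℝ}
    (hf : ∀ t ∈ Set.Icc a b, HasDerivWithinAt f (f' t) (Set.Icc a b) t) (S : Finset ℝ)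
    (hS : ↑S ⊆ Set.Icc a b) (h0 : ∀ t ∈ S, f t = 0) :
    ∃ T : Finset ℝ, ↑T ⊆ Set.Icc a b ∧ (∀ t ∈ T, f' t = 0) ∧ Disjoint S T ∧
      (∀ t ∈ T, ∃ s ∈ S, t < s) ∧ S.card ≤ T.card + 1 := by
  induction S using Finset.induction_on_max with
  | empty => exact ⟨∅, by simp, by simp, by simp, by simp, by simp⟩
  | insert x S hx ih =>
    have hxJ : x ∈ Set.Icc a b := hS (by simp)
    obtain ⟨T, hT, hT0, hdisj, hlt, hcard⟩ := ih (fun s hs => hS (by simp [Finset.mem_coe.1 hs]))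
      fun t ht => h0 t (by simp [ht])
    have hxS : x ∉ S := fun h => lt_irrefl _ (hx x h)
    rcases S.eq_empty_or_nonempty with rfl | hne
    · exact ⟨∅, by simp, by simp, by simp, by simp, by simp⟩
    · set y := S.max' hne
      have hyS : y ∈ S := S.max'_mem hne
      have hyJ : y ∈ Set.Icc a b := hS (by simp [hyS])
      have hyx : y < x := hx y hyS
      obtain ⟨c, hc, hc0⟩ := exists_hasDerivAt_eq_zero (f := f) (f' := f') hyx
        (fun t ht => ((hf t ⟨hyJ.1.trans ht.1, ht.2.trans hxJ.2⟩).continuousWithinAt).mono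
          (Set.Icc_subset_Icc hyJ.1 hxJ.2))
        (by rw [h0 y (by simp [hyS]), h0 x (by simp)])
        (fun t ht => (hf t ⟨hyJ.1.trans ht.1.le, ht.2.le.trans hxJ.2⟩).hasDerivAt
          (Icc_mem_nhds (hyJ.1.trans_lt ht.1) (ht.2.trans_le hxJ.2)))
      -- This is the use of the clause that each point of T lies below some point of S: old Rolle
      -- points stay left of y, so the point found in (y, x) is new.
      have hTy : ∀ t ∈ T, t < y := fun t ht => by
        obtain ⟨s, hs, hts⟩ := hlt t ht
        exact hts.trans_le (S.le_max' s hs)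
      have hcT : c ∉ T := fun h => lt_asymm hc.1 (hTy c h)
      refine ⟨insert c T, ?_, ?_, ?_, ?_, ?_⟩
      · intro t ht
        rcases Finset.mem_insert.1 (Finset.mem_coe.1 ht) with rfl | ht
        · exact ⟨hyJ.1.trans hc.1.le, hc.2.le.trans hxJ.2⟩
        · exact hT ht
      · intro t ht
        rcases Finset.mem_insert.1 ht with rfl | ht
        · exact hc0
        · exact hT0 t ht
      · rw [Finset.disjoint_left] at hdisj ⊢
        intro t ht ht'
        rcases Finset.mem_insert.1 ht with rfl | ht <;>
          rcases Finset.mem_insert.1 ht' with h | h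
        · exact hc.2.ne h.symm
        · exact lt_asymm hyx (hTy _ h)
        · exact absurd (h ▸ S.le_max' t ht) (not_le.2 hc.1)
        · exact hdisj ht h
      · intro t ht
        rcases Finset.mem_insert.1 ht with rfl | ht
        · exact ⟨x, by simp, hc.2⟩
        · exact ⟨y, by simp [hyS], hTy t ht⟩
      · rw [Finset.card_insert_of_notMem hxS, Finset.card_insert_of_notMem hcT]
        omega

/-- A chain of functions, each a positive multiple of the derivative of the previous one. -/
theorem sum_vanishOrder_le {a b : ℝ} (hab : a < b) (N : ℕ) (ℓ β : ℕ → ℝ → ℝ)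
    (hβ : ∀ j < N, ∀ t ∈ Set.Icc a b, 0 < β j t)
    (hℓ : ∀ j < N, ∀ t ∈ Set.Icc a b,
      HasDerivWithinAt (ℓ j) (β j t * ℓ (j + 1) t) (Set.Icc a b) t)
    (hconst : ∀ t ∈ Set.Icc a b, ℓ N t = ℓ N a)
    (hne : ∃ t ∈ Set.Icc a b, ∃ j ≤ N, ℓ j t ≠ 0) (S : Finset ℝ) (hS : ↑S ⊆ Set.Icc a b) :
    ∑ t ∈ S, vanishOrder N ℓ t ≤ N := by
  induction N generalizing ℓ β S with
  | zero => simp [vanishOrder]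
  | succ N ih =>
    set ℓ' : ℕ → ℝ → ℝ := fun j => ℓ (j + 1) with hℓ'
    by_cases htail : ∃ t ∈ Set.Icc a b, ∃ j ≤ N, ℓ' j t ≠ 0
    · have ih' := ih ℓ' (fun j => β (j + 1)) (fun j hj => hβ (j + 1) (by omega))
        (fun j hj => hℓ (j + 1) (by omega)) hconst htail
      set S₀ := S.filter fun t => ℓ 0 t = 0
      obtain ⟨T, hT, hT0, hdisj, -, hcard⟩ := exists_finset_deriv_eq_zero (hℓ 0 (by omega)) S₀
        (fun t ht => hS (Finset.mem_filter.1 (Finset.mem_coe.1 ht)).1)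
        (fun t ht => (Finset.mem_filter.1 ht).2)
      have hsum : ∑ t ∈ S, vanishOrder (N + 1) ℓ t =
          ∑ t ∈ S₀, vanishOrder N ℓ' t + S₀.card := by
        rw [Finset.card_eq_sum_ones, ← Finset.sum_add_distrib, Finset.sum_filter]
        exact Finset.sum_congr rfl fun t _ => rfl
      rw [hsum]
      have hT1 : ∀ t ∈ T, ℓ' 0 t = 0 := fun t ht =>
        (mul_eq_zero.1 (hT0 t ht)).resolve_left (hβ 0 (by omega) t (hT ht)).ne'
      -- Each Rolle point adds at least one zero of the shortened chain. For N = 0, where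
      -- `vanishOrder` is 0 by definition, T is empty because the last function is a nonzero
      -- constant.
      have hTcard : T.card ≤ ∑ t ∈ T, vanishOrder N ℓ' t := by
        rw [Finset.card_eq_sum_ones]
        refine Finset.sum_le_sum fun t ht => ?_
        match N with
        | 0 =>
          obtain ⟨s, hs, j, hj, hne⟩ := htail
          obtain rfl : j = 0 := by omega
          exact absurd ((hconst s hs).trans ((hconst t (hT ht)).symm.trans (hT1 t ht))) hne
        | N + 1 =>
          rw [vanishOrder, if_pos (hT1 t ht)]
          omega
      have := ih' (S₀ ∪ T) (by
        rw [Finset.coe_union]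
        exact Set.union_subset
          (fun t ht => hS (Finset.mem_filter.1 (Finset.mem_coe.1 ht)).1) hT)
      rw [Finset.sum_union hdisj] at this
      omega
    -- If the rest of the chain vanishes identically, the first function is a nonzero constant and
    -- has no zeroes.
    · push Not at htail
      have hc : ∀ t ∈ Set.Icc a b, ℓ 0 t = ℓ 0 a :=
        constant_of_derivWithin_zero
          (fun t ht => (hℓ 0 (by omega) t ht).differentiableWithinAt) fun t ht => by
            have ht' : t ∈ Set.Icc a b := ⟨ht.1, ht.2.le⟩
            rw [(hℓ 0 (by omega) t ht').derivWithin (uniqueDiffOn_Icc hab t ht')]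
            have := htail t ht' 0 (by omega)
            simp only [hℓ'] at this
            rw [this, mul_zero]
      obtain ⟨s, hs, j, hj, hne⟩ := hne
      have h0 : ℓ 0 s ≠ 0 := by
        match j with
        | 0 => exact hne
        | j + 1 => exact absurd (htail s hs j (by omega)) hne
      rw [Finset.sum_eq_zero]
      · exact Nat.zero_le _
      · intro t ht
        rw [vanishOrder, if_neg]
        rw [hc t (hS ht), ← hc s hs]
        exact h0

/-! ### Triangular factorization of a Wronski matrix -/

theorem lower_mul_apply {m : ℕ} {L : Matrix (Fin m) (Fin m) ℝ} (hL : L ∈ lowerUnitriangular m)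
    (A : Matrix (Fin m) (Fin m) ℝ) (i j : Fin m) :
    (L * A) i j = ∑ k ∈ Finset.Iio i, L i k * A k j + A i j := by
  have : (L * A) i j = ∑ k ∈ Finset.Iic i, L i k * A k j := by
    rw [Matrix.mul_apply]
    refine (Finset.sum_subset (Finset.subset_univ _) fun k _ hk => ?_).symm
    rw [hL.1 i k (by simpa using hk), zero_mul]
  rw [this, ← Finset.Iio_insert, Finset.sum_insert (by simp), hL.2, one_mul, add_comm]

theorem mul_upper_apply {m : ℕ} {U : Matrix (Fin m) (Fin m) ℝ} (hU : ∀ i j, j < i → U i j = 0)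
    (A : Matrix (Fin m) (Fin m) ℝ) (i j : Fin m) :
    (A * U) i j = ∑ k ∈ Finset.Iio j, A i k * U k j + A i j * U j j := by
  have : (A * U) i j = ∑ k ∈ Finset.Iic j, A i k * U k j := by
    rw [Matrix.mul_apply]
    refine (Finset.sum_subset (Finset.subset_univ _) fun k _ hk => ?_).symm
    rw [hU k j (by simpa using hk), mul_zero]
  rw [this, ← Finset.Iio_insert, Finset.sum_insert (by simp), add_comm]

/-- The columns of the lower factor of a Wronski matrix form a chain. -/
theorem exists_hasDerivWithinAt_lower {n : ℕ} {J : Set ℝ}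
    {W L U : ℝ → Matrix (Fin (n + 1)) (Fin (n + 1)) ℝ} {t : ℝ} (ht : t ∈ J)
    (hJ : UniqueDiffWithinAt ℝ J t)
    (hdiff : ∀ i j, DifferentiableWithinAt ℝ (fun t => W t i j) J t)
    (hW : ∀ i (j : ℕ) (hj : j + 1 < n + 1),
      HasDerivWithinAt (fun t => W t i ⟨j, by omega⟩) (W t i ⟨j + 1, hj⟩) J t)
    (hL : ∀ t ∈ J, L t ∈ lowerUnitriangular (n + 1)) (hU : ∀ t ∈ J, U t ∈ upperPositive (n + 1))
    (hLU : ∀ t ∈ J, W t = L t * U t) (j : ℕ) (hj : j + 1 < n + 1) :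
    ∃ β > 0, ∀ i, HasDerivWithinAt (fun t => L t i ⟨j, by omega⟩) (β * L t i ⟨j + 1, hj⟩) J t := by
  -- Elimination computes row k of U and then column k of L rationally from W and the earlier rows
  -- and columns, so differentiability passes from W to both factors.
  have hd : ∀ k, (∀ j, DifferentiableWithinAt ℝ (fun t => U t k j) J t) ∧
      ∀ i, DifferentiableWithinAt ℝ (fun t => L t i k) J t := by
    intro k
    induction k using WellFoundedLT.induction with
    | _ k ih =>
      have h1 : ∀ j, DifferentiableWithinAt ℝ (fun t => U t k j) J t := by
        intro j
        have hs : DifferentiableWithinAt ℝ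
            (fun s => W s k j - ∑ l ∈ Finset.Iio k, L s k l * U s l j) J t :=
          (hdiff k j).sub (DifferentiableWithinAt.fun_sum fun l hl =>
            ((ih l (Finset.mem_Iio.1 hl)).2 k).mul ((ih l (Finset.mem_Iio.1 hl)).1 j))
        have he : ∀ s ∈ J, U s k j = W s k j - ∑ l ∈ Finset.Iio k, L s k l * U s l j := by
          intro s hs
          rw [hLU s hs, lower_mul_apply (hL s hs)]
          ring
        exact hs.congr he (he t ht)
      refine ⟨h1, fun i => ?_⟩
      have hs : DifferentiableWithinAt ℝ
          (fun s => (W s i k - ∑ l ∈ Finset.Iio k, L s i l * U s l k) / U s k k) J t :=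
        ((hdiff i k).sub (DifferentiableWithinAt.fun_sum fun l hl =>
          ((ih l (Finset.mem_Iio.1 hl)).2 i).mul ((ih l (Finset.mem_Iio.1 hl)).1 k))).div (h1 k)
            ((hU t ht).2 k).ne'
      have he : ∀ s ∈ J, L s i k =
          (W s i k - ∑ l ∈ Finset.Iio k, L s i l * U s l k) / U s k k := by
        intro s hs
        rw [hLU s hs, mul_upper_apply (hU s hs).1, eq_div_iff ((hU s hs).2 k).ne']
        ring
      exact hs.congr he (he t ht)
  set L' : Matrix (Fin (n + 1)) (Fin (n + 1)) ℝ :=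
    Matrix.of fun i j => derivWithin (fun t => L t i j) J t with hL'
  set U' : Matrix (Fin (n + 1)) (Fin (n + 1)) ℝ :=
    Matrix.of fun i j => derivWithin (fun t => U t i j) J t with hU'
  have hL'0 : ∀ i j, i ≤ j → L' i j = 0 := by
    intro i j hij
    have : ∀ s ∈ J, L s i j = L t i j := by
      intro s hs
      rcases hij.eq_or_lt with rfl | hlt
      · rw [(hL s hs).2, (hL t ht).2]
      · rw [(hL s hs).1 i j hlt, (hL t ht).1 i j hlt]
    simp only [hL', Matrix.of_apply]
    rw [derivWithin_congr (f := fun _ => L t i j) this rfl]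
    simp
  have hU'0 : ∀ i j, j < i → U' i j = 0 := by
    intro i j hij
    have : ∀ s ∈ J, U s i j = 0 := fun s hs => (hU s hs).1 i j hij
    simp only [hU', Matrix.of_apply]
    rw [derivWithin_congr (f := fun _ => 0) this (this t ht)]
    simp
  have hLdet : IsUnit (L t).det := by
    rw [Matrix.det_of_isLowerTriangular]
    · simp [(hL t ht).2]
    · intro a b hab
      exact (hL t ht).1 a b hab
  -- As L is unitriangular, K is strictly lower triangular. Differentiating W = L U and cancelling L
  -- shows that K U + U' is U shifted by one column, which leaves in column j of K only the
  -- subdiagonal entry U_{j+1,j+1} / U_{j,j} > 0. Then L' = L K is the chain relation.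
  set K := (L t)⁻¹ * L' with hK
  have hLK : L t * K = L' := by rw [hK, ← mul_assoc, Matrix.mul_nonsing_inv _ hLdet, one_mul]
  have hK0 : ∀ i j, i ≤ j → K i j = 0 := by
    intro i j
    induction i using WellFoundedLT.induction with
    | _ i ih =>
      intro hij
      have h := lower_mul_apply (hL t ht) K i j
      rw [hLK, hL'0 i j hij, Finset.sum_eq_zero, zero_add] at h
      · exact h.symm
      · intro k hk
        rw [ih k (Finset.mem_Iio.1 hk) ((Finset.mem_Iio.1 hk).le.trans hij), mul_zero]
  have hKU : ∀ i (j : ℕ) (hj : j + 1 < n + 1),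
      (K * U t) i ⟨j, by omega⟩ + U' i ⟨j, by omega⟩ = U t i ⟨j + 1, hj⟩ := by
    intro i j hj
    have h1 : ∀ i, (L' * U t) i ⟨j, by omega⟩ + (L t * U') i ⟨j, by omega⟩ =
        (L t * U t) i ⟨j + 1, hj⟩ := by
      intro i
      have hder : HasDerivWithinAt (fun s => (L s * U s) i ⟨j, by omega⟩)
          ((L' * U t) i ⟨j, by omega⟩ + (L t * U') i ⟨j, by omega⟩) J t := by
        simp only [Matrix.mul_apply]
        rw [← Finset.sum_add_distrib]
        exact HasDerivWithinAt.fun_sum fun k _ =>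
          ((hd k).2 i).hasDerivWithinAt.mul ((hd k).1 _).hasDerivWithinAt
      have hder' := (hW i j hj).congr (fun s hs => by rw [hLU s hs]) (by rw [hLU t ht])
      rw [← hLU t ht]
      exact hJ.eq_deriv _ hder hder'
    set v : Fin (n + 1) → ℝ := fun i =>
      (K * U t) i ⟨j, by omega⟩ + U' i ⟨j, by omega⟩ - U t i ⟨j + 1, hj⟩ with hv
    have hv0 : (L t).mulVec v = 0 := by
      ext i
      have e1 : (L t).mulVec v i = (L t * (K * U t)) i ⟨j, by omega⟩ +
          (L t * U') i ⟨j, by omega⟩ - (L t * U t) i ⟨j + 1, hj⟩ := by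
        simp only [Matrix.mulVec, dotProduct, hv, mul_sub, mul_add, Finset.sum_sub_distrib,
          Finset.sum_add_distrib]
        rw [Matrix.mul_apply, Matrix.mul_apply, Matrix.mul_apply]
      rw [e1, ← mul_assoc, hLK, h1, sub_self, Pi.zero_apply]
    have := congrFun (Matrix.eq_zero_of_mulVec_eq_zero hLdet.ne_zero hv0) i
    exact sub_eq_zero.1 this
  have hK1 : ∀ (j : ℕ) (hj : j + 1 < n + 1) (i : Fin (n + 1)), j + 1 < i →
      K i ⟨j, by omega⟩ = 0 := by
    intro j
    induction j using Nat.strong_induction_on with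
    | _ j ih =>
      intro hj i hi
      have h := hKU i j hj
      rw [mul_upper_apply (hU t ht).1, Finset.sum_eq_zero, zero_add,
        hU'0 i ⟨j, by omega⟩ (by rw [Fin.lt_def]; simp only; omega), add_zero,
        (hU t ht).1 i ⟨j + 1, hj⟩ (by rw [Fin.lt_def]; exact hi)] at h
      · exact (mul_eq_zero.1 h).resolve_right ((hU t ht).2 _).ne'
      · intro k hk
        have hk' : (k : ℕ) < j := by simpa [Fin.lt_def] using hk
        rw [ih k hk' (by omega) i (by omega), zero_mul]
  have hKj : K ⟨j + 1, hj⟩ ⟨j, by omega⟩ =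
      U t ⟨j + 1, hj⟩ ⟨j + 1, hj⟩ / U t ⟨j, by omega⟩ ⟨j, by omega⟩ := by
    have h := hKU ⟨j + 1, hj⟩ j hj
    rw [mul_upper_apply (hU t ht).1, Finset.sum_eq_zero, zero_add,
      hU'0 ⟨j + 1, hj⟩ ⟨j, by omega⟩ (by simp [Fin.lt_def]), add_zero] at h
    · rw [← h, mul_div_cancel_right₀ _ ((hU t ht).2 _).ne']
    · intro k hk
      have hk' : (k : ℕ) < j := by simpa [Fin.lt_def] using hk
      rw [hK1 k (by omega) ⟨j + 1, hj⟩ (by simp only; omega), zero_mul]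
  refine ⟨K ⟨j + 1, hj⟩ ⟨j, by omega⟩, ?_, fun i => ?_⟩
  · rw [hKj]
    exact div_pos ((hU t ht).2 _) ((hU t ht).2 _)
  · have h1 := ((hd ⟨j, by omega⟩).2 i).hasDerivWithinAt
    have h2 : L' i ⟨j, by omega⟩ = K ⟨j + 1, hj⟩ ⟨j, by omega⟩ * L t i ⟨j + 1, hj⟩ := by
      rw [← hLK, Matrix.mul_apply, Fintype.sum_eq_single ⟨j + 1, hj⟩, mul_comm]
      intro k hk
      rcases Nat.lt_or_ge (j + 1) k with h | h
      · rw [hK1 j hj k h, mul_zero]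
      · rw [hK0 k ⟨j, by omega⟩, mul_zero]
        rw [Fin.le_def]
        simp only [ne_eq, Fin.ext_iff] at hk ⊢
        omega
    rw [← h2]
    exact h1

/-- A linear combination of functions whose Wronski matrix admits a triangular factorization has at
most `n` zeroes. -/
theorem zeroCount_le_of_lower_mul_upper {n : ℕ} {a b : ℝ} (hab : a < b)
    {W L U : ℝ → Matrix (Fin (n + 1)) (Fin (n + 1)) ℝ}
    (hdiff : ∀ t ∈ Set.Icc a b, ∀ i j, DifferentiableWithinAt ℝ (fun t => W t i j) (Set.Icc a b) t)
    (hW : ∀ t ∈ Set.Icc a b, ∀ i (j : ℕ) (hj : j + 1 < n + 1),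
      HasDerivWithinAt (fun t => W t i ⟨j, by omega⟩) (W t i ⟨j + 1, hj⟩) (Set.Icc a b) t)
    (hL : ∀ t ∈ Set.Icc a b, L t ∈ lowerUnitriangular (n + 1))
    (hU : ∀ t ∈ Set.Icc a b, U t ∈ upperPositive (n + 1))
    (hLU : ∀ t ∈ Set.Icc a b, W t = L t * U t) {c : Fin (n + 1) → ℝ} (hc : c ≠ 0) {f : ℝ → ℝ}
    (hf : ∀ t ∈ Set.Icc a b, ∀ j : Fin (n + 1),
      iteratedDerivWithin j f (Set.Icc a b) t = Matrix.vecMul c (W t) j) :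
    zeroCount f (Set.Icc a b) ≤ n := by
  have hchain : ∀ j t, ∃ β : ℝ, j < n → t ∈ Set.Icc a b → 0 < β ∧ ∀ (hj : j + 1 < n + 1) i,
      HasDerivWithinAt (fun t => L t i ⟨j, by omega⟩) (β * L t i ⟨j + 1, hj⟩) (Set.Icc a b) t := by
    intro j t
    by_cases h : j < n ∧ t ∈ Set.Icc a b
    · obtain ⟨β, hβ, hd⟩ := exists_hasDerivWithinAt_lower h.2 (uniqueDiffOn_Icc hab t h.2)
        (hdiff t h.2) (hW t h.2) hL hU hLU j (by omega)
      exact ⟨β, fun _ _ => ⟨hβ, fun _ => hd⟩⟩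
    · exact ⟨0, fun h1 h2 => absurd ⟨h1, h2⟩ h⟩
  choose β hβ using hchain
  set ℓ : ℕ → ℝ → ℝ := fun j t =>
    if hj : j < n + 1 then Matrix.vecMul c (L t) ⟨j, hj⟩ else 0 with hℓ
  have hℓap : ∀ j (hj : j < n + 1) t, ℓ j t = Matrix.vecMul c (L t) ⟨j, hj⟩ :=
    fun j hj t => dif_pos hj
  have hℓne : ∀ t ∈ Set.Icc a b, ∃ j ≤ n, ℓ j t ≠ 0 := by
    intro t ht
    by_contra! h
    refine hc (Matrix.eq_zero_of_vecMul_eq_zero (M := L t) ?_ ?_)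
    · rw [Matrix.det_of_isLowerTriangular]
      · simp [(hL t ht).2]
      · intro x y hxy
        exact (hL t ht).1 x y hxy
    · ext j
      have := h j (by omega)
      simp only [hℓ] at this
      rwa [dif_pos j.2] at this
  have hcount := sum_vanishOrder_le hab n ℓ β (fun j hj t ht => (hβ j t hj ht).1)
    (fun j hj t ht => by
      have h := (hβ j t hj ht).2 (by omega)
      have h2 : HasDerivWithinAt (fun t => ∑ i, c i * L t i ⟨j, by omega⟩)
          (∑ i, c i * (β j t * L t i ⟨j + 1, by omega⟩)) (Set.Icc a b) t :=
        HasDerivWithinAt.fun_sum fun i _ => (h i).const_mul (c i)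
      have e1 : ℓ j = fun t => ∑ i, c i * L t i ⟨j, by omega⟩ := by
        funext t
        simp only [hℓ]
        rw [dif_pos (by omega)]
        rfl
      have e2 : β j t * ℓ (j + 1) t = ∑ i, c i * (β j t * L t i ⟨j + 1, by omega⟩) := by
        simp only [hℓ]
        rw [dif_pos (by omega), Matrix.vecMul, dotProduct, Finset.mul_sum]
        exact Finset.sum_congr rfl fun i _ => by ring
      rw [e1, e2]
      exact h2)
    (by
      have hlast : ∀ t ∈ Set.Icc a b, ℓ n t = c (Fin.last n) := by
        intro t ht
        simp only [hℓ]
        rw [dif_pos (by omega), Matrix.vecMul, dotProduct, Fintype.sum_eq_single (Fin.last n)]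
        · change c (Fin.last n) * L t (Fin.last n) (Fin.last n) = _
          rw [(hL t ht).2, mul_one]
        · intro i hi
          have h0 : L t i ⟨n, by omega⟩ = 0 := (hL t ht).1 i _ (Fin.lt_last_iff_ne_last.2 hi)
          rw [h0, mul_zero]
      intro t ht
      rw [hlast t ht, hlast a ⟨le_rfl, hab.le⟩])
    ⟨a, ⟨le_rfl, hab.le⟩, hℓne a ⟨le_rfl, hab.le⟩⟩
  -- The derivatives of f are the entries of (c L) U with U upper triangular. If v is the first
  -- index at which the chain c L does not vanish, the derivative of order v is that entry times a
  -- positive diagonal entry.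
  have hmult : ∀ t ∈ Set.Icc a b,
      zeroMultiplicity f (Set.Icc a b) t ≤ (vanishOrder n ℓ t : ℕ∞) := by
    intro t ht
    have hle := vanishOrder_le n ℓ t
    have hne := apply_vanishOrder_ne_zero (hℓne t ht)
    refine iInf₂_le (vanishOrder n ℓ t) ?_
    rw [hf t ht ⟨vanishOrder n ℓ t, by omega⟩, hLU t ht, ← Matrix.vecMul_vecMul]
    have hsum : Matrix.vecMul (Matrix.vecMul c (L t)) (U t) ⟨vanishOrder n ℓ t, by omega⟩ =
        ℓ (vanishOrder n ℓ t) t *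
          U t ⟨vanishOrder n ℓ t, by omega⟩ ⟨vanishOrder n ℓ t, by omega⟩ := by
      rw [Matrix.vecMul, dotProduct, Fintype.sum_eq_single ⟨vanishOrder n ℓ t, by omega⟩]
      · rw [hℓap _ (by omega)]
      · intro k hk
        rcases lt_or_gt_of_ne hk with h | h
        · have h0 := eq_zero_of_lt_vanishOrder (N := n) (ℓ := ℓ) (t := t) (j := k) h
          rw [hℓap _ k.2] at h0
          rw [h0, zero_mul]
        · rw [(hU t ht).1 _ _ h, mul_zero]
    rw [hsum]
    exact mul_ne_zero hne ((hU t ht).2 _).ne'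
  refine iSup₂_le fun S hS => ?_
  calc ∑ t ∈ S, zeroMultiplicity f (Set.Icc a b) t
      ≤ ∑ t ∈ S, (vanishOrder n ℓ t : ℕ∞) := Finset.sum_le_sum fun t ht => hmult t (hS ht)
    _ = ((∑ t ∈ S, vanishOrder n ℓ t : ℕ) : ℕ∞) := by push_cast; rfl
    _ ≤ n := by exact_mod_cast hcount S hS

/-! ### The double covering is a homomorphism -/

section SpinGroup

variable {n : ℕ}

theorem cliffordι_injective : Function.Injective (CliffordAlgebra.ι (eucForm n)) := by
  rw [injective_iff_map_eq_zero]
  intro v hv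
  have h := CliffordAlgebra.ι_sq_scalar (eucForm n) v
  rw [hv, zero_mul, eucForm_apply, eq_comm,
    FaithfulSMul.algebraMap_eq_zero_iff ℝ (CliffordAlgebra (eucForm n))] at h
  simpa using h

theorem coe_mul_coe_inv (z : Spin n) :
    (z : CliffordAlgebra (eucForm n)) * ((z⁻¹ : Spin n) : CliffordAlgebra (eucForm n)) = 1 := by
  rw [← Submonoid.coe_mul, mul_inv_cancel, Submonoid.coe_one]

theorem coe_inv_mul_coe (z : Spin n) :
    ((z⁻¹ : Spin n) : CliffordAlgebra (eucForm n)) * (z : CliffordAlgebra (eucForm n)) = 1 := by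
  rw [← Submonoid.coe_mul, inv_mul_cancel, Submonoid.coe_one]

theorem spinConj_eq_of_mul_eq {z : Spin n} {v w : Euc n}
    (h : CliffordAlgebra.ι (eucForm n) w * (z : CliffordAlgebra (eucForm n)) =
      (z : CliffordAlgebra (eucForm n)) * CliffordAlgebra.ι (eucForm n) v) : spinConj z v = w := by
  apply cliffordι_injective
  rw [spinConj_spec, ← h, mul_assoc, coe_mul_coe_inv, mul_one]

/-- The linear map `v ↦ z v z⁻¹`. -/
def spinConjLinear (z : Spin n) : Euc n →ₗ[ℝ] Euc n where
  toFun := spinConj z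
  map_add' u v := cliffordι_injective (by
    rw [map_add, spinConj_spec, spinConj_spec, spinConj_spec, map_add, mul_add, add_mul])
  map_smul' c v := cliffordι_injective (by
    rw [RingHom.id_apply, map_smul, spinConj_spec, spinConj_spec, map_smul, mul_smul_comm,
      smul_mul_assoc])

theorem spinConj_mul (z w : Spin n) (v : Euc n) :
    spinConj (z * w) v = spinConj z (spinConj w v) := by
  apply cliffordι_injective
  rw [spinConj_spec, spinConj_spec, spinConj_spec, mul_inv_rev, Submonoid.coe_mul,
    Submonoid.coe_mul]
  simp only [mul_assoc]

theorem norm_spinConj (z : Spin n) (v : Euc n) : ‖spinConj z v‖ = ‖v‖ := by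
  have h := CliffordAlgebra.ι_sq_scalar (eucForm n) (spinConj z v)
  have e : CliffordAlgebra.ι (eucForm n) (spinConj z v) * CliffordAlgebra.ι (eucForm n)
      (spinConj z v) = algebraMap ℝ _ (eucForm n v) := by
    rw [spinConj_spec]
    calc _ = (z : CliffordAlgebra (eucForm n)) * CliffordAlgebra.ι (eucForm n) v *
          (((z⁻¹ : Spin n) : CliffordAlgebra (eucForm n)) * (z : CliffordAlgebra (eucForm n))) *
          CliffordAlgebra.ι (eucForm n) v * ((z⁻¹ : Spin n) : CliffordAlgebra (eucForm n)) := by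
            simp only [mul_assoc]
      _ = (z : CliffordAlgebra (eucForm n)) * (CliffordAlgebra.ι (eucForm n) v *
          CliffordAlgebra.ι (eucForm n) v) * ((z⁻¹ : Spin n) : CliffordAlgebra (eucForm n)) := by
            rw [coe_inv_mul_coe, mul_one]; simp only [mul_assoc]
      _ = _ := by
            rw [CliffordAlgebra.ι_sq_scalar, ← Algebra.commutes, mul_assoc, coe_mul_coe_inv, mul_one]
  rw [e, (FaithfulSMul.algebraMap_injective ℝ (CliffordAlgebra (eucForm n))).eq_iff, eucForm_apply,
    eucForm_apply] at h
  exact ((sq_eq_sq₀ (norm_nonneg _) (norm_nonneg _)).1 h).symm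

theorem spinConj_apply (z : Spin n) (v : Euc n) (i : Fin (n + 1)) :
    spinConj z v i = ∑ j, spinProj z i j * v j := by
  have h := (EuclideanSpace.basisFun (Fin (n + 1)) ℝ).sum_repr v
  have h2 : spinConjLinear z v = ∑ j, v j • spinConjLinear z (EuclideanSpace.single j 1) := by
    conv_lhs => rw [← h]
    simp [map_sum]
  change spinConjLinear z v i = _
  rw [h2]
  simp [spinProj, spinConjLinear, mul_comm]

theorem spinProj_mul (z w : Spin n) : spinProj (z * w) = spinProj z * spinProj w := by
  ext i j
  rw [Matrix.mul_apply]
  change spinConj (z * w) (EuclideanSpace.single j 1) i = _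
  rw [spinConj_mul, spinConj_apply]
  rfl

theorem spinProj_one : spinProj (1 : Spin n) = 1 := by
  ext i j
  change spinConj 1 (EuclideanSpace.single j 1) i = _
  rw [spinConj_eq_of_mul_eq (w := EuclideanSpace.single j 1) (by simp)]
  simp [Matrix.one_apply]

/-- The double covering as a homomorphism into matrices. -/
def spinProjHom (n : ℕ) : Spin n →* Matrix (Fin (n + 1)) (Fin (n + 1)) ℝ where
  toFun := spinProj
  map_one' := spinProj_one
  map_mul' := spinProj_mul

theorem transpose_spinProj_mul (z : Spin n) : (spinProj z).transpose * spinProj z = 1 := by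
  let φ : Euc n →ₗᵢ[ℝ] Euc n := ⟨spinConjLinear z, norm_spinConj z⟩
  ext i j
  have h := φ.inner_map_map (EuclideanSpace.single i 1) (EuclideanSpace.single j 1)
  rw [EuclideanSpace.inner_single_left, PiLp.inner_apply] at h
  rw [Matrix.mul_apply, Matrix.one_apply]
  simp only [Matrix.transpose_apply]
  rw [show (if i = j then (1 : ℝ) else 0) = (starRingEnd ℝ) 1 *
    (EuclideanSpace.single j (1 : ℝ) : Euc n) i by simp, ← h]
  refine Finset.sum_congr rfl fun k _ => ?_
  simp only [RCLike.inner_apply, conj_trivial]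
  rw [mul_comm]
  rfl

theorem spinProj_inv (z : Spin n) : spinProj z⁻¹ = (spinProj z).transpose := by
  have h : spinProj z⁻¹ * spinProj z = 1 := by
    rw [← spinProj_mul, inv_mul_cancel, spinProj_one]
  calc spinProj z⁻¹ = spinProj z⁻¹ * (spinProj z * (spinProj z).transpose) := by
        rw [mul_eq_one_comm.1 (transpose_spinProj_mul z), mul_one]
    _ = _ := by rw [← mul_assoc, h, one_mul]

theorem spinProj_mem_of_det {z : Spin n} (h : (spinProj z).det = 1) :
    spinProj z ∈ Matrix.specialOrthogonalGroup (Fin (n + 1)) ℝ := by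
  rw [Matrix.mem_specialOrthogonalGroup_iff]
  refine ⟨?_, h⟩
  rw [Matrix.mem_orthogonalGroup_iff']
  exact transpose_spinProj_mul z

/-! ### The one-parameter subgroups -/

theorem ι_single_sq (j : Fin (n + 1)) :
    CliffordAlgebra.ι (eucForm n) (EuclideanSpace.single j 1) *
      CliffordAlgebra.ι (eucForm n) (EuclideanSpace.single j 1) = 1 := by
  rw [CliffordAlgebra.ι_sq_scalar, eucForm_apply]
  simp

theorem ι_single_mul_comm {j k : Fin (n + 1)} (h : j ≠ k) :
    CliffordAlgebra.ι (eucForm n) (EuclideanSpace.single j 1) *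
      CliffordAlgebra.ι (eucForm n) (EuclideanSpace.single k 1) =
    -(CliffordAlgebra.ι (eucForm n) (EuclideanSpace.single k 1) *
      CliffordAlgebra.ι (eucForm n) (EuclideanSpace.single j 1)) := by
  refine CliffordAlgebra.ι_mul_ι_comm_of_isOrtho ?_
  have h0 : inner ℝ (EuclideanSpace.single j 1 : Euc n) (EuclideanSpace.single k 1) = 0 := by
    simp [EuclideanSpace.inner_single_left, h]
  rw [QuadraticMap.isOrtho_def, eucForm_apply, eucForm_apply, eucForm_apply, sq, sq, sq,
    norm_add_sq_eq_norm_sq_add_norm_sq_of_inner_eq_zero _ _ h0]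

theorem coe_spinAlpha (i : Fin n) (θ : ℝ) :
    (spinAlpha i θ : CliffordAlgebra (eucForm n)) =
      Real.cos (θ / 2) • (1 : CliffordAlgebra (eucForm n)) + Real.sin (θ / 2) •
        (CliffordAlgebra.ι (eucForm n) (EuclideanSpace.single i.succ 1) *
          CliffordAlgebra.ι (eucForm n) (EuclideanSpace.single i.castSucc 1)) := by
  change CliffordAlgebra.ι (eucForm n) (EuclideanSpace.single i.succ 1) *
    CliffordAlgebra.ι (eucForm n) _ = _
  rw [map_add, map_smul, map_smul, mul_add, mul_smul_comm, mul_smul_comm, ι_single_sq]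

theorem spinAlpha_zero (i : Fin n) : spinAlpha i 0 = 1 := by
  apply Subtype.ext
  rw [coe_spinAlpha]
  simp

theorem spinAlpha_commute {i j : Fin n} (h : (i : ℕ) + 2 ≤ j) (θ θ' : ℝ) :
    spinAlpha i θ * spinAlpha j θ' = spinAlpha j θ' * spinAlpha i θ := by
  apply Subtype.ext
  rw [Submonoid.coe_mul, Submonoid.coe_mul, coe_spinAlpha, coe_spinAlpha]
  have hne : ∀ a b : Fin (n + 1), (a : ℕ) < b → a ≠ b := fun a b hab e => by
    rw [e] at hab; exact lt_irrefl _ hab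
  have h1 := ι_single_mul_comm (hne i.succ j.succ (by simp; omega))
  have h2 := ι_single_mul_comm (hne i.succ j.castSucc (by simp; omega))
  have h3 := ι_single_mul_comm (hne i.castSucc j.succ (by simp; omega))
  have h4 := ι_single_mul_comm (hne i.castSucc j.castSucc (by simp; omega))
  generalize CliffordAlgebra.ι (eucForm n) (EuclideanSpace.single i.succ 1) = A at *
  generalize CliffordAlgebra.ι (eucForm n) (EuclideanSpace.single i.castSucc 1) = B at *
  generalize CliffordAlgebra.ι (eucForm n) (EuclideanSpace.single j.succ 1) = C at *
  generalize CliffordAlgebra.ι (eucForm n) (EuclideanSpace.single j.castSucc 1) = D at *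
  have hBC : Commute (A * B) (C * D) := by
    change A * B * (C * D) = C * D * (A * B)
    calc A * B * (C * D) = A * (B * C) * D := by simp only [mul_assoc]
      _ = -(A * C * (B * D)) := by rw [h3]; simp [mul_assoc]
      _ = -(C * (A * D) * B) := by rw [h1, h4]; simp [mul_assoc]
      _ = C * D * (A * B) := by rw [h2]; simp [mul_assoc]
  exact (((Commute.one_left _).smul_left _).add_left (((Commute.one_right _).smul_right _).add_right
    (hBC.smul_right _) |>.smul_left _)).eq

/-- Comparing w z with z v in the Clifford algebra avoids computing an inverse; what remains are the
subtraction formulas for θ - θ/2. -/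
theorem spinProj_spinAlpha (i : Fin n) (θ : ℝ) :
    spinProj (spinAlpha i θ) = planeMatrix (Real.cos θ) (-Real.sin θ) (Real.sin θ) i := by
  have hne : i.succ ≠ i.castSucc := (Fin.castSucc_lt_succ (i := i)).ne'
  have hcos : Real.cos θ * Real.cos (θ / 2) + Real.sin θ * Real.sin (θ / 2) = Real.cos (θ / 2) := by
    rw [← Real.cos_sub]; ring_nf
  have hsin : Real.sin θ * Real.cos (θ / 2) - Real.cos θ * Real.sin (θ / 2) = Real.sin (θ / 2) := by
    rw [← Real.sin_sub]; ring_nf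
  have h0 := ι_single_sq i.castSucc
  have h1 := ι_single_sq i.succ
  have h10 := ι_single_mul_comm hne
  ext a j
  change spinConj (spinAlpha i θ) (EuclideanSpace.single j 1) a = _
  by_cases hj0 : j = i.castSucc
  · subst hj0
    rw [spinConj_eq_of_mul_eq (w := Real.cos θ • EuclideanSpace.single i.castSucc 1 +
      Real.sin θ • EuclideanSpace.single i.succ 1)]
    · simp only [planeMatrix, Matrix.of_apply, PiLp.add_apply, PiLp.smul_apply, smul_eq_mul,
        PiLp.single_apply, Fin.ext_iff, Fin.val_castSucc, Fin.val_succ]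
      split_ifs <;> first | omega | simp_all
    · rw [map_add, map_smul, map_smul, coe_spinAlpha]
      generalize CliffordAlgebra.ι (eucForm n) (EuclideanSpace.single i.succ 1) = A at *
      generalize CliffordAlgebra.ι (eucForm n) (EuclideanSpace.single i.castSucc 1) = B at *
      have e1 : B * (A * B) = -A := by
        rw [h10, mul_neg, ← mul_assoc, h0, one_mul]
      have e2 : A * (A * B) = B := by rw [← mul_assoc, h1, one_mul]
      have e3 : A * B * B = A := by rw [mul_assoc, h0, mul_one]
      simp only [mul_add, add_mul, smul_mul_assoc, mul_smul_comm, mul_one, one_mul, e1, e2, e3]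
      linear_combination (norm := module) hcos • B + hsin • A
  · by_cases hj1 : j = i.succ
    · subst hj1
      rw [spinConj_eq_of_mul_eq (w := -Real.sin θ • EuclideanSpace.single i.castSucc 1 +
        Real.cos θ • EuclideanSpace.single i.succ 1)]
      · simp only [planeMatrix, Matrix.of_apply, PiLp.add_apply, PiLp.smul_apply, smul_eq_mul,
          PiLp.single_apply, Fin.ext_iff, Fin.val_castSucc, Fin.val_succ]
        split_ifs <;> first | omega | simp_all
      · rw [map_add, map_smul, map_smul, coe_spinAlpha]
        generalize CliffordAlgebra.ι (eucForm n) (EuclideanSpace.single i.succ 1) = A at *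
        generalize CliffordAlgebra.ι (eucForm n) (EuclideanSpace.single i.castSucc 1) = B at *
        have e1 : B * (A * B) = -A := by
          rw [h10, mul_neg, ← mul_assoc, h0, one_mul]
        have e2 : A * (A * B) = B := by rw [← mul_assoc, h1, one_mul]
        have e3 : A * B * A = -B := by rw [h10, neg_mul, mul_assoc, h1, mul_one]
        simp only [mul_add, add_mul, smul_mul_assoc, mul_smul_comm, mul_one, one_mul, e1, e2, e3]
        linear_combination (norm := module) hcos • A - hsin • B
    · rw [spinConj_eq_of_mul_eq (w := EuclideanSpace.single j 1)]
      · have h0' : (j : ℕ) ≠ i := fun h => hj0 (Fin.ext h)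
        have h1' : (j : ℕ) ≠ i + 1 := fun h => hj1 (Fin.ext h)
        simp only [planeMatrix, Matrix.of_apply, PiLp.single_apply, Fin.ext_iff]
        split_ifs <;> first | omega | simp_all
      · rw [coe_spinAlpha]
        have c0 := ι_single_mul_comm hj0
        have c1 := ι_single_mul_comm hj1
        generalize CliffordAlgebra.ι (eucForm n) (EuclideanSpace.single i.succ 1) = A at *
        generalize CliffordAlgebra.ι (eucForm n) (EuclideanSpace.single i.castSucc 1) = B at *
        generalize CliffordAlgebra.ι (eucForm n) (EuclideanSpace.single j 1) = C at *
        have : Commute C (A * B) := by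
          change C * (A * B) = A * B * C
          rw [← mul_assoc, c1, neg_mul, mul_assoc, c0]
          simp [mul_assoc]
        exact (((Commute.one_right _).smul_right _).add_right (this.smul_right _)).eq

/-! ### Topology of the spin group -/

instance cliffordIsModuleTopology (n : ℕ) : IsModuleTopology ℝ (CliffordAlgebra (eucForm n)) := ⟨rfl⟩

instance cliffordContinuousAdd (n : ℕ) : ContinuousAdd (CliffordAlgebra (eucForm n)) :=
  IsModuleTopology.toContinuousAdd ℝ _

theorem continuous_spin_mul_left (z : Spin n) : Continuous fun w : Spin n => z * w :=
  Continuous.subtype_mk ((IsModuleTopology.continuous_of_linearMap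
    (LinearMap.mulLeft ℝ (z : CliffordAlgebra (eucForm n)))).comp continuous_subtype_val) _

theorem continuous_spin_mul_right (z : Spin n) : Continuous fun w : Spin n => w * z :=
  Continuous.subtype_mk ((IsModuleTopology.continuous_of_linearMap
    (LinearMap.mulRight ℝ (z : CliffordAlgebra (eucForm n)))).comp continuous_subtype_val) _

theorem continuous_spin_inv : Continuous fun w : Spin n => w⁻¹ := by
  let φ : CliffordAlgebra (eucForm n) →ₗ[ℝ] CliffordAlgebra (eucForm n) :=
    CliffordAlgebra.reverse ∘ₗ CliffordAlgebra.involute.toLinearMap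
  have h : Continuous φ := IsModuleTopology.continuous_of_linearMap φ
  have e : Subtype.val ∘ (fun w : Spin n => w⁻¹) = φ ∘ Subtype.val := by
    funext w
    exact CliffordAlgebra.star_def _
  rw [continuous_induced_rng, e]
  exact h.comp continuous_subtype_val

/-- The path `∏ α_i(θ)` along the reduced word, from `1` to `acuteEta n`. -/
def spinPath (n : ℕ) (θ : ℝ) : Spin n :=
  blockProd (fun i => if h : i < n then spinAlpha ⟨i, h⟩ θ else 1) n

theorem spinProj_spinPath (n : ℕ) (θ : ℝ) : spinProj (spinPath n θ) = rotationProd n θ := by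
  change spinProjHom n (spinPath n θ) = _
  rw [spinPath, map_blockProd, rotationProd]
  refine blockProd_congr fun i hi => ?_
  rw [dif_pos hi]
  exact spinProj_spinAlpha ⟨i, hi⟩ θ

theorem spinPath_pi_div_two (n : ℕ) : spinPath n (Real.pi / 2) = acuteEta n := by
  rw [acuteEta, etaWord_prod acuteGen
    (fun i => if h : i < n then spinAlpha ⟨i, h⟩ (Real.pi / 2) else 1)]
  · rfl
  · intro i
    rw [dif_pos i.2]
    rfl

theorem spinPath_zero (n : ℕ) : spinPath n 0 = 1 := by
  have : spinPath n 0 ∈ (⊥ : Submonoid (Spin n)) := by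
    refine blockProd_mem _ _ _ fun i hi => ?_
    rw [Submonoid.mem_bot, dif_pos hi, spinAlpha_zero]
  simpa using this

/-- Inversion reverses the word, and this particular word can be reversed using only commutation of
distant letters; no braid relation enters. -/
theorem graveEta_eq_inv (n : ℕ) : graveEta n = (acuteEta n)⁻¹ := by
  have h1 : acuteEta n = blockProd (fun i => if h : i < n then acuteGen ⟨i, h⟩ else 1) n :=
    etaWord_prod _ _ fun i => by rw [dif_pos i.2]
  have h2 : graveEta n =
      blockProd (fun i => (if h : i < n then acuteGen ⟨i, h⟩ else 1 : Spin n)⁻¹) n :=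
    etaWord_prod _ _ fun i => by rw [dif_pos i.2]; rfl
  rw [h1, h2, inv_blockProd]
  refine blockProd_eq_revBlockProd _ _ fun i j hj hij => ?_
  rw [dif_pos hj, dif_pos (by omega : i < n), ← mul_inv_rev, ← mul_inv_rev]
  congr 1
  exact (spinAlpha_commute hij _ _).symm

/-- The paths whose products with continuous paths are continuous. -/
def continuousMultipliers (n : ℕ) : Submonoid (ℝ → Spin n) where
  carrier := {F | ∀ G : ℝ → Spin n, Continuous G → Continuous (F * G)}
  one_mem' := fun G hG => by rwa [one_mul]
  mul_mem' := fun {A B} hA hB G hG => by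
    rw [mul_assoc]
    exact hA _ (hB _ hG)

/-- Factors are attached one at a time on the left: α_i(θ) G(θ) is a combination, with coefficients
cos(θ/2) and sin(θ/2), of G(θ) and a fixed linear image of it. -/
theorem continuous_spinPath (n : ℕ) : Continuous (spinPath n) := by
  have h : blockProd (fun i θ => if h : i < n then spinAlpha ⟨i, h⟩ θ else 1) n ∈
      continuousMultipliers n := by
    refine blockProd_mem _ _ _ fun i hi G hG => ?_
    have hG' : Continuous fun θ => (G θ : CliffordAlgebra (eucForm n)) :=
      continuous_subtype_val.comp hG
    refine continuous_induced_rng.2 ?_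
    have e : (Subtype.val ∘ ((fun θ => if h : i < n then spinAlpha ⟨i, h⟩ θ else 1) * G)) =
        fun θ => Real.cos (θ / 2) • (G θ : CliffordAlgebra (eucForm n)) + Real.sin (θ / 2) •
          LinearMap.mulLeft ℝ
            (CliffordAlgebra.ι (eucForm n) (EuclideanSpace.single (⟨i, hi⟩ : Fin n).succ 1) *
              CliffordAlgebra.ι (eucForm n) (EuclideanSpace.single (⟨i, hi⟩ : Fin n).castSucc 1))
            (G θ : CliffordAlgebra (eucForm n)) := by
      funext θ
      simp only [Function.comp_apply, Pi.mul_apply, dif_pos hi, Submonoid.coe_mul, coe_spinAlpha,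
        add_mul, smul_mul_assoc, one_mul, LinearMap.mulLeft_apply]
    rw [e]
    have hlin := (IsModuleTopology.continuous_of_linearMap (LinearMap.mulLeft ℝ
      (CliffordAlgebra.ι (eucForm n) (EuclideanSpace.single (⟨i, hi⟩ : Fin n).succ 1) *
        CliffordAlgebra.ι (eucForm n) (EuclideanSpace.single (⟨i, hi⟩ : Fin n).castSucc 1)))).comp hG'
    exact ((Real.continuous_cos.comp (continuous_id.div_const 2)).smul hG').add
      ((Real.continuous_sin.comp (continuous_id.div_const 2)).smul hlin)
  have h1 := h 1 continuous_const
  rw [mul_one] at h1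
  have e : blockProd (fun i θ => if h : i < n then spinAlpha ⟨i, h⟩ θ else 1) n = spinPath n := by
    funext θ
    exact map_blockProd (Pi.evalMonoidHom (fun _ : ℝ => Spin n) θ)
      (fun i θ => if h : i < n then spinAlpha ⟨i, h⟩ θ else 1) n
  rwa [e] at h1

end SpinGroup

/-! ### Frenet frames and Wronski matrices -/

namespace IsSmoothNondegenerate

variable {n : ℕ} {γ : ℝ → Euc n} {a b : ℝ}

theorem linearIndependent (h : IsSmoothNondegenerate γ (Set.Icc a b)) {t : ℝ}
    (ht : t ∈ Set.Icc a b) :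
    LinearIndependent ℝ fun k : Fin (n + 1) => iteratedDerivWithin (k : ℕ) γ (Set.Icc a b) t := by
  have h0 := Matrix.linearIndependent_cols_of_det_ne_zero (h.det_pos t ht).ne'
  exact LinearIndependent.of_comp (WithLp.linearEquiv 2 ℝ (Fin (n + 1) → ℝ)).toLinearMap h0

theorem frenetFrame_transpose_mul (γ : ℝ → Euc n) (J : Set ℝ) (t : ℝ)
    (M : Matrix (Fin (n + 1)) (Fin (n + 1)) ℝ) (v : Fin (n + 1) → Euc n)
    (hM : ∀ i j, M i j = v j i) (i j : Fin (n + 1)) :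
    ((frenetFrame γ J t).transpose * M) i j =
      inner ℝ (InnerProductSpace.gramSchmidtNormed ℝ
        (fun k : Fin (n + 1) => iteratedDerivWithin (k : ℕ) γ J t) i) (v j) := by
  rw [Matrix.mul_apply, PiLp.inner_apply]
  refine Finset.sum_congr rfl fun k _ => ?_
  rw [hM]
  simp [frenetFrame, mul_comm]

theorem transpose_frenetFrame_mul_self (h : IsSmoothNondegenerate γ (Set.Icc a b)) {t : ℝ}
    (ht : t ∈ Set.Icc a b) :
    (frenetFrame γ (Set.Icc a b) t).transpose * frenetFrame γ (Set.Icc a b) t = 1 := by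
  ext i j
  refine (frenetFrame_transpose_mul γ _ t (frenetFrame γ (Set.Icc a b) t)
    (InnerProductSpace.gramSchmidtNormed ℝ
      (fun k : Fin (n + 1) => iteratedDerivWithin (k : ℕ) γ (Set.Icc a b) t))
    (fun _ _ => rfl) i j).trans ?_
  rw [orthonormal_iff_ite.1
    (InnerProductSpace.gramSchmidtNormed_orthonormal (h.linearIndependent ht)), Matrix.one_apply]

/-- The Wronski matrix is upper triangular with positive diagonal in the Frenet frame. -/
theorem transpose_frenetFrame_mul_wronskiMatrix (h : IsSmoothNondegenerate γ (Set.Icc a b)) {t : ℝ}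
    (ht : t ∈ Set.Icc a b) :
    (frenetFrame γ (Set.Icc a b) t).transpose * wronskiMatrix γ (Set.Icc a b) t ∈
      upperPositive (n + 1) := by
  set v : Fin (n + 1) → Euc n := fun k => iteratedDerivWithin (k : ℕ) γ (Set.Icc a b) t with hv
  have key := frenetFrame_transpose_mul γ (Set.Icc a b) t (wronskiMatrix γ (Set.Icc a b) t) v
    (fun _ _ => rfl)
  refine ⟨fun i j hij => ?_, fun i => ?_⟩
  · rw [key, InnerProductSpace.gramSchmidtNormed, inner_smul_left,
      InnerProductSpace.gramSchmidt_inv_triangular _ _ hij, mul_zero]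
  · have hne := InnerProductSpace.gramSchmidt_ne_zero (𝕜 := ℝ) i (h.linearIndependent ht)
    have hdiag : inner ℝ (InnerProductSpace.gramSchmidt ℝ v i) (v i) =
        ‖InnerProductSpace.gramSchmidt ℝ v i‖ ^ 2 := by
      conv_lhs => rw [InnerProductSpace.gramSchmidt_def'' ℝ v i]
      rw [inner_add_right, inner_sum, Finset.sum_eq_zero, add_zero, real_inner_self_eq_norm_sq]
      intro k hk
      rw [inner_smul_right, InnerProductSpace.gramSchmidt_orthogonal ℝ v
        (Finset.mem_Iio.1 hk).ne', mul_zero]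
    rw [key, InnerProductSpace.gramSchmidtNormed, inner_smul_left, hdiag]
    have := norm_pos_iff.2 hne
    simp only [RCLike.ofReal_real_eq_id, id_eq, map_inv₀, conj_trivial]
    positivity

theorem det_upperPositive {m : ℕ} {U : Matrix (Fin m) (Fin m) ℝ} (hU : U ∈ upperPositive m) :
    0 < U.det := by
  rw [Matrix.det_of_isUpperTriangular]
  · exact Finset.prod_pos fun i _ => hU.2 i
  · intro i j hij
    exact hU.1 i j hij

/-- Orthogonality gives det² = 1; the sign follows from the positive determinants of the Wronski
matrix and of its triangular factor. -/
theorem det_frenetFrame (h : IsSmoothNondegenerate γ (Set.Icc a b)) {t : ℝ}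
    (ht : t ∈ Set.Icc a b) : (frenetFrame γ (Set.Icc a b) t).det = 1 := by
  have h1 := congrArg Matrix.det (h.transpose_frenetFrame_mul_self ht)
  have h2 := det_upperPositive (h.transpose_frenetFrame_mul_wronskiMatrix ht)
  rw [Matrix.det_mul, Matrix.det_transpose] at h2
  rw [Matrix.det_mul, Matrix.det_transpose, Matrix.det_one] at h1
  have h3 := pos_of_mul_pos_left h2 (h.det_pos t ht).le
  nlinarith

theorem wronskiMatrix_eq (h : IsSmoothNondegenerate γ (Set.Icc a b)) {t : ℝ}
    (ht : t ∈ Set.Icc a b) :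
    wronskiMatrix γ (Set.Icc a b) t = frenetFrame γ (Set.Icc a b) t *
      ((frenetFrame γ (Set.Icc a b) t).transpose * wronskiMatrix γ (Set.Icc a b) t) := by
  rw [← mul_assoc, mul_eq_one_comm.1 (h.transpose_frenetFrame_mul_self ht), one_mul]

theorem differentiableOn (h : IsSmoothNondegenerate γ (Set.Icc a b)) (hab : a < b) (k : ℕ) :
    DifferentiableOn ℝ (iteratedDerivWithin k γ (Set.Icc a b)) (Set.Icc a b) :=
  h.smooth.differentiableOn_iteratedDerivWithin (by exact_mod_cast ENat.natCast_lt_top k)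
    (uniqueDiffOn_Icc hab)

theorem hasDerivWithinAt_wronskiMatrix (h : IsSmoothNondegenerate γ (Set.Icc a b)) (hab : a < b)
    {t : ℝ} (ht : t ∈ Set.Icc a b) (i j : Fin (n + 1)) :
    HasDerivWithinAt (fun s => wronskiMatrix γ (Set.Icc a b) s i j)
      ((iteratedDerivWithin (j + 1) γ (Set.Icc a b) t) i) (Set.Icc a b) t := by
  have h1 := (h.differentiableOn hab j t ht).hasDerivWithinAt
  rw [← iteratedDerivWithin_succ] at h1
  exact hasDerivWithinAt_pi.1 ((PiLp.hasStrictFDerivAt_ofLp (𝕜 := ℝ) 2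
    (E := fun _ : Fin (n + 1) => ℝ) _).hasFDerivAt.comp_hasDerivWithinAt t h1) i

theorem hasDerivWithinAt_mul_wronskiMatrix (h : IsSmoothNondegenerate γ (Set.Icc a b)) (hab : a < b)
    (M : Matrix (Fin (n + 1)) (Fin (n + 1)) ℝ) {t : ℝ} (ht : t ∈ Set.Icc a b) (i : Fin (n + 1))
    (j : ℕ) (hj : j + 1 < n + 1) :
    HasDerivWithinAt (fun s => (M * wronskiMatrix γ (Set.Icc a b) s) i ⟨j, by omega⟩)
      ((M * wronskiMatrix γ (Set.Icc a b) t) i ⟨j + 1, hj⟩) (Set.Icc a b) t := by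
  simp only [Matrix.mul_apply]
  exact HasDerivWithinAt.fun_sum fun k _ =>
    (h.hasDerivWithinAt_wronskiMatrix hab ht k ⟨j, by omega⟩).const_mul (M i k)

theorem differentiableOn_mul_wronskiMatrix (h : IsSmoothNondegenerate γ (Set.Icc a b)) (hab : a < b)
    (M : Matrix (Fin (n + 1)) (Fin (n + 1)) ℝ) (i j : Fin (n + 1)) :
    DifferentiableOn ℝ (fun s => (M * wronskiMatrix γ (Set.Icc a b) s) i j) (Set.Icc a b) := by
  intro t ht
  simp only [Matrix.mul_apply]
  exact DifferentiableWithinAt.fun_sum fun k _ =>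
    ((h.hasDerivWithinAt_wronskiMatrix hab ht k j).differentiableWithinAt).const_mul (M i k)

theorem continuousOn_wronskiMatrix (h : IsSmoothNondegenerate γ (Set.Icc a b)) (hab : a < b) :
    ContinuousOn (wronskiMatrix γ (Set.Icc a b)) (Set.Icc a b) :=
  continuousOn_pi.2 fun i => continuousOn_pi.2 fun j _ ht =>
    (h.hasDerivWithinAt_wronskiMatrix hab ht i j).continuousWithinAt

theorem isWronskianFrom (h : IsSmoothNondegenerate γ (Set.Icc a b)) {t₀ : ℝ}
    (ht₀ : t₀ ∈ Set.Icc a b) (hlt : t₀ < b) :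
    IsWronskianFrom (fun t => (frenetFrame γ (Set.Icc a b) t₀).transpose *
      wronskiMatrix γ (Set.Icc a b) t) t₀ b := by
  have hab := ht₀.1.trans_lt hlt
  refine ⟨hlt, fun i j => ?_, fun i j hj t ht => ?_,
    h.transpose_frenetFrame_mul_wronskiMatrix ht₀⟩
  · exact ((h.differentiableOn_mul_wronskiMatrix hab _ i j t₀ ht₀).continuousWithinAt.mono
      (Set.Icc_subset_Icc_left ht₀.1)).mono_of_mem_nhdsWithin (Icc_mem_nhdsGE hlt)
  · exact (h.hasDerivWithinAt_mul_wronskiMatrix hab _ ⟨ht₀.1.trans ht.1.le, ht.2.le⟩ i j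
      hj).hasDerivAt (Icc_mem_nhds (ht₀.1.trans_lt ht.1) ht.2)

theorem iteratedDerivWithin_dual (h : IsSmoothNondegenerate γ (Set.Icc a b)) (hab : a < b)
    (f : Module.Dual ℝ (Euc n)) {t : ℝ} (ht : t ∈ Set.Icc a b) (k : ℕ) :
    iteratedDerivWithin k (fun s => f (γ s)) (Set.Icc a b) t =
      f (iteratedDerivWithin k γ (Set.Icc a b) t) := by
  have h1 := (LinearMap.toContinuousLinearMap f).iteratedFDerivWithin_comp_left (h.smooth t ht)
    (uniqueDiffOn_Icc hab) ht (i := k) (by exact_mod_cast le_top)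
  rw [iteratedDerivWithin_eq_iteratedFDerivWithin, iteratedDerivWithin_eq_iteratedFDerivWithin]
  have h2 := congrArg (fun F => F fun _ => (1 : ℝ)) h1
  exact h2

end IsSmoothNondegenerate

/-- The coefficients of a linear functional. -/
def dualCoeff {n : ℕ} (f : Module.Dual ℝ (Euc n)) (i : Fin (n + 1)) : ℝ :=
  f (EuclideanSpace.single i 1)

theorem dual_apply {n : ℕ} (f : Module.Dual ℝ (Euc n)) (v : Euc n) :
    f v = ∑ i, dualCoeff f i * v i := by
  have h := (EuclideanSpace.basisFun (Fin (n + 1)) ℝ).sum_repr v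
  conv_lhs => rw [← h]
  simp [dualCoeff, mul_comm]

/-- If the Wronski matrix has a triangular factorization after a change of basis, then the curve is
strictly convex. -/
theorem isStrictlyConvexCurve_of_lower_mul_upper {n : ℕ} {γ : ℝ → Euc n} {a b : ℝ} (hab : a < b)
    (h : IsSmoothNondegenerate γ (Set.Icc a b)) {Q : Matrix (Fin (n + 1)) (Fin (n + 1)) ℝ}
    (hQ : Q.transpose * Q = 1)
    (hLU : ∀ t ∈ Set.Icc a b, ∃ L ∈ lowerUnitriangular (n + 1), ∃ U ∈ upperPositive (n + 1),
      Q.transpose * wronskiMatrix γ (Set.Icc a b) t = L * U) :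
    IsStrictlyConvexCurve γ (Set.Icc a b) := by
  intro f hf
  have hLU' : ∀ t, ∃ L U, t ∈ Set.Icc a b → L ∈ lowerUnitriangular (n + 1) ∧
      U ∈ upperPositive (n + 1) ∧ Q.transpose * wronskiMatrix γ (Set.Icc a b) t = L * U := by
    intro t
    by_cases ht : t ∈ Set.Icc a b
    · obtain ⟨L, hL, U, hU, e⟩ := hLU t ht
      exact ⟨L, U, fun _ => ⟨hL, hU, e⟩⟩
    · exact ⟨0, 0, fun h => absurd h ht⟩
  choose L U hL using hLU'
  have hQ' := mul_eq_one_comm.1 hQ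
  refine zeroCount_le_of_lower_mul_upper hab
    (W := fun t => Q.transpose * wronskiMatrix γ (Set.Icc a b) t)
    (fun t ht i j => h.differentiableOn_mul_wronskiMatrix hab _ i j t ht)
    (fun t ht i j hj => h.hasDerivWithinAt_mul_wronskiMatrix hab _ ht i j hj)
    (fun t ht => (hL t ht).1) (fun t ht => (hL t ht).2.1) (fun t ht => (hL t ht).2.2)
    -- The coefficients of the functional in the basis given by the columns of Q, since Q Qᵀ = 1.
    (c := Matrix.vecMul (dualCoeff f) Q) (fun hc => hf ?_) (fun t ht j => ?_)
  · have h0 : dualCoeff f = 0 := by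
      rw [← Matrix.vecMul_one (dualCoeff f), ← hQ', ← Matrix.vecMul_vecMul, hc, Matrix.zero_vecMul]
    ext v
    rw [dual_apply, h0]
    simp
  · rw [h.iteratedDerivWithin_dual hab f ht, dual_apply, Matrix.vecMul_vecMul, ← mul_assoc, hQ',
      one_mul]
    rfl

/-- A strictly convex curve has no degenerate two-point Wronskians. -/
theorem IsStrictlyConvexCurve.flagMinor_ne_zero {n : ℕ} {γ : ℝ → Euc n} {a b : ℝ} (hab : a < b)
    (h : IsSmoothNondegenerate γ (Set.Icc a b)) (hconv : IsStrictlyConvexCurve γ (Set.Icc a b))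
    {t₀ t₁ : ℝ} (ht₀ : t₀ ∈ Set.Icc a b) (ht₁ : t₁ ∈ Set.Icc a b) (hne : t₀ ≠ t₁) {k : ℕ}
    (hk : k ≤ n + 1) :
    flagMinor ((frenetFrame γ (Set.Icc a b) t₀).transpose * wronskiMatrix γ (Set.Icc a b) t₁) hk
      (rowWindow (n + 1 - k) k (Nat.sub_add_cancel hk).le) ≠ 0 := by
  intro h0
  set F := frenetFrame γ (Set.Icc a b) t₀ with hF
  -- A row relation v of the singular minor defines a functional f, the combination with
  -- coefficients v of inner products with the last k Frenet vectors at t₀.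
  obtain ⟨v, hv, hv0⟩ := Matrix.exists_vecMul_eq_zero_iff.2 h0
  set w := rowWindow (n + 1 - k) k (Nat.sub_add_cancel hk).le with hw
  have hwinj : Function.Injective w := rowWindow_injective _
  let f : Module.Dual ℝ (Euc n) :=
    ∑ d : Fin k, v d • ∑ i, F i (w d) • (EuclideanSpace.proj i : Euc n →L[ℝ] ℝ).toLinearMap
  have hf : ∀ x : Euc n, f x = ∑ d : Fin k, v d * ∑ i, F i (w d) * x i := by
    intro x
    simp [f]
  have hfW : ∀ t (j : Fin (n + 1)), f (iteratedDerivWithin j γ (Set.Icc a b) t) =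
      ∑ d : Fin k, v d * (F.transpose * wronskiMatrix γ (Set.Icc a b) t) (w d) j := by
    intro t j
    rw [hf]
    rfl
  have hfne : f ≠ 0 := by
    intro hf0
    obtain ⟨d, hd⟩ := Function.ne_iff.1 hv
    have h1 : ∀ e, ∑ i, F i (w d) * F i e = (1 : Matrix (Fin (n + 1)) (Fin (n + 1)) ℝ) (w d) e := by
      intro e
      rw [← h.transpose_frenetFrame_mul_self ht₀, Matrix.mul_apply]
      rfl
    -- Evaluating on the d-th of these orthonormal vectors returns v d ≠ 0.
    have h2 := hf (WithLp.toLp 2 fun i => F i (w d))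
    rw [hf0, Fintype.sum_eq_single d] at h2
    · simp only [h1, Matrix.one_apply_eq, LinearMap.zero_apply, mul_one] at h2
      exact hd h2.symm
    · intro e he
      have h3 : ∑ i, F i (w e) * F i (w d) = 0 := by
        rw [show ∑ i, F i (w e) * F i (w d) = ∑ i, F i (w d) * F i (w e) from
          Finset.sum_congr rfl fun i _ => mul_comm _ _, h1, Matrix.one_apply_ne]
        exact fun e' => he (hwinj e').symm
      simp only [h3, mul_zero]
  have hmult : ∀ t ∈ Set.Icc a b, ∀ q : ℕ, q ≤ n + 1 → (∀ j : Fin (n + 1), (j : ℕ) < q →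
      f (iteratedDerivWithin j γ (Set.Icc a b) t) = 0) →
      (q : ℕ∞) ≤ zeroMultiplicity (fun s => f (γ s)) (Set.Icc a b) t := by
    intro t ht q hq hz
    refine le_iInf₂ fun j hj => ?_
    rw [h.iteratedDerivWithin_dual hab f ht] at hj
    by_contra hlt
    have hlt' : j < q := by exact_mod_cast not_le.1 hlt
    exact hj (hz ⟨j, by omega⟩ hlt')
  -- At t₀ the first n + 1 - k derivatives are orthogonal to the last k Frenet vectors; at t₁ the
  -- first k derivatives are killed by the choice of v.
  have hm0 := hmult t₀ ht₀ (n + 1 - k) (by omega) fun j hj => by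
    rw [hfW]
    refine Finset.sum_eq_zero fun d _ => ?_
    rw [(h.transpose_frenetFrame_mul_wronskiMatrix ht₀).1, mul_zero]
    rw [Fin.lt_def]
    simp only [hw, rowWindow]
    omega
  have hm1 := hmult t₁ ht₁ k hk fun j hj => by
    rw [hfW]
    exact congrFun hv0 ⟨j, hj⟩
  have hle : zeroMultiplicity (fun s => f (γ s)) (Set.Icc a b) t₀ +
      zeroMultiplicity (fun s => f (γ s)) (Set.Icc a b) t₁ ≤ n := by
    refine le_trans ?_ (hconv f hfne)
    rw [← Finset.sum_pair hne]
    refine le_iSup₂_of_le {t₀, t₁} ?_ le_rfl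
    intro t ht
    simp only [Finset.coe_insert, Finset.coe_singleton, Set.mem_insert_iff,
      Set.mem_singleton_iff] at ht
    rcases ht with rfl | rfl <;> assumption
  have := (add_le_add hm0 hm1).trans hle
  have h4 : n + 1 - k + k ≤ n := by exact_mod_cast this
  omega

/-! ### The open Bruhat cell in the spin group -/

theorem upperPositive_mul {m : ℕ} {A B : Matrix (Fin m) (Fin m) ℝ} (hA : A ∈ upperPositive m)
    (hB : B ∈ upperPositive m) : A * B ∈ upperPositive m := by
  refine ⟨fun i j hij => ?_, fun i => ?_⟩
  · rw [Matrix.mul_apply]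
    refine Finset.sum_eq_zero fun k _ => ?_
    rcases lt_or_ge k i with h | h
    · rw [hA.1 i k h, zero_mul]
    · rw [hB.1 k j (lt_of_lt_of_le hij h), mul_zero]
  · rw [Matrix.mul_apply, Fintype.sum_eq_single i]
    · exact mul_pos (hA.2 i) (hB.2 i)
    · intro k hk
      rcases lt_or_gt_of_ne hk with h | h
      · rw [hA.1 i k h, zero_mul]
      · rw [hB.1 k i h, mul_zero]

theorem exists_inv_mem_upperPositive {m : ℕ} {U : Matrix (Fin m) (Fin m) ℝ}
    (hU : U ∈ upperPositive m) : ∃ V ∈ upperPositive m, U * V = 1 := by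
  have hdet : IsUnit U.det := (IsSmoothNondegenerate.det_upperPositive hU).ne'.isUnit
  let := Matrix.invertibleOfIsUnitDet U hdet
  have htri : U.BlockTriangular id := fun i j hij => hU.1 i j hij
  have hinv : ∀ i j, j < i → U⁻¹ i j = 0 := fun i j hij =>
    Matrix.blockTriangular_inv_of_blockTriangular htri hij
  have h1 : U * U⁻¹ = 1 := Matrix.mul_nonsing_inv _ hdet
  refine ⟨U⁻¹, ⟨hinv, fun i => ?_⟩, h1⟩
  have h2 := congrFun (congrFun h1 i) i
  rw [Matrix.mul_apply, Fintype.sum_eq_single i, Matrix.one_apply_eq] at h2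
  · exact pos_of_mul_pos_right (h2 ▸ one_pos) (hU.2 i).le
  · intro k hk
    rcases lt_or_gt_of_ne hk with h | h
    · rw [hU.1 i k h, zero_mul]
    · rw [hinv k i h, mul_zero]

theorem det_rotationProd (n : ℕ) (θ : ℝ) : (rotationProd n θ).det = 1 := by
  have : rotationProd n θ ∈ MonoidHom.mker (Matrix.detMonoidHom (R := ℝ) (n := Fin (n + 1))) := by
    refine blockProd_mem _ _ _ fun i hi => ?_
    -- With all rows and all columns the flag minor is the determinant.
    have h := flagMinor_mul_planeMatrix (m := n + 1) 1 (c := Real.cos θ) (q := -Real.sin θ)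
      (r := Real.sin θ) (by nlinarith [Real.sin_sq_add_cos_sq θ]) le_rfl (by omega : i + 2 ≤ n + 1)
      id
    rw [one_mul] at h
    exact h.trans Matrix.det_one
  exact this

/-- The elements covering rotations with positive southwest minors. -/
def southwestSpin (n : ℕ) : Set (Spin n) :=
  {z | (spinProj z).det = 1 ∧ SouthwestPositive (spinProj z)}

theorem spinPath_mem_southwestSpin {n : ℕ} {θ : ℝ} (h0 : 0 < θ) (hpi : θ < Real.pi) :
    spinPath n θ ∈ southwestSpin n := by
  rw [southwestSpin, Set.mem_ofPred_eq, spinProj_spinPath]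
  exact ⟨det_rotationProd n θ, southwestPositive_rotationProd h0 hpi⟩

theorem acuteEta_mem_southwestSpin (n : ℕ) : acuteEta n ∈ southwestSpin n := by
  rw [← spinPath_pi_div_two]
  exact spinPath_mem_southwestSpin (by positivity) (by linarith [Real.pi_pos])

/-- At θ = π/2 every factor is monomial, and southwest positivity then forces the antidiagonal
pattern, without following the permutation along the word. -/
theorem spinProj_acuteEta_apply {n : ℕ} (a b : Fin (n + 1)) (hab : (a : ℕ) + b ≠ n) :
    spinProj (acuteEta n) a b = 0 := by
  refine apply_eq_zero_of_monomial ?_ (acuteEta_mem_southwestSpin n).2 a b hab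
  rw [← spinPath_pi_div_two, spinProj_spinPath, rotationProd, Real.cos_pi_div_two]
  exact blockProd_mem _ _ _ fun i hi => planeMatrix_mem_monomialMatrices _ _ (by omega)

theorem spinProj_mul_transpose {n : ℕ} (z : Spin n) :
    spinProj z * (spinProj z).transpose = 1 :=
  mul_eq_one_comm.1 (transpose_spinProj_mul z)

theorem exists_spinProj_eq_of_mem_southwestSpin {n : ℕ} {z : Spin n} (hz : z ∈ southwestSpin n) :
    ∃ L ∈ lowerUnitriangular (n + 1), ∃ U ∈ upperPositive (n + 1),
      spinProj z = spinProj (acuteEta n) * (L * U) :=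
  SouthwestPositive.exists_eq_mul_lower_mul_upper spinProj_acuteEta_apply
    (spinProj_mul_transpose _) (acuteEta_mem_southwestSpin n).2 hz.2

/-- With H = Π(acute η), southwest positivity yields H L U = (H L Hᵀ) H U, and H L Hᵀ is upper
triangular. -/
theorem preimage_bruhatSO_acuteEta (n : ℕ) :
    spinProj ⁻¹' bruhatSO (spinProj (acuteEta n)) = southwestSpin n := by
  ext z
  constructor
  · rintro ⟨hz, U₀, hU₀, U₁, hU₁, h⟩
    refine ⟨(Matrix.mem_specialOrthogonalGroup_iff.1 hz).2, ?_⟩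
    rw [h]
    exact ((acuteEta_mem_southwestSpin n).2.upper_mul hU₀).mul_upper hU₁
  · intro hz
    obtain ⟨L, hL, U, hU, h⟩ := exists_spinProj_eq_of_mem_southwestSpin hz
    refine ⟨spinProj_mem_of_det hz.1, _, antidiagonal_mul_lower_mul_transpose
      spinProj_acuteEta_apply (spinProj_mul_transpose _) hL, U, hU, ?_⟩
    rw [h, mul_assoc _ (spinProj (acuteEta n)).transpose, transpose_spinProj_mul, mul_one, mul_assoc]

/-- The translate by y of the open cell projects into the triangular chart domain centred at the
projection of y · acute η, because the cell consists of products H L U. -/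
theorem mem_preimage_chartSO {n : ℕ} {y w : Spin n} (hy : (spinProj y).det = 1)
    (hw : y⁻¹ * w ∈ southwestSpin n) :
    w ∈ spinProj ⁻¹' chartSO (spinProj (y * acuteEta n)) := by
  obtain ⟨L, hL, U, hU, h⟩ := exists_spinProj_eq_of_mem_southwestSpin hw
  have hmul : spinProj w = spinProj y * spinProj (y⁻¹ * w) := by
    rw [← spinProj_mul, mul_inv_cancel_left]
  refine ⟨spinProj_mem_of_det ?_, L, hL, U, hU, ?_⟩
  · rw [hmul, Matrix.det_mul, hy, hw.1, one_mul]
  · rw [hmul, h, spinProj_mul, mul_assoc]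

theorem inv_mem_bruhatSpin_inv {n : ℕ} {z w : Spin n} (hw : w ∈ bruhatSpin z) :
    w⁻¹ ∈ bruhatSpin z⁻¹ := by
  -- `connectedComponentIn` is empty when its base point is outside the set; the existence of w
  -- excludes this.
  have hz : z ∈ spinProj ⁻¹' bruhatSO (spinProj z) :=
    connectedComponentIn_nonempty_iff.1 ⟨w, hw⟩
  have hsub : (fun x : Spin n => x⁻¹) '' bruhatSpin z ⊆ spinProj ⁻¹' bruhatSO (spinProj z⁻¹) := by
    rintro _ ⟨x, hx, rfl⟩
    obtain ⟨hSO, U₀, hU₀, U₁, hU₁, h⟩ := connectedComponentIn_subset _ _ hx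
    obtain ⟨V₀, hV₀, h₀⟩ := exists_inv_mem_upperPositive hU₀
    obtain ⟨V₁, hV₁, h₁⟩ := exists_inv_mem_upperPositive hU₁
    refine ⟨spinProj_mem_of_det ?_, V₁, hV₁, V₀, hV₀, ?_⟩
    · rw [spinProj_inv, Matrix.det_transpose]
      exact (Matrix.mem_specialOrthogonalGroup_iff.1 hSO).2
    · rw [spinProj_inv, spinProj_inv]
      have h2 : spinProj x * (V₁ * (spinProj z).transpose * V₀) = 1 := by
        calc spinProj x * (V₁ * (spinProj z).transpose * V₀)
            = U₀ * (spinProj z * (U₁ * V₁) * (spinProj z).transpose) * V₀ := by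
              rw [h]; simp only [mul_assoc]
          _ = 1 := by rw [h₁, mul_one, spinProj_mul_transpose, mul_one, h₀]
      calc (spinProj x).transpose
          = (spinProj x).transpose * (spinProj x * (V₁ * (spinProj z).transpose * V₀)) := by
            rw [h2, mul_one]
        _ = _ := by rw [← mul_assoc, transpose_spinProj_mul, one_mul]
  exact (isPreconnected_connectedComponentIn.image _
    continuous_spin_inv.continuousOn).subset_connectedComponentIn
      ⟨z, mem_connectedComponentIn hz, rfl⟩ hsub ⟨w, hw, rfl⟩

theorem mem_smul_bruhatSpin_graveEta_iff {n : ℕ} (x y : Spin n) :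
    x ∈ y • bruhatSpin (graveEta n) ↔ y ∈ x • bruhatSpin (acuteEta n) := by
  rw [Set.mem_smul_set_iff_inv_smul_mem, Set.mem_smul_set_iff_inv_smul_mem, smul_eq_mul, smul_eq_mul,
    graveEta_eq_inv]
  constructor
  · intro h
    simpa using inv_mem_bruhatSpin_inv h
  · intro h
    simpa using inv_mem_bruhatSpin_inv h

/-! ### Lifted Frenet frames -/

section Lift

variable {n : ℕ} {γ : ℝ → Euc n} {a b : ℝ} {Γ : ℝ → Spin n}

/-- Frame and Wronski matrix at t differ by a right factor in Up⁺, which does not affect positivity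
of southwest minors. -/
theorem inv_mul_mem_southwestSpin_iff (h : IsSmoothNondegenerate γ (Set.Icc a b))
    (hΓ : IsFrenetLift Γ γ (Set.Icc a b)) {t₀ t : ℝ} (ht₀ : t₀ ∈ Set.Icc a b)
    (ht : t ∈ Set.Icc a b) (θ : ℝ) :
    spinPath n θ * ((Γ t₀)⁻¹ * Γ t) ∈ southwestSpin n ↔
      SouthwestPositive (rotationProd n θ * ((frenetFrame γ (Set.Icc a b) t₀).transpose *
        wronskiMatrix γ (Set.Icc a b) t)) := by
  have hproj : spinProj (spinPath n θ * ((Γ t₀)⁻¹ * Γ t)) = rotationProd n θ *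
      ((frenetFrame γ (Set.Icc a b) t₀).transpose * frenetFrame γ (Set.Icc a b) t) := by
    rw [spinProj_mul, spinProj_mul, spinProj_inv, hΓ.proj_eq t₀ ht₀, hΓ.proj_eq t ht,
      spinProj_spinPath]
  have hdet : (spinProj (spinPath n θ * ((Γ t₀)⁻¹ * Γ t))).det = 1 := by
    rw [hproj, Matrix.det_mul, Matrix.det_mul, Matrix.det_transpose, det_rotationProd,
      h.det_frenetFrame ht₀, h.det_frenetFrame ht]
    norm_num
  have hW : rotationProd n θ * ((frenetFrame γ (Set.Icc a b) t₀).transpose *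
      wronskiMatrix γ (Set.Icc a b) t) = spinProj (spinPath n θ * ((Γ t₀)⁻¹ * Γ t)) *
        ((frenetFrame γ (Set.Icc a b) t).transpose * wronskiMatrix γ (Set.Icc a b) t) := by
    conv_lhs => rw [h.wronskiMatrix_eq ht]
    rw [hproj]
    simp only [mul_assoc]
  have hT := h.transpose_frenetFrame_mul_wronskiMatrix ht
  rw [hW]
  exact ⟨fun hz => hz.2.mul_upper hT, fun hz => ⟨hdet, hz.of_mul_upper hT⟩⟩

theorem inv_mul_mem_southwestSpin_iff' (h : IsSmoothNondegenerate γ (Set.Icc a b))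
    (hΓ : IsFrenetLift Γ γ (Set.Icc a b)) {t₀ t : ℝ} (ht₀ : t₀ ∈ Set.Icc a b)
    (ht : t ∈ Set.Icc a b) :
    (Γ t₀)⁻¹ * Γ t ∈ southwestSpin n ↔
      SouthwestPositive ((frenetFrame γ (Set.Icc a b) t₀).transpose *
        wronskiMatrix γ (Set.Icc a b) t) := by
  have := inv_mul_mem_southwestSpin_iff h hΓ ht₀ ht 0
  rwa [spinPath_zero, one_mul, rotationProd_zero, one_mul] at this

/-- If all frames after `t₀` have positive southwest minors relatively to the frame at `t₀`, then
they lie in the Bruhat cell of `acuteEta n`. -/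
theorem mem_smul_bruhatSpin_acuteEta (h : IsSmoothNondegenerate γ (Set.Icc a b))
    (hΓ : IsFrenetLift Γ γ (Set.Icc a b)) {t₀ t₁ : ℝ} (ht₀ : t₀ ∈ Set.Icc a b)
    (ht₁ : t₁ ∈ Set.Icc a b) (hlt : t₀ < t₁)
    (hpos : ∀ t ∈ Set.Ioc t₀ t₁, (Γ t₀)⁻¹ * Γ t ∈ southwestSpin n) :
    Γ t₁ ∈ Γ t₀ • bruhatSpin (acuteEta n) := by
  rw [Set.mem_smul_set_iff_inv_smul_mem, smul_eq_mul, bruhatSpin, preimage_bruhatSO_acuteEta]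
  obtain ⟨ε, hε, hloc⟩ := (h.isWronskianFrom ht₀ (hlt.trans_le ht₁.2)).exists_southwestPositive
  obtain ⟨δ, hδ, hδε, hδt, hδπ⟩ : ∃ δ > 0, δ + δ ≤ ε ∧ t₀ + δ ≤ t₁ ∧ δ ≤ Real.pi / 2 :=
    ⟨min (ε / 2) (min (t₁ - t₀) (Real.pi / 2)),
      lt_min (by positivity) (lt_min (by linarith) (by positivity)),
      by linarith [min_le_left (ε / 2) (min (t₁ - t₀) (Real.pi / 2))],
      by linarith [(min_le_right (ε / 2) (min (t₁ - t₀) (Real.pi / 2))).trans (min_le_left _ _)],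
      (min_le_right _ _).trans (min_le_right _ _)⟩
  have hJ : ∀ t, t₀ ≤ t → t ≤ t₁ → t ∈ Set.Icc a b := fun t h1 h2 =>
    ⟨ht₀.1.trans h1, h2.trans ht₁.2⟩
  have hX : ContinuousOn (fun t => (Γ t₀)⁻¹ * Γ t) (Set.Icc a b) :=
    (continuous_spin_mul_left _).comp_continuousOn hΓ.continuousOn
  have hmem : ∀ θ t, 0 ≤ θ → t₀ ≤ t → 0 < θ + (t - t₀) → θ ≤ δ → t ≤ t₀ + δ →
      spinPath n θ * ((Γ t₀)⁻¹ * Γ t) ∈ southwestSpin n := by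
    intro θ t h1 h2 h3 h4 h5
    rw [inv_mul_mem_southwestSpin_iff h hΓ ht₀ (hJ t h2 (h5.trans hδt))]
    have := hloc θ (t - t₀) h1 (by linarith) h3 (by linarith)
    simpa using this
  -- A connected set in the cell joins acute η to Γ(t₀)⁻¹ Γ(t₁) in four arcs: θ falls from π/2 to δ
  -- at t = t₀, t moves to t₀ + δ, θ falls to 0, and t moves on to t₁. The detour avoids θ = 0, t =
  -- t₀, where the product is 1.
  have hS1 : IsPreconnected (spinPath n '' Set.Icc δ (Real.pi / 2)) :=
    isPreconnected_Icc.image _ (continuous_spinPath n).continuousOn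
  have hS2 : IsPreconnected ((fun t => spinPath n δ * ((Γ t₀)⁻¹ * Γ t)) '' Set.Icc t₀ (t₀ + δ)) :=
    isPreconnected_Icc.image _ ((continuous_spin_mul_left _).comp_continuousOn
      (hX.mono fun t ht => hJ t ht.1 (ht.2.trans hδt)))
  have hS3 : IsPreconnected
      ((fun θ => spinPath n θ * ((Γ t₀)⁻¹ * Γ (t₀ + δ))) '' Set.Icc 0 δ) :=
    isPreconnected_Icc.image _
      ((continuous_spin_mul_right _).comp (continuous_spinPath n)).continuousOn
  have hS4 : IsPreconnected ((fun t => (Γ t₀)⁻¹ * Γ t) '' Set.Icc (t₀ + δ) t₁) :=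
    isPreconnected_Icc.image _ (hX.mono fun t ht => hJ t (by linarith [ht.1]) ht.2)
  have hS := ((hS1.union (spinPath n δ) (by exact ⟨δ, ⟨le_rfl, hδπ⟩, rfl⟩)
      (by exact ⟨t₀, ⟨le_rfl, by linarith⟩, by simp⟩) hS2).union
    (spinPath n δ * ((Γ t₀)⁻¹ * Γ (t₀ + δ)))
      (by exact Or.inr ⟨t₀ + δ, ⟨by linarith, le_rfl⟩, rfl⟩)
      (by exact ⟨δ, ⟨hδ.le, le_rfl⟩, rfl⟩) hS3).union
    ((Γ t₀)⁻¹ * Γ (t₀ + δ)) (by exact Or.inr ⟨0, ⟨le_rfl, hδ.le⟩, by simp [spinPath_zero]⟩)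
      (by exact ⟨t₀ + δ, ⟨le_rfl, hδt⟩, rfl⟩) hS4
  refine hS.subset_connectedComponentIn ?_ ?_ (Or.inr ⟨t₁, ⟨hδt, le_rfl⟩, rfl⟩)
  · exact Or.inl (Or.inl (Or.inl ⟨Real.pi / 2, ⟨hδπ, le_rfl⟩, spinPath_pi_div_two n⟩))
  · rintro _ (((⟨θ, hθ, rfl⟩ | ⟨t, ht, rfl⟩) | ⟨θ, hθ, rfl⟩) | ⟨t, ht, rfl⟩)
    · exact spinPath_mem_southwestSpin (hδ.trans_le hθ.1) (by linarith [hθ.2, Real.pi_pos])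
    · exact hmem δ t hδ.le ht.1 (by linarith [ht.1]) le_rfl ht.2
    · exact hmem θ (t₀ + δ) hθ.1 (by linarith) (by linarith [hθ.1]) hθ.2 le_rfl
    · exact hpos t ⟨by linarith [ht.1], ht.2⟩

/-- Just after t₀ the minors are positive for any nondegenerate curve. Convexity forbids zeroes at
later times, so by the intermediate value theorem the sign persists. -/
theorem IsStrictlyConvexCurve.southwestPositive (hab : a < b)
    (h : IsSmoothNondegenerate γ (Set.Icc a b)) (hconv : IsStrictlyConvexCurve γ (Set.Icc a b))
    {t₀ t₁ : ℝ} (ht₀ : t₀ ∈ Set.Icc a b) (ht₁ : t₁ ∈ Set.Icc a b) (hlt : t₀ < t₁) :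
    SouthwestPositive ((frenetFrame γ (Set.Icc a b) t₀).transpose *
      wronskiMatrix γ (Set.Icc a b) t₁) := by
  intro k hk
  by_contra hneg
  obtain ⟨ε, hε, hloc⟩ := (h.isWronskianFrom ht₀ (hlt.trans_le ht₁.2)).exists_southwestPositive
  obtain ⟨δ, hδ, hδε, hδt⟩ : ∃ δ > 0, δ ≤ ε ∧ t₀ + δ ≤ t₁ :=
    ⟨min ε (t₁ - t₀), lt_min hε (by linarith), min_le_left _ _,
      by linarith [min_le_right ε (t₁ - t₀)]⟩
  have h1 := hloc 0 δ le_rfl hδ.le (by linarith) (by linarith) k hk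
  rw [rotationProd_zero, one_mul] at h1
  have hcont : ContinuousOn (fun t => flagMinor ((frenetFrame γ (Set.Icc a b) t₀).transpose *
      wronskiMatrix γ (Set.Icc a b) t) hk (rowWindow (n + 1 - k) k (Nat.sub_add_cancel hk).le))
      (Set.Icc (t₀ + δ) t₁) :=
    ((continuous_flagMinor hk _).comp (continuous_const.matrix_mul continuous_id)).comp_continuousOn
      ((h.continuousOn_wronskiMatrix hab).mono
        (Set.Icc_subset_Icc (by linarith [ht₀.1]) ht₁.2))
  obtain ⟨t, ht, ht0⟩ := intermediate_value_Icc' hδt hcont ⟨not_lt.1 hneg, h1.le⟩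
  exact IsStrictlyConvexCurve.flagMinor_ne_zero hab h hconv ht₀
    ⟨by linarith [ht.1, ht₀.1], ht.2.trans ht₁.2⟩ (by linarith [ht.1] : t₀ < t).ne hk ht0

/-- If all frames after the initial one lie in the open Bruhat cell of the initial frame, then the
lifted frames lie in a triangular chart. -/
theorem isShort_of_mem_southwestSpin (hab : a < b) (h : IsSmoothNondegenerate γ (Set.Icc a b))
    (hΓ : IsFrenetLift Γ γ (Set.Icc a b))
    (hpos : ∀ t ∈ Set.Ioc a b, (Γ a)⁻¹ * Γ t ∈ southwestSpin n) :
    IsShort Γ (Set.Icc a b) := by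
  have ha : a ∈ Set.Icc a b := ⟨le_rfl, hab.le⟩
  obtain ⟨ε, hε, hloc⟩ := (h.isWronskianFrom ha hab).exists_southwestPositive
  set G : ℝ → Matrix (Fin (n + 1)) (Fin (n + 1)) ℝ := fun t =>
    (frenetFrame γ (Set.Icc a b) a).transpose * wronskiMatrix γ (Set.Icc a b) t with hG
  -- Away from a, positivity is an open condition on a compact interval and survives a small
  -- rotation; near a, where G(a) itself is not in the cell, the local lemma takes over.
  have hfar : ∀ᶠ θ in 𝓝 (0 : ℝ), ∀ t ∈ Set.Icc (a + ε / 2) b,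
      t ∈ Set.Icc (a + ε / 2) b → SouthwestPositive (rotationProd n θ * G t) := by
    refine isCompact_Icc.eventually_forall_of_forall_eventually
      (P := fun θ t => t ∈ Set.Icc (a + ε / 2) b → SouthwestPositive (rotationProd n θ * G t))
      fun t ht => ?_
    have hsub : Set.Icc (a + ε / 2) b ⊆ Set.Icc a b := Set.Icc_subset_Icc_left (by linarith)
    have hGc : ContinuousWithinAt G (Set.Icc (a + ε / 2) b) t :=
      (((continuous_const.matrix_mul continuous_id).comp_continuousOn
        (h.continuousOn_wronskiMatrix hab)).mono hsub) t ht
    have hlim : Tendsto (fun z : ℝ × ℝ => rotationProd n z.1 * G z.2)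
        (𝓝[Prod.snd ⁻¹' Set.Icc (a + ε / 2) b] (0, t)) (𝓝 (rotationProd n 0 * G t)) := by
      have h1 : Tendsto (fun z : ℝ × ℝ => rotationProd n z.1)
          (𝓝[Prod.snd ⁻¹' Set.Icc (a + ε / 2) b] (0, t)) (𝓝 (rotationProd n 0)) :=
        (((continuous_rotationProd n).comp continuous_fst).tendsto (0, t)).mono_left
          nhdsWithin_le_nhds
      have h2 : Tendsto (fun z : ℝ × ℝ => G z.2)
          (𝓝[Prod.snd ⁻¹' Set.Icc (a + ε / 2) b] (0, t)) (𝓝 (G t)) :=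
        hGc.tendsto.comp (continuous_snd.continuousWithinAt.tendsto_nhdsWithin
          fun _ hz => hz)
      exact ((continuous_fst.matrix_mul continuous_snd).tendsto (rotationProd n 0, G t)).comp
        (h1.prodMk_nhds h2)
    have hGpos : SouthwestPositive (rotationProd n 0 * G t) := by
      rw [rotationProd_zero, one_mul]
      exact (inv_mul_mem_southwestSpin_iff' h hΓ ha (hsub ht)).1
        (hpos t ⟨by linarith [ht.1], ht.2⟩)
    have hall : ∀ᶠ z in 𝓝[Prod.snd ⁻¹' Set.Icc (a + ε / 2) b] ((0 : ℝ), t), ∀ k : Fin (n + 2),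
        0 < flagMinor (rotationProd n z.1 * G z.2) (Nat.lt_succ_iff.1 k.2)
          (rowWindow (n + 1 - k) k (Nat.sub_add_cancel (Nat.lt_succ_iff.1 k.2)).le) :=
      eventually_all.2 fun k =>
        (((continuous_flagMinor _ _).tendsto _).comp hlim).eventually_const_lt (hGpos k _)
    filter_upwards [eventually_nhdsWithin_iff.1 hall] with z hz hzt k hk
    exact hz hzt ⟨k, by omega⟩
  obtain ⟨δ, hδ, hball⟩ := Metric.eventually_nhds_iff.1 hfar
  obtain ⟨θ, hθ, hθδ, hθε, hθπ⟩ : ∃ θ > 0, θ < δ ∧ θ ≤ ε / 2 ∧ θ ≤ Real.pi / 2 :=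
    ⟨min (δ / 2) (min (ε / 2) (Real.pi / 2)),
      lt_min (by positivity) (lt_min (by positivity) (by positivity)),
      (min_le_left _ _).trans_lt (by linarith), (min_le_right _ _).trans (min_le_left _ _),
      (min_le_right _ _).trans (min_le_right _ _)⟩
  have hall : ∀ t ∈ Set.Icc a b, spinPath n θ * ((Γ a)⁻¹ * Γ t) ∈ southwestSpin n := by
    intro t ht
    rw [inv_mul_mem_southwestSpin_iff h hΓ ha ht]
    rcases le_total t (a + ε / 2) with hle | hle
    · have := hloc θ (t - a) hθ.le (by linarith [ht.1]) (by linarith [ht.1]) (by linarith)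
      simpa using this
    · exact hball (by rw [Real.dist_eq, sub_zero, abs_of_pos hθ]; exact hθδ) t ⟨hle, ht.2⟩
        ⟨hle, ht.2⟩
  -- Chosen so that y⁻¹ Γ(t) is the rotated frame just shown to lie in the cell. The arc y ·
  -- `spinPath n s`, s ∈ [θ, π/2], joins Γ(a) to the chart's centre y · acute η and fixes the
  -- component.
  set y : Spin n := Γ a * (spinPath n θ)⁻¹ with hy
  have hydet : (spinProj y).det = 1 := by
    rw [hy, spinProj_mul, spinProj_inv, Matrix.det_mul, Matrix.det_transpose, spinProj_spinPath,
      det_rotationProd, hΓ.proj_eq a ha, h.det_frenetFrame ha, one_mul]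
  have hS1 : IsPreconnected ((fun s => y * spinPath n s) '' Set.Icc θ (Real.pi / 2)) :=
    isPreconnected_Icc.image _
      ((continuous_spin_mul_left y).comp (continuous_spinPath n)).continuousOn
  have hS2 : IsPreconnected (Γ '' Set.Icc a b) := isPreconnected_Icc.image _ hΓ.continuousOn
  have hS := hS1.union (Γ a) (by exact ⟨θ, ⟨le_rfl, hθπ⟩, by simp [hy]⟩)
    (by exact ⟨a, ha, rfl⟩) hS2
  refine ⟨y * acuteEta n, Set.subset_union_right.trans (hS.subset_connectedComponentIn
    (Or.inl ⟨Real.pi / 2, ⟨hθπ, le_rfl⟩, by simp only [spinPath_pi_div_two]⟩) ?_)⟩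
  rintro _ (⟨s, hs, rfl⟩ | ⟨t, ht, rfl⟩)
  · refine mem_preimage_chartSO hydet ?_
    rw [inv_mul_cancel_left]
    exact spinPath_mem_southwestSpin (hθ.trans_le hs.1) (by linarith [hs.2, Real.pi_pos])
  · refine mem_preimage_chartSO hydet ?_
    rw [hy, mul_inv_rev, inv_inv, mul_assoc]
    exact hall t ht

/-- Only the projected chart matters here: Π(z)ᵀ F = L U, and W = F T with T in Up⁺, give the
factorization Π(z)ᵀ W = L (U T) on all of J. -/
theorem IsShort.isStrictlyConvexCurve (hab : a < b) (h : IsSmoothNondegenerate γ (Set.Icc a b))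
    (hΓ : IsFrenetLift Γ γ (Set.Icc a b)) (hshort : IsShort Γ (Set.Icc a b)) :
    IsStrictlyConvexCurve γ (Set.Icc a b) := by
  obtain ⟨z, hz⟩ := hshort
  refine isStrictlyConvexCurve_of_lower_mul_upper hab h (transpose_spinProj_mul z) fun t ht => ?_
  obtain ⟨-, L, hL, U, hU, e⟩ := connectedComponentIn_subset _ _ (hz ⟨t, ht, rfl⟩)
  refine ⟨L, hL, _, upperPositive_mul hU (h.transpose_frenetFrame_mul_wronskiMatrix ht), ?_⟩
  have hF := (hΓ.proj_eq t ht).symm.trans e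
  have hW := h.wronskiMatrix_eq ht
  generalize (frenetFrame γ (Set.Icc a b) t).transpose * wronskiMatrix γ (Set.Icc a b) t = T at hW ⊢
  rw [hW, hF, mul_assoc, ← mul_assoc _ (spinProj z), transpose_spinProj_mul, one_mul, mul_assoc]

end Lift

end

theorem mainTheorem4 (n : ℕ) (hn : 2 ≤ n) (a b : ℝ) (hab : a < b) (γ : ℝ → Euc n)
    (hγ : IsSmoothNondegenerate γ (Set.Icc a b))
    (Γ : ℝ → Spin n) (hΓ : IsFrenetLift Γ γ (Set.Icc a b)) :
    List.TFAE [
      IsStrictlyConvexCurve γ (Set.Icc a b),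
      IsShort Γ (Set.Icc a b),
      ∀ t₀ ∈ Set.Icc a b, ∀ t₁ ∈ Set.Icc a b, t₀ < t₁ →
        Γ t₁ ∈ Γ t₀ • bruhatSpin (acuteEta n),
      ∀ t₀ ∈ Set.Icc a b, ∀ t₁ ∈ Set.Icc a b, t₁ < t₀ →
        Γ t₁ ∈ Γ t₀ • bruhatSpin (graveEta n)] := by
  tfae_have 1 → 3 := fun hconv t₀ ht₀ t₁ ht₁ hlt =>
    mem_smul_bruhatSpin_acuteEta hγ hΓ ht₀ ht₁ hlt fun t ht =>
      (inv_mul_mem_southwestSpin_iff' hγ hΓ ht₀ ⟨ht₀.1.trans ht.1.le, ht.2.trans ht₁.2⟩).2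
        (hconv.southwestPositive hab hγ ht₀ ⟨ht₀.1.trans ht.1.le, ht.2.trans ht₁.2⟩ ht.1)
  -- Condition 3 enters only through t₀ = a and the projection of the cell to SO.
  tfae_have 3 → 2 := fun h3 => isShort_of_mem_southwestSpin hab hγ hΓ fun t ht => by
    have h := h3 a ⟨le_rfl, hab.le⟩ t ⟨ht.1.le, ht.2⟩ ht.1
    rw [Set.mem_smul_set_iff_inv_smul_mem, smul_eq_mul] at h
    rw [← preimage_bruhatSO_acuteEta]
    exact connectedComponentIn_subset _ _ h
  tfae_have 2 → 1 := fun h2 => h2.isStrictlyConvexCurve hab hγ hΓ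
  tfae_have 3 ↔ 4 :=
    ⟨fun h t₀ ht₀ t₁ ht₁ hlt => (mem_smul_bruhatSpin_graveEta_iff _ _).2 (h t₁ ht₁ t₀ ht₀ hlt),
      fun h t₀ ht₀ t₁ ht₁ hlt => (mem_smul_bruhatSpin_graveEta_iff _ _).1 (h t₁ ht₁ t₀ ht₀ hlt)⟩
  tfae_finish
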